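/- Let $d\ge 1$ and $\gamma\in\mathbb R$, with $\gamma>0$ if $d\ge2$ and $\gamma>1/2$ if $d=1$. For $0\le V\in L^{\gamma+d/2}(\mathbb R^d)$ let $\lambda_j(-\Delta-V)$, $j\ge1$, denote the $j$-th min-max level of $-\Delta-V$, i.e. the infimum over $j$-dimensional subspaces $E\subset H^1(\mathbb R^d)$ of $\sup\{\int|\nabla u|^2-\int V|u|^2:\ u\in E,\ \|u\|_{L^2}=1\}$ (the $j$-th negative eigenvalue counted with multiplicity if it exists, and $0$ otherwise). For an integer $N\ge1$ put $$L^{(N)}_{\gamma,d}=\sup_{\substack{0\le V\in L^{\gamma+d/2}(\mathbb R^d)\\ V\ne0}}\frac{\sum_{j=1}^N|\lambda_j(-\Delta-V)|^\gamma}{\int_{\mathbb R^d}V^{\gamma+d/2}};$$ a maximizer for $L^{(N)}_{\gamma,d}$ is a nonzero $0\le V\in L^{\gamma+d/2}(\mathbb R^d)$ that attains this supremum. **Theorem (Bubble decomposition, subcritical case).** Let $N\ge1$ and let $(V_n)$ be a normalized maximizing sequence for $L^{(N)}_{\gamma,d}$, that is, $0\le V_n\in L^{\gamma+d/2}(\mathbb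 R^d)$ with $$\int_{\mathbb R^d}V_n^{\gamma+d/2}=1,\qquad \lim_{n\to\infty}\sum_{j=1}^N|\lambda_j(-\Delta-V_n)|^\gamma=L^{(N)}_{\gamma,d}.$$ Then there exist $K\ge1$ and * integers $N_1,\dots,N_K\ge1$ with $\sum_{k=1}^KN_k=N$ and $L^{(N_k)}_{\gamma,d}=L^{(N)}_{\gamma,d}$ for all $k$; * nonnegative functions $0\ne V^{(k)}\in L^{\gamma+d/2}(\mathbb R^d)$, $k=1,\dots,K$, such that $V^{(k)}$ is a maximizer for $L^{(N_k)}_{\gamma,d}$, satisfies $\lambda_{N_k+1}(-\Delta-V^{(k)})=0$ if $N_k<N$, and is also a maximizer for $L^{(N)}_{\gamma,d}$; * sequences $(x^{(k)}_n)_n$ in $\mathbb R^d$, $k=1,\dots,K$, with $\lim_{n\to\infty}|x^{(k)}_n-x^{(k')}_n|=+\infty$ for all $k\ne k'$; such that, along a subsequence, $$\lim_{n\to\infty}\Big\|V_n-\sum_{k=1}^KV^{(k)}(\cdot-x^{(k)}_n)\Big\|_{L^{\gamma+d/2}(\mathbb R^d)}=0.$$ -/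

import Mathlib

open MeasureTheory Filter Topology
open scoped ENNReal ContDiff

namespace LiebThirring

noncomputable section

/-- `ℝ^d` with its Euclidean structure and Lebesgue measure. -/
abbrev Space (d : ℕ) : Type := EuclideanSpace ℝ (Fin d)

/-- The complex Hilbert space `L²(ℝ^d)`. -/
abbrev L2 (d : ℕ) : Type := Lp ℂ 2 (volume : Measure (Space d))

/-- `g` is the weak partial derivative `∂ᵢ u`, i.e. `∫ u ∂ᵢφ = - ∫ g φ` for every real
test function `φ ∈ C_c^∞(ℝ^d)`. -/
def IsWeakPartial {d : ℕ} (i : Fin d) (u g : L2 d) : Prop :=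
  ∀ φ : Space d → ℝ, ContDiff ℝ ∞ φ → HasCompactSupport φ →
    ∫ x, fderiv ℝ φ x (EuclideanSpace.single i 1) • u x = - ∫ x, φ x • g x

theorem integrable_smul_L2 {d : ℕ} {φ : Space d → ℝ} (hφ : Continuous φ)
    (hc : HasCompactSupport φ) (u : L2 d) : Integrable (fun x => φ x • u x) :=
  ((Lp.memLp u).locallyIntegrable (by norm_num)).integrable_smul_left_of_hasCompactSupport hφ hc

theorem IsWeakPartial.zero {d : ℕ} (i : Fin d) : IsWeakPartial i (0 : L2 d) 0 := by
  intro φ _ _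
  rw [integral_eq_zero_of_ae, integral_eq_zero_of_ae, neg_zero]
  · exact ae_of_all _ fun x => by simp
  · exact ae_of_all _ fun x => by simp

theorem IsWeakPartial.add {d : ℕ} {i : Fin d} {u v g h : L2 d}
    (hu : IsWeakPartial i u g) (hv : IsWeakPartial i v h) : IsWeakPartial i (u + v) (g + h) := by
  intro φ hφ hc
  have key : ∀ (ψ : Space d → ℝ), Continuous ψ → HasCompactSupport ψ → ∀ a b : L2 d,
      ∫ x, ψ x • (a + b : L2 d) x = (∫ x, ψ x • a x) + ∫ x, ψ x • b x := by
    intro ψ hψ hψc a b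
    rw [← integral_add (integrable_smul_L2 hψ hψc a) (integrable_smul_L2 hψ hψc b)]
    refine integral_congr_ae ?_
    filter_upwards [Lp.coeFn_add a b] with x hx
    rw [hx, Pi.add_apply, smul_add]
  have hd : Continuous fun x => fderiv ℝ φ x (EuclideanSpace.single i 1) :=
    (hφ.continuous_fderiv (by simp)).clm_apply continuous_const
  have hdc : HasCompactSupport fun x => fderiv ℝ φ x (EuclideanSpace.single i 1) :=
    hc.fderiv_apply ℝ _
  rw [key _ hd hdc, key _ hφ.continuous hc, hu φ hφ hc, hv φ hφ hc, neg_add]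

theorem IsWeakPartial.smul {d : ℕ} {i : Fin d} {u g : L2 d} (c : ℂ)
    (hu : IsWeakPartial i u g) : IsWeakPartial i (c • u) (c • g) := by
  intro φ hφ hc
  have key : ∀ (ψ : Space d → ℝ) (a : L2 d),
      ∫ x, ψ x • (c • a : L2 d) x = c • ∫ x, ψ x • a x := by
    intro ψ a
    rw [← integral_smul]
    refine integral_congr_ae ?_
    filter_upwards [Lp.coeFn_smul c a] with x hx
    rw [hx, Pi.smul_apply, smul_comm]
  rw [key, key, hu φ hφ hc, smul_neg]

/-- The Sobolev space `H¹(ℝ^d)`: a pair `p` consists of `p.1 = u ∈ L²(ℝ^d)` and its weak gradient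
`p.2 = ∇u ∈ L²(ℝ^d)^d` (which is determined by `u`). -/
def H1 (d : ℕ) : Submodule ℂ (L2 d × (Fin d → L2 d)) where
  carrier := {p | ∀ i, IsWeakPartial i p.1 (p.2 i)}
  zero_mem' := fun i => IsWeakPartial.zero i
  add_mem' := fun ha hb i => (ha i).add (hb i)
  smul_mem' := fun c _ ha i => (ha i).smul c

/-- The quadratic form `u ↦ ∫ |∇u|² - ∫ V |u|²` of the operator `-Δ - V` on `H¹(ℝ^d)`. -/
def energy {d : ℕ} (V : Space d → ℝ) (u : H1 d) : ℝ :=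
  ∑ i, ‖u.1.2 i‖ ^ 2 - ∫ x, V x * ‖u.1.1 x‖ ^ 2

/-- The `j`-th min-max level `λ_j(-Δ - V)`, `j ≥ 1`: the infimum over all `j`-dimensional subspaces
`E` of `H¹(ℝ^d)` of the supremum of the quadratic form over the `L²`-normalized `u ∈ E`. -/
def level {d : ℕ} (V : Space d → ℝ) (j : ℕ) : EReal :=
  ⨅ (E : Submodule ℂ (H1 d)) (_ : Module.finrank ℂ E = j),
    ⨆ (u : H1 d) (_ : u ∈ E) (_ : ‖u.1.1‖ = 1), (energy V u : EReal)

/-- `∑_{j=1}^N |λ_j(-Δ - V)|^γ`. -/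
def rieszSum {d : ℕ} (γ : ℝ) (N : ℕ) (V : Space d → ℝ) : ℝ≥0∞ :=
  ∑ j ∈ Finset.Icc 1 N, (level V j).abs ^ γ

/-- `∫ V_+^{γ + d/2}`. -/
def mass {d : ℕ} (γ : ℝ) (V : Space d → ℝ) : ℝ≥0∞ :=
  ∫⁻ x, ENNReal.ofReal (V x) ^ (γ + (d : ℝ) / 2)

/-- The potential `V` is nonnegative (almost everywhere) and lies in `L^{γ + d/2}(ℝ^d)`. -/
def IsPotential {d : ℕ} (γ : ℝ) (V : Space d → ℝ) : Prop :=
  0 ≤ᵐ[volume] V ∧ MemLp V (ENNReal.ofReal (γ + (d : ℝ) / 2)) volume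

/-- The best constant `L^{(N)}_{γ,d}` in the finite-rank Lieb-Thirring inequality. -/
def bestConst (d : ℕ) (γ : ℝ) (N : ℕ) : ℝ≥0∞ :=
  ⨆ (V : Space d → ℝ) (_ : IsPotential γ V) (_ : ¬ V =ᵐ[volume] 0), rieszSum γ N V / mass γ V

/-- `V` is a maximizer for `L^{(N)}_{γ,d}`: a nontrivial nonnegative potential which realizes the
supremum defining `L^{(N)}_{γ,d}`. -/
def IsMaximizer {d : ℕ} (γ : ℝ) (N : ℕ) (V : Space d → ℝ) : Prop :=
  IsPotential γ V ∧ ¬ V =ᵐ[volume] 0 ∧ rieszSum γ N V / mass γ V = bestConst d γ N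

/-- `(V_n)` is a normalized maximizing sequence for `L^{(N)}_{γ,d}`. -/
def IsNormalizedMaximizingSeq {d : ℕ} (γ : ℝ) (N : ℕ) (V : ℕ → Space d → ℝ) : Prop :=
  (∀ n, IsPotential γ (V n)) ∧ (∀ n, mass γ (V n) = 1) ∧
    Tendsto (fun n => rieszSum γ N (V n)) atTop (𝓝 (bestConst d γ N))

end

end LiebThirring

open scoped FourierTransform SchwartzMap LineDeriv

namespace LiebThirring

noncomputable section

/-! ### Smooth cutoff functions -/

/-! Put p = γ + d/2 and L = L^(N). The hypotheses on γ amount to p > 1 and d < 2p. Bubbles are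
peeled off one at a time from sequences with ∫ V_n^p → m, 0 < m < ∞, and N-th Riesz sum → L m. The
mass m is left free so that the remainder is again a sequence of this kind and strong induction on N
applies (`exists_bubbles`).

One bubble (`exists_bubble`). Since L m > 0, the lowest level stays below some -t < 0. Averaging a
cut-off trial function over all centres shows that some ball of fixed radius already binds
(`exists_localized`). After recentring there, a subsequence U_n converges weakly to some W, and W ≠
0 because negative subspaces of potentials cut to a fixed ball survive in the weak limit
(`WeakTo.eventually_hasNegSubspace`). Now let r_n → ∞ slowly enough that negative subspaces of U_n
restricted to B(2 r_n) pass to W with vanishing error. A quadratic partition of unity at scale r_n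
costs O(r_n^-2) in energy, and a dimension count for Hermitian forms (`exists_neg_of_split`) turns
the splitting of the energy into μ_(a+b+1) ≤ max(|λ_(a+1)(W)|, ν_(b+1)) for the limiting absolute
levels μ of U_n and ν of its part outside B(r_n) (`level_limit_le`). Spending the N levels greedily
gives a + b = N with L m ≤ Σ_(j≤a) |λ_j(W)|^γ + Σ_(j≤b) ν_j^γ ≤ L^(a) ∫ W^p + L^(b) m₁ ≤ L (α + m₁)
= L m, where α and m₁ are the limiting masses inside and outside B(r_n). They add up exactly because
the potential is cut by indicators; ∫ W^p ≤ α is weak lower semicontinuity, and L^(a), L^(b) ≤ L. So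
all inequalities are equalities (`splitting_eq`): W is a maximizer for a levels with L^(a) = L; the
inner mass converges to ∫ W^p, which upgrades weak to strong convergence
(`WeakTo.tendsto_eLpNorm_sub`); and the outer part either vanishes in the limit or is maximizing for
b < N levels with L^(b) = L.

The remainder vanishes on growing balls, so later centres run away from the current one
(`tendsto_norm_center`). A maximizer for M < N levels with L^(M) = L^(N) is one for N levels and has
no further negative level, since that level would push its quotient above L
(`IsMaximizer.of_bestConst_eq`).

The analytic input is a subcritical Sobolev bound for q = 2p/(p-1) with small high-frequency part,
obtained by summing dyadic frequency blocks (`eLpNorm_highpass_le`). It bounds the potential energy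
relative to the kinetic energy, and also replaces Rellich's theorem: the low frequencies are bounded
and Lipschitz, and weak convergence is uniform on such functions. -/

/-- A smooth function vanishing on the unit ball and equal to one outside the ball of radius 2. -/
def ramp {d : ℕ} (x : Space d) : ℝ := Real.smoothTransition ((‖x‖ ^ 2 - 1) / 3)

/-- A smooth function equal to one on `B(c, R)` and vanishing outside `B(c, 2R)`. -/
def innerCut {d : ℕ} (c : Space d) (R : ℝ) (x : Space d) : ℝ :=
  Real.cos (Real.pi / 2 * ramp (R⁻¹ • (x - c)))

/-- A smooth function vanishing on `B(c, R)` and equal to one outside `B(c, 2R)`. -/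
def outerCut {d : ℕ} (c : Space d) (R : ℝ) (x : Space d) : ℝ :=
  Real.sin (Real.pi / 2 * ramp (R⁻¹ • (x - c)))

variable {d : ℕ}

theorem contDiff_ramp : ContDiff ℝ ∞ (ramp : Space d → ℝ) :=
  Real.smoothTransition.contDiff.comp
    (((contDiff_norm_sq ℝ).sub contDiff_const).div_const _)

theorem ramp_eq_zero {x : Space d} (hx : ‖x‖ ≤ 1) : ramp x = 0 :=
  Real.smoothTransition.zero_of_nonpos (by nlinarith [norm_nonneg x])

theorem ramp_eq_one {x : Space d} (hx : 2 ≤ ‖x‖) : ramp x = 1 :=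
  Real.smoothTransition.one_of_one_le (by nlinarith [norm_nonneg x])

theorem exists_norm_fderiv_ramp_le (d : ℕ) :
    ∃ C : ℝ, 0 ≤ C ∧ ∀ x : Space d, ‖fderiv ℝ ramp x‖ ≤ C := by
  have hc : HasCompactSupport (fun x : Space d => 1 - ramp x) := by
    refine HasCompactSupport.of_support_subset_isCompact (isCompact_closedBall 0 2) ?_
    intro x hx
    rw [mem_closedBall_zero_iff]
    by_contra! h
    exact hx (by simp [ramp_eq_one h.le])
  have hd : ContDiff ℝ ∞ (fun x : Space d => 1 - ramp x) := contDiff_const.sub contDiff_ramp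
  obtain ⟨C, hC⟩ := (hd.continuous_fderiv (by simp)).bounded_above_of_compact_support (hc.fderiv ℝ)
  refine ⟨C, (norm_nonneg _).trans (hC 0), fun x => ?_⟩
  have := hC x
  rwa [fderiv_const_sub, norm_neg] at this

theorem hasFDerivAt_ramp_scaled (c : Space d) (R : ℝ) (x : Space d) :
    HasFDerivAt (fun y => ramp (R⁻¹ • (y - c)))
      (R⁻¹ • fderiv ℝ ramp (R⁻¹ • (x - c))) x := by
  have h1 : HasFDerivAt (fun y : Space d => R⁻¹ • (y - c))
      (R⁻¹ • ContinuousLinearMap.id ℝ (Space d)) x :=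
    ((hasFDerivAt_id x).sub_const c).const_smul R⁻¹
  have h2 := ((contDiff_ramp (d := d)).differentiable (by simp) (R⁻¹ • (x - c))).hasFDerivAt.comp x h1
  have h3 : R⁻¹ • fderiv ℝ ramp (R⁻¹ • (x - c)) =
      (fderiv ℝ ramp (R⁻¹ • (x - c))).comp (R⁻¹ • ContinuousLinearMap.id ℝ (Space d)) := by
    ext v
    simp
  rw [h3]
  exact h2

theorem contDiff_innerCut (c : Space d) (R : ℝ) : ContDiff ℝ ∞ (innerCut c R) :=
  Real.contDiff_cos.comp (contDiff_const.mul
    (contDiff_ramp.comp ((contDiff_id.sub contDiff_const).const_smul R⁻¹)))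

theorem contDiff_outerCut (c : Space d) (R : ℝ) : ContDiff ℝ ∞ (outerCut c R) :=
  Real.contDiff_sin.comp (contDiff_const.mul
    (contDiff_ramp.comp ((contDiff_id.sub contDiff_const).const_smul R⁻¹)))

/-- With cosine and sine of a common angle, each cutoff has the other as a factor of its derivative,
up to sign. This is what cancels the cross terms in `gradSq_cut`. -/
theorem fderiv_innerCut (c : Space d) (R : ℝ) (x : Space d) :
    fderiv ℝ (innerCut c R) x =
      (-outerCut c R x) • ((Real.pi / 2) • (R⁻¹ • fderiv ℝ ramp (R⁻¹ • (x - c)))) :=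
  (((hasFDerivAt_ramp_scaled c R x).const_mul (Real.pi / 2)).cos).fderiv

theorem fderiv_outerCut (c : Space d) (R : ℝ) (x : Space d) :
    fderiv ℝ (outerCut c R) x =
      innerCut c R x • ((Real.pi / 2) • (R⁻¹ • fderiv ℝ ramp (R⁻¹ • (x - c)))) :=
  (((hasFDerivAt_ramp_scaled c R x).const_mul (Real.pi / 2)).sin).fderiv

theorem abs_innerCut_le (c : Space d) (R : ℝ) (x : Space d) : |innerCut c R x| ≤ 1 :=
  Real.abs_cos_le_one _

theorem abs_outerCut_le (c : Space d) (R : ℝ) (x : Space d) : |outerCut c R x| ≤ 1 :=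
  Real.abs_sin_le_one _

theorem innerCut_sq_add_outerCut_sq (c : Space d) (R : ℝ) (x : Space d) :
    innerCut c R x ^ 2 + outerCut c R x ^ 2 = 1 :=
  Real.cos_sq_add_sin_sq _

theorem innerCut_eq_one {c x : Space d} {R : ℝ} (hR : 0 < R) (hx : ‖x - c‖ ≤ R) :
    innerCut c R x = 1 := by
  have : ramp (R⁻¹ • (x - c)) = 0 := ramp_eq_zero (by
    rw [norm_smul, norm_inv, Real.norm_of_nonneg hR.le]
    exact (inv_mul_le_one₀ hR).2 hx)
  simp [innerCut, this]

theorem outerCut_eq_zero {c x : Space d} {R : ℝ} (hR : 0 < R) (hx : ‖x - c‖ ≤ R) :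
    outerCut c R x = 0 := by
  have : ramp (R⁻¹ • (x - c)) = 0 := ramp_eq_zero (by
    rw [norm_smul, norm_inv, Real.norm_of_nonneg hR.le]
    exact (inv_mul_le_one₀ hR).2 hx)
  simp [outerCut, this]

theorem innerCut_eq_zero {c x : Space d} {R : ℝ} (hR : 0 < R) (hx : 2 * R ≤ ‖x - c‖) :
    innerCut c R x = 0 := by
  have : ramp (R⁻¹ • (x - c)) = 1 := ramp_eq_one (by
    rw [norm_smul, norm_inv, Real.norm_of_nonneg hR.le, inv_mul_eq_div, le_div_iff₀ hR]
    exact hx)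
  simp [innerCut, this]

theorem hasCompactSupport_innerCut (c : Space d) {R : ℝ} (hR : 0 < R) :
    HasCompactSupport (innerCut c R) := by
  refine HasCompactSupport.of_support_subset_isCompact (isCompact_closedBall c (2 * R)) ?_
  intro x hx
  rw [mem_closedBall_iff_norm]
  by_contra! h
  exact hx (innerCut_eq_zero hR h.le)

/-- Uniform bound for the gradients of the cutoff functions of unit scale. -/
def cutConst (d : ℕ) : ℝ := Real.pi / 2 * (exists_norm_fderiv_ramp_le d).choose

theorem cutConst_nonneg (d : ℕ) : 0 ≤ cutConst d :=
  mul_nonneg (by positivity) (exists_norm_fderiv_ramp_le d).choose_spec.1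

theorem norm_rampDeriv_le (c : Space d) {R : ℝ} (hR : 0 < R) (x : Space d) :
    ‖(Real.pi / 2) • (R⁻¹ • fderiv ℝ ramp (R⁻¹ • (x - c)))‖ ≤ cutConst d / R := by
  rw [norm_smul, norm_smul, norm_inv, Real.norm_of_nonneg hR.le,
    Real.norm_of_nonneg (by positivity), cutConst, mul_div_assoc, div_eq_inv_mul (Exists.choose _)]
  gcongr
  exact (exists_norm_fderiv_ramp_le d).choose_spec.2 _

theorem norm_fderiv_innerCut_le (c : Space d) {R : ℝ} (hR : 0 < R) (x : Space d) :
    ‖fderiv ℝ (innerCut c R) x‖ ≤ cutConst d / R := by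
  rw [fderiv_innerCut, norm_smul, norm_neg]
  exact (mul_le_of_le_one_left (norm_nonneg _) (abs_outerCut_le c R x)).trans
    (norm_rampDeriv_le c hR x)

theorem norm_fderiv_outerCut_le (c : Space d) {R : ℝ} (hR : 0 < R) (x : Space d) :
    ‖fderiv ℝ (outerCut c R) x‖ ≤ cutConst d / R := by
  rw [fderiv_outerCut, norm_smul]
  exact (mul_le_of_le_one_left (norm_nonneg _) (abs_innerCut_le c R x)).trans
    (norm_rampDeriv_le c hR x)

theorem abs_fderiv_single_le (φ : Space d → ℝ) (x : Space d) (i : Fin d) :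
    |fderiv ℝ φ x (EuclideanSpace.single i 1)| ≤ ‖fderiv ℝ φ x‖ := by
  simpa using (fderiv ℝ φ x).le_opNorm (EuclideanSpace.single i 1)

end

end LiebThirring

namespace LiebThirring

noncomputable section

variable {d : ℕ}

/-! ### Weak derivatives and the Fourier transform -/

theorem hasFDerivAt_ofReal_comp {f : Space d → ℂ} {x : Space d} (hf : DifferentiableAt ℝ f x)
    (e : Space d) :
    fderiv ℝ (fun y => (f y).re) x e = (fderiv ℝ f x e).re ∧
      fderiv ℝ (fun y => (f y).im) x e = (fderiv ℝ f x e).im := by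
  have h1 := (Complex.reCLM.hasFDerivAt.comp x hf.hasFDerivAt).fderiv
  have h2 := (Complex.imCLM.hasFDerivAt.comp x hf.hasFDerivAt).fderiv
  constructor
  · exact DFunLike.congr_fun h1 e
  · exact DFunLike.congr_fun h2 e

/-- Weak derivatives are defined by real test functions, whereas the Fourier transform needs complex
ones; real and imaginary parts are tested separately. -/
theorem IsWeakPartial.complex_test {i : Fin d} {u g : L2 d} (h : IsWeakPartial i u g)
    {f : Space d → ℂ} (hf : ContDiff ℝ ∞ f) (hc : HasCompactSupport f) :
    ∫ x, fderiv ℝ f x (EuclideanSpace.single i 1) • u x = - ∫ x, f x • g x := by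
  have split : ∀ (k : Space d → ℂ), Continuous k → HasCompactSupport k → ∀ v : L2 d,
      ∫ x, k x • v x = (∫ x, (k x).re • v x) + Complex.I * ∫ x, (k x).im • v x := by
    intro k hk hkc v
    rw [← integral_const_mul, ← integral_add]
    · refine integral_congr_ae (ae_of_all _ fun x => ?_)
      simp only [smul_eq_mul, Complex.real_smul]
      conv_lhs => rw [← Complex.re_add_im (k x)]
      ring
    · exact integrable_smul_L2 (Complex.continuous_re.comp hk) (hkc.comp_left (g := Complex.re) rfl) v
    · exact (integrable_smul_L2 (Complex.continuous_im.comp hk)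
        (hkc.comp_left (g := Complex.im) rfl) v).const_mul _
  have hre : ContDiff ℝ ∞ fun x => (f x).re := Complex.reCLM.contDiff.comp hf
  have him : ContDiff ℝ ∞ fun x => (f x).im := Complex.imCLM.contDiff.comp hf
  have h1 := h _ hre (hc.comp_left (g := Complex.re) rfl)
  have h2 := h _ him (hc.comp_left (g := Complex.im) rfl)
  have hd : ∀ x, DifferentiableAt ℝ f x := fun x => hf.differentiable (by simp) x
  simp_rw [fun x => (hasFDerivAt_ofReal_comp (hd x) (EuclideanSpace.single i 1)).1] at h1
  simp_rw [fun x => (hasFDerivAt_ofReal_comp (hd x) (EuclideanSpace.single i 1)).2] at h2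
  rw [split _ ((hf.continuous_fderiv (by simp)).clm_apply continuous_const)
    (hc.fderiv_apply ℝ _), split _ hf.continuous hc, h1, h2]
  ring

theorem integrable_schwartz_smul (f : 𝓢(Space d, ℂ)) (u : L2 d) :
    Integrable fun x => f x • u x := by
  have := (Lp.memLp u).smul (p := 2) (q := 2) (r := 1) (f.memLp 2 volume)
  exact memLp_one_iff_integrable.1 this

/-- Cut off at radius n + 1 and let n → ∞: the gradient of the cutoff is O(1/n), and dominated
convergence handles both sides. This links the weak derivative to tempered distributions. -/
theorem IsWeakPartial.schwartz_test {i : Fin d} {u g : L2 d} (h : IsWeakPartial i u g)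
    (f : 𝓢(Space d, ℂ)) :
    ∫ x, (∂_{(EuclideanSpace.single i 1 : Space d)} f) x • u x = - ∫ x, f x • g x := by
  set e : Space d := EuclideanSpace.single i 1 with he
  have hc : ∀ n : ℕ, 0 < (n : ℝ) + 1 := fun n => by positivity
  have hfd : ∀ (n : ℕ) (x : Space d),
      fderiv ℝ (fun y => innerCut 0 ((n : ℝ) + 1) y • f y) x e =
        innerCut 0 ((n : ℝ) + 1) x • (∂_{e} f) x
          + (fderiv ℝ (innerCut 0 ((n : ℝ) + 1)) x e) • f x := by
    intro n x
    have h1 := (((contDiff_innerCut (0 : Space d) ((n : ℝ) + 1)).differentiable (by simp)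
      x).hasFDerivAt.smul (f.differentiableAt (x := x)).hasFDerivAt).fderiv
    have h2 := DFunLike.congr_fun h1 e
    rw [SchwartzMap.lineDerivOp_apply_eq_fderiv]
    exact h2
  have key : ∀ n : ℕ, ∫ x, (innerCut 0 ((n : ℝ) + 1) x • (∂_{e} f) x
          + (fderiv ℝ (innerCut 0 ((n : ℝ) + 1)) x e) • f x) • u x =
      - ∫ x, (innerCut 0 ((n : ℝ) + 1) x • f x) • g x := by
    intro n
    simp_rw [← hfd]
    exact h.complex_test ((contDiff_innerCut _ _).smul f.smooth')
      (hasCompactSupport_innerCut (d := d) 0 (hc n)).smul_right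
  have hone : ∀ x : Space d, Tendsto (fun n : ℕ => innerCut 0 ((n : ℝ) + 1) x) atTop (𝓝 1) := by
    intro x
    refine tendsto_const_nhds.congr' ?_
    obtain ⟨m, hm⟩ := exists_nat_ge ‖x‖
    filter_upwards [eventually_ge_atTop m] with n hn
    refine (innerCut_eq_one (hc n) ?_).symm
    have : (m : ℝ) ≤ n := by exact_mod_cast hn
    rw [sub_zero]; linarith
  have hinv : Tendsto (fun n : ℕ => cutConst d / ((n : ℝ) + 1)) atTop (𝓝 0) :=
    tendsto_const_nhds.div_atTop (tendsto_atTop_add_const_right _ _ tendsto_natCast_atTop_atTop)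
  have hbd : ∀ (n : ℕ) (x : Space d), |fderiv ℝ (innerCut 0 ((n : ℝ) + 1)) x e| ≤
      cutConst d / ((n : ℝ) + 1) := fun n x =>
    (abs_fderiv_single_le _ x i).trans (norm_fderiv_innerCut_le _ (hc n) x)
  have hzero : ∀ x : Space d,
      Tendsto (fun n : ℕ => fderiv ℝ (innerCut 0 ((n : ℝ) + 1)) x e) atTop (𝓝 0) := fun x =>
    squeeze_zero_norm (fun n => hbd n x) hinv
  have hcut : ∀ n : ℕ, Continuous (innerCut (0 : Space d) ((n : ℝ) + 1)) := fun n =>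
    (contDiff_innerCut _ _).continuous
  have hcut' : ∀ n : ℕ, Continuous fun x => fderiv ℝ (innerCut (0 : Space d) ((n : ℝ) + 1)) x e :=
    fun n => ((contDiff_innerCut _ _).continuous_fderiv (by simp)).clm_apply continuous_const
  have hu := (Lp.aestronglyMeasurable u)
  have hg := (Lp.aestronglyMeasurable g)
  have hL : Tendsto (fun n : ℕ => ∫ x, (innerCut 0 ((n : ℝ) + 1) x • (∂_{e} f) x
      + (fderiv ℝ (innerCut 0 ((n : ℝ) + 1)) x e) • f x) • u x) atTop
      (𝓝 (∫ x, (∂_{e} f) x • u x)) := by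
    refine tendsto_integral_of_dominated_convergence
      (fun x => ‖(∂_{e} f) x • u x‖ + cutConst d * ‖f x • u x‖) ?_ ?_ ?_ ?_
    · intro n
      exact (((hcut n).smul (∂_{e} f).continuous).add
        ((hcut' n).smul f.continuous)).aestronglyMeasurable.smul hu
    · exact (integrable_schwartz_smul _ u).norm.add ((integrable_schwartz_smul _ u).norm.const_mul _)
    · intro n
      refine ae_of_all _ fun x => ?_
      rw [add_smul, smul_assoc, smul_assoc]
      refine (norm_add_le _ _).trans (add_le_add ?_ ?_)
      · rw [norm_smul]
        exact mul_le_of_le_one_left (norm_nonneg _) (abs_innerCut_le _ _ _)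
      · rw [norm_smul]
        refine mul_le_mul_of_nonneg_right ((hbd n x).trans ?_) (norm_nonneg _)
        exact div_le_self (cutConst_nonneg d) (by linarith [n.cast_nonneg (α := ℝ)])
    · refine ae_of_all _ fun x => ?_
      have := (((hone x).smul_const ((∂_{e} f) x)).add ((hzero x).smul_const (f x))).smul_const (u x)
      simpa using this
  have hR : Tendsto (fun n : ℕ => - ∫ x, (innerCut 0 ((n : ℝ) + 1) x • f x) • g x) atTop
      (𝓝 (- ∫ x, f x • g x)) := by
    refine (tendsto_integral_of_dominated_convergence (fun x => ‖f x • g x‖) ?_ ?_ ?_ ?_).neg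
    · intro n
      exact ((hcut n).smul f.continuous).aestronglyMeasurable.smul hg
    · exact (integrable_schwartz_smul _ g).norm
    · intro n
      refine ae_of_all _ fun x => ?_
      rw [smul_assoc, norm_smul]
      exact mul_le_of_le_one_left (norm_nonneg _) (abs_innerCut_le _ _ _)
    · refine ae_of_all _ fun x => ?_
      have := ((hone x).smul_const (f x)).smul_const (g x)
      simpa using this
  refine tendsto_nhds_unique hL ?_
  simp_rw [key]
  exact hR

/-- The Fourier transform turns weak derivatives into multiplication by the coordinates. -/
theorem IsWeakPartial.fourier_ae_eq {i : Fin d} {u g : L2 d} (h : IsWeakPartial i u g) :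
    (𝓕 g : L2 d) =ᵐ[volume] fun ξ => (2 * Real.pi * Complex.I * (ξ i : ℂ)) * (𝓕 u : L2 d) ξ := by
  set e : Space d := EuclideanSpace.single i 1 with he
  have h1 : ∂_{e} (u : 𝓢'(Space d, ℂ)) = (g : 𝓢'(Space d, ℂ)) := by
    ext f
    rw [TemperedDistribution.lineDerivOp_apply_apply, Lp.toTemperedDistribution_apply,
      Lp.toTemperedDistribution_apply]
    have := h.schwartz_test f
    simp only [neg_apply, neg_smul, integral_neg]
    rw [this, neg_neg]
  have h2 : ((𝓕 g : L2 d) : 𝓢'(Space d, ℂ)) = (2 * Real.pi * Complex.I) •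
      TemperedDistribution.smulLeftCLM ℂ (inner ℝ · e) ((𝓕 u : L2 d) : 𝓢'(Space d, ℂ)) := by
    rw [← Lp.fourier_toTemperedDistribution_eq, ← Lp.fourier_toTemperedDistribution_eq, ← h1,
      TemperedDistribution.fourier_lineDerivOp_eq]
  have hin : ∀ x : Space d, inner ℝ x e = x i := by
    intro x
    simp [he, EuclideanSpace.inner_single_right]
  have hcont : Continuous fun ξ : Space d => (2 * Real.pi * Complex.I * (ξ i : ℂ)) := by
    fun_prop
  have hloc : LocallyIntegrable (fun ξ => (𝓕 u : L2 d) ξ) volume :=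
    (Lp.memLp _).locallyIntegrable (by norm_num)
  have hloc' : LocallyIntegrable
      (fun ξ => (2 * Real.pi * Complex.I * (ξ i : ℂ)) * (𝓕 u : L2 d) ξ) volume := by
    have := (locallyIntegrableOn_univ.2 hloc).continuousOn_smul isOpen_univ.isLocallyClosed
      hcont.continuousOn
    exact locallyIntegrableOn_univ.1 this
  -- The distributional identity `h2` becomes an a.e. identity because both sides are locally
  -- integrable and agree against all smooth compactly supported functions.
  refine ae_eq_of_integral_contDiff_smul_eq ((Lp.memLp _).locallyIntegrable (by norm_num)) hloc' ?_
  intro φ hφ hφc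
  have hφ' : ContDiff ℝ ∞ (Complex.ofRealCLM ∘ φ) := Complex.ofRealCLM.contDiff.comp hφ
  have hφc' : HasCompactSupport (Complex.ofRealCLM ∘ φ) := hφc.comp_left rfl
  have h3 := DFunLike.congr_fun h2 (hφc'.toSchwartzMap hφ')
  have htg : (fun x : Space d => ((inner ℝ x e : ℝ) : ℂ)).HasTemperateGrowth := by fun_prop
  rw [smul_apply, TemperedDistribution.smulLeftCLM_apply_apply, Lp.toTemperedDistribution_apply,
    Lp.toTemperedDistribution_apply, ← integral_smul] at h3
  refine Eq.trans ?_ (h3.trans ?_)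
  · refine integral_congr_ae (ae_of_all _ fun x => ?_)
    simp
  · refine integral_congr_ae (ae_of_all _ fun x => ?_)
    simp only [SchwartzMap.smulLeftCLM_apply_apply htg]
    simp [hin]
    ring

end

end LiebThirring

namespace LiebThirring

noncomputable section

variable {d : ℕ}

/-! ### Frequency localization and subcritical Sobolev bounds -/

/-- `∫ |∇u|²`. -/
def gradSq (u : H1 d) : ℝ := ∑ i, ‖u.1.2 i‖ ^ 2

theorem gradSq_nonneg (u : H1 d) : 0 ≤ gradSq u := Finset.sum_nonneg fun _ _ => by positivity

theorem lintegral_enorm_sq (f : L2 d) : ∫⁻ x, ‖f x‖ₑ ^ 2 = ENNReal.ofReal (‖f‖ ^ 2) := by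
  rw [Lp.norm_def, ← ENNReal.toReal_pow, ENNReal.ofReal_toReal
    (ENNReal.pow_ne_top (Lp.eLpNorm_ne_top f))]
  have := eLpNorm_nnreal_pow_eq_lintegral (f := f) (μ := volume) (p := 2) (by norm_num)
  simpa using this.symm

theorem integral_norm_sq (f : L2 d) : ∫ x, ‖f x‖ ^ 2 = ‖f‖ ^ 2 := by
  rw [integral_eq_lintegral_of_nonneg_ae (ae_of_all _ fun x => by positivity)
    (by exact (Lp.aestronglyMeasurable f).norm.pow 2)]
  have : ∀ x, ENNReal.ofReal (‖f x‖ ^ 2) = ‖f x‖ₑ ^ 2 := fun x => by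
    rw [ENNReal.ofReal_pow (norm_nonneg _), ofReal_norm]
  simp_rw [this, lintegral_enorm_sq]
  exact ENNReal.toReal_ofReal (by positivity)

/-- High frequencies are controlled by the gradient. -/
theorem setLIntegral_fourier_le (u : H1 d) {r : ℝ} (hr : 0 < r) {S : Set (Space d)}
    (hS : MeasurableSet S) (hSr : ∀ ξ ∈ S, r ≤ ‖ξ‖) :
    ∫⁻ ξ in S, ‖(𝓕 u.1.1 : L2 d) ξ‖ₑ ^ 2 ≤ ENNReal.ofReal (gradSq u / r ^ 2) := by
  have hae : ∀ᵐ ξ ∂(volume.restrict S), ENNReal.ofReal (r ^ 2) * ‖(𝓕 u.1.1 : L2 d) ξ‖ₑ ^ 2 ≤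
      ∑ i, ‖(𝓕 (u.1.2 i) : L2 d) ξ‖ₑ ^ 2 := by
    have h1 : ∀ᵐ ξ ∂(volume : Measure (Space d)), ∀ i, (𝓕 (u.1.2 i) : L2 d) ξ =
        (2 * Real.pi * Complex.I * (ξ i : ℂ)) * (𝓕 u.1.1 : L2 d) ξ :=
      ae_all_iff.2 fun i => (u.2 i).fourier_ae_eq
    filter_upwards [ae_restrict_of_ae h1, ae_restrict_mem hS] with ξ hξ hξS
    have e1 : ∀ z : ℂ, ‖z‖ₑ ^ 2 = ENNReal.ofReal (‖z‖ ^ 2) := fun z => by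
      rw [ENNReal.ofReal_pow (norm_nonneg _), ofReal_norm]
    simp_rw [e1]
    rw [← ENNReal.ofReal_mul (by positivity), ← ENNReal.ofReal_sum_of_nonneg
      (fun _ _ => by positivity)]
    refine ENNReal.ofReal_le_ofReal ?_
    simp_rw [hξ, norm_mul, mul_pow, ← Finset.sum_mul]
    refine mul_le_mul_of_nonneg_right ?_ (by positivity)
    have h2 : r ^ 2 ≤ ∑ i, (ξ i) ^ 2 := by
      have := hSr ξ hξS
      rw [EuclideanSpace.norm_eq] at this
      have h3 := pow_le_pow_left₀ hr.le this 2
      rw [Real.sq_sqrt (Finset.sum_nonneg fun _ _ => by positivity)] at h3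
      simpa using h3
    refine h2.trans (Finset.sum_le_sum fun i _ => ?_)
    -- The factor (2π)² of the Fourier convention is only needed to be at least 1.
    have h4 : (1 : ℝ) ≤ (2 * Real.pi) ^ 2 := by nlinarith [Real.pi_gt_three]
    have h5 : ‖(2 : ℂ)‖ ^ 2 * ‖(Real.pi : ℂ)‖ ^ 2 * ‖Complex.I‖ ^ 2 * ‖((ξ i : ℝ) : ℂ)‖ ^ 2
        = (2 * Real.pi) ^ 2 * (ξ i) ^ 2 := by
      simp [mul_pow]
    rw [h5]
    nlinarith [sq_nonneg (ξ i)]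
  have h6 := lintegral_mono_ae hae
  rw [lintegral_const_mul'' _ ((Lp.aestronglyMeasurable _).aemeasurable.enorm.pow_const 2).restrict,
    lintegral_finsetSum' _ fun i _ =>
      ((Lp.aestronglyMeasurable _).aemeasurable.enorm.pow_const 2).restrict] at h6
  have h7 : ∑ i, ∫⁻ ξ in S, ‖(𝓕 (u.1.2 i) : L2 d) ξ‖ₑ ^ 2 ≤ ENNReal.ofReal (gradSq u) := by
    rw [gradSq, ENNReal.ofReal_sum_of_nonneg (fun _ _ => by positivity)]
    refine Finset.sum_le_sum fun i _ => ?_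
    refine (setLIntegral_le_lintegral _ _).trans ?_
    rw [lintegral_enorm_sq, Lp.norm_fourier_eq]
  rw [ENNReal.ofReal_div_of_pos (by positivity)]
  rw [ENNReal.le_div_iff_mul_le (Or.inl (by simpa using hr.ne')) (Or.inl ENNReal.ofReal_ne_top),
    mul_comm]
  exact h6.trans h7

/-- Restriction of the Fourier transform to a measurable set. -/
def bandpass {S : Set (Space d)} (hS : MeasurableSet S) (f : L2 d) : L2 d :=
  𝓕⁻ (((Lp.memLp (𝓕 f : L2 d)).indicator hS).toLp _ : L2 d)

theorem fourier_bandpass {S : Set (Space d)} (hS : MeasurableSet S) (f : L2 d) :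
    (𝓕 (bandpass hS f) : L2 d) =ᵐ[volume] S.indicator (𝓕 f : L2 d) := by
  have : (𝓕 (bandpass hS f) : L2 d) = ((Lp.memLp (𝓕 f : L2 d)).indicator hS).toLp _ :=
    FourierTransform.fourier_fourierInv_eq _
  rw [this]
  exact MemLp.coeFn_toLp _

theorem ext_fourier {f g : L2 d} (h : (𝓕 f : L2 d) =ᵐ[volume] (𝓕 g : L2 d)) : f = g := by
  exact (Lp.fourierTransformₗᵢ (Space d) ℂ).injective (Lp.ext h)

theorem bandpass_union {S T : Set (Space d)} (hS : MeasurableSet S) (hT : MeasurableSet T)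
    (hST : Disjoint S T) (f : L2 d) :
    bandpass (hS.union hT) f = bandpass hS f + bandpass hT f := by
  refine ext_fourier ?_
  rw [FourierTransform.fourier_add]
  filter_upwards [fourier_bandpass hS f, fourier_bandpass hT f, fourier_bandpass (hS.union hT) f,
    Lp.coeFn_add (𝓕 (bandpass hS f) : L2 d) (𝓕 (bandpass hT f))] with ξ h1 h2 h3 h4
  rw [h3, h4, Pi.add_apply, h1, h2, Set.indicator_union_of_disjoint hST]

theorem bandpass_univ (f : L2 d) : bandpass MeasurableSet.univ f = f := by
  refine ext_fourier ?_
  filter_upwards [fourier_bandpass MeasurableSet.univ f] with ξ h1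
  simpa using h1

theorem lintegral_bandpass {S : Set (Space d)} (hS : MeasurableSet S) (f : L2 d) :
    ∫⁻ x, ‖bandpass hS f x‖ₑ ^ 2 = ∫⁻ ξ in S, ‖(𝓕 f : L2 d) ξ‖ₑ ^ 2 := by
  rw [lintegral_enorm_sq, ← Lp.norm_fourier_eq, ← lintegral_enorm_sq, ← lintegral_indicator hS]
  refine lintegral_congr_ae ?_
  filter_upwards [fourier_bandpass hS f] with ξ h1
  rw [h1]
  by_cases h : ξ ∈ S <;> simp [h]

/-- An `L²` function whose Fourier transform is integrable is given by Fourier inversion. -/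
theorem ae_eq_fourierInv (f : L2 d) (hf : Integrable (𝓕 f : L2 d)) :
    f =ᵐ[volume] 𝓕⁻ (⇑(𝓕 f : L2 d)) := by
  have hcont : Continuous (𝓕⁻ (⇑(𝓕 f : L2 d))) := by
    rw [Real.fourierInv_eq_fourier_comp_neg]
    exact VectorFourier.fourierIntegral_continuous Real.continuous_fourierChar
      (by exact continuous_inner) hf.comp_neg
  refine ae_eq_of_integral_contDiff_smul_eq ((Lp.memLp _).locallyIntegrable (by norm_num))
    hcont.locallyIntegrable ?_
  intro φ hφ hφc
  have hφ' : ContDiff ℝ ∞ (Complex.ofRealCLM ∘ φ) := Complex.ofRealCLM.contDiff.comp hφ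
  have hφc' : HasCompactSupport (Complex.ofRealCLM ∘ φ) := hφc.comp_left rfl
  set g : 𝓢(Space d, ℂ) := hφc'.toSchwartzMap hφ' with hg
  have hgφ : ∀ x, g x = φ x := fun x => rfl
  have h1 := DFunLike.congr_fun (Lp.fourierInv_toTemperedDistribution_eq (𝓕 f : L2 d)) g
  rw [FourierTransform.fourierInv_fourier_eq, TemperedDistribution.fourierInv_apply,
    Lp.toTemperedDistribution_apply, Lp.toTemperedDistribution_apply] at h1
  have h2 : ∫ x, (𝓕⁻ g) x • (𝓕 f : L2 d) x = ∫ x, g x • 𝓕⁻ (⇑(𝓕 f : L2 d)) x := by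
    -- Symmetry of the Fourier pairing, applied to the reflected function since inverse transform is
    -- transform after reflection.
    have h3 := VectorFourier.integral_fourierIntegral_smul_eq_flip (L := innerₗ (Space d))
      (μ := volume) (ν := volume) Real.continuous_fourierChar continuous_inner
      (f := ⇑g) (g := fun x => (𝓕 f : L2 d) (-x)) g.integrable hf.comp_neg
    rw [flip_innerₗ] at h3
    rw [Real.fourierInv_eq_fourier_comp_neg]
    refine Eq.trans ?_ h3
    rw [← integral_neg_eq_self]
    refine integral_congr_ae (ae_of_all _ fun x => ?_)
    simp only [SchwartzMap.fourierInv_coe]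
    rw [Real.fourierInv_eq_fourier_neg, neg_neg]
    rfl
  have h4 : ∀ v : Space d → ℂ, ∫ x, φ x • v x = ∫ x, g x • v x := fun v => by
    simp [hgφ]
  rw [h4, h4, ← h1, h2]

end

end LiebThirring

namespace LiebThirring

noncomputable section

variable {d : ℕ}

/-! ### Bernstein-type bounds and summation of dyadic frequency blocks -/

theorem eLpNorm_ofReal_eq {E : Type*} [NormedAddCommGroup E] (f : Space d → E) {q : ℝ}
    (hq : 0 < q) :
    eLpNorm f (ENNReal.ofReal q) volume = (∫⁻ x, ‖f x‖ₑ ^ q) ^ (1 / q) := by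
  rw [eLpNorm_eq_lintegral_rpow_enorm_toReal (by simpa using hq) ENNReal.ofReal_ne_top,
    ENNReal.toReal_ofReal hq.le]

/-- Cauchy–Schwarz on the frequency set. Together with Fourier inversion it gives the sup bound of
`enorm_bandpass_le`. -/
theorem lintegral_enorm_fourier_bandpass_le {S : Set (Space d)} (hS : MeasurableSet S)
    (f : L2 d) : ∫⁻ ξ, ‖(𝓕 (bandpass hS f) : L2 d) ξ‖ₑ ≤
      (volume S) ^ (1 / 2 : ℝ) * (∫⁻ ξ in S, ‖(𝓕 f : L2 d) ξ‖ₑ ^ 2) ^ (1 / 2 : ℝ) := by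
  have e : ∫⁻ ξ, ‖(𝓕 (bandpass hS f) : L2 d) ξ‖ₑ = ∫⁻ ξ in S, ‖(𝓕 f : L2 d) ξ‖ₑ := by
    rw [← lintegral_indicator hS]
    refine lintegral_congr_ae ?_
    filter_upwards [fourier_bandpass hS f] with ξ h1
    rw [h1]
    by_cases h : ξ ∈ S <;> simp [h]
  rw [e]
  have h := ENNReal.lintegral_mul_le_Lp_mul_Lq (volume.restrict S) Real.HolderConjugate.two_two
    (f := fun _ => 1) (g := fun ξ => ‖(𝓕 f : L2 d) ξ‖ₑ) aemeasurable_const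
    (Lp.aestronglyMeasurable _).aemeasurable.enorm.restrict
  simpa using h

theorem integrable_fourier_bandpass {S : Set (Space d)} (hS : MeasurableSet S)
    (hfin : volume S ≠ ⊤) (f : L2 d) : Integrable (𝓕 (bandpass hS f) : L2 d) := by
  refine ⟨Lp.aestronglyMeasurable _, (lintegral_enorm_fourier_bandpass_le hS f).trans_lt
    (ENNReal.mul_lt_top (ENNReal.rpow_lt_top_of_nonneg (by norm_num) hfin)
      (ENNReal.rpow_lt_top_of_nonneg (by norm_num) ?_))⟩
  refine ((setLIntegral_le_lintegral _ _).trans_lt ?_).ne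
  rw [lintegral_enorm_sq]
  exact ENNReal.ofReal_lt_top

theorem enorm_bandpass_le {S : Set (Space d)} (hS : MeasurableSet S) (hfin : volume S ≠ ⊤)
    (f : L2 d) :
    ∀ᵐ x ∂(volume : Measure (Space d)), ‖bandpass hS f x‖ₑ ≤
      (volume S) ^ (1 / 2 : ℝ) * (∫⁻ ξ in S, ‖(𝓕 f : L2 d) ξ‖ₑ ^ 2) ^ (1 / 2 : ℝ) := by
  filter_upwards [ae_eq_fourierInv (bandpass hS f) (integrable_fourier_bandpass hS hfin f)]
    with x hx
  rw [hx]
  refine le_trans ?_ (lintegral_enorm_fourier_bandpass_le hS f)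
  rw [Real.fourierInv_eq]
  refine (enorm_integral_le_lintegral_enorm _).trans_eq (lintegral_congr fun ξ => ?_)
  rw [← ofReal_norm, ← ofReal_norm, Circle.norm_smul]

/-- Bernstein's inequality by interpolation: with the sup bound M, |f|^q ≤ M^(q-2) |f|², and
Plancherel evaluates the remaining L² integral. -/
theorem eLpNorm_bandpass_le {S : Set (Space d)} (hS : MeasurableSet S) (hfin : volume S ≠ ⊤)
    (f : L2 d) {q : ℝ} (hq : 2 < q) :
    eLpNorm (bandpass hS f) (ENNReal.ofReal q) volume ≤
      (volume S) ^ (1 / 2 - 1 / q) * (∫⁻ ξ in S, ‖(𝓕 f : L2 d) ξ‖ₑ ^ 2) ^ (1 / 2 : ℝ) := by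
  set A := ∫⁻ ξ in S, ‖(𝓕 f : L2 d) ξ‖ₑ ^ 2 with hA
  set M := (volume S) ^ (1 / 2 : ℝ) * A ^ (1 / 2 : ℝ) with hM
  rw [eLpNorm_ofReal_eq _ (by linarith)]
  have h1 : ∫⁻ x, ‖bandpass hS f x‖ₑ ^ q ≤ M ^ (q - 2) * A := by
    calc ∫⁻ x, ‖bandpass hS f x‖ₑ ^ q
        ≤ ∫⁻ x, M ^ (q - 2) * ‖bandpass hS f x‖ₑ ^ 2 := by
          refine lintegral_mono_ae ?_
          filter_upwards [enorm_bandpass_le hS hfin f] with x hx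
          calc ‖bandpass hS f x‖ₑ ^ q
              = ‖bandpass hS f x‖ₑ ^ (q - 2) * ‖bandpass hS f x‖ₑ ^ 2 := by
                rw [← ENNReal.rpow_natCast, ← ENNReal.rpow_add_of_nonneg _ _ (by linarith)
                  (by norm_num)]
                norm_num
            _ ≤ _ := by
                gcongr
      _ = M ^ (q - 2) * A := by
          rw [lintegral_const_mul'' _ ((Lp.aestronglyMeasurable _).aemeasurable.enorm.pow_const 2),
            lintegral_bandpass]
  calc (∫⁻ x, ‖bandpass hS f x‖ₑ ^ q) ^ (1 / q) ≤ (M ^ (q - 2) * A) ^ (1 / q) :=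
        ENNReal.rpow_le_rpow h1 (by positivity)
    _ = _ := by
        have hq0 : q ≠ 0 := by linarith
        rw [hM, ENNReal.mul_rpow_of_nonneg _ _ (by linarith : 0 ≤ q - 2), ← ENNReal.rpow_mul,
          ← ENNReal.rpow_mul, mul_assoc]
        have h2 : A ^ (1 / 2 * (q - 2)) * A = A ^ (q / 2) := by
          conv_lhs => rw [← ENNReal.rpow_one A, ← ENNReal.rpow_mul]
          rw [one_mul, ← ENNReal.rpow_add_of_nonneg _ _ (by linarith) zero_le_one]
          congr 1; ring
        rw [h2, ENNReal.mul_rpow_of_nonneg _ _ (by positivity), ← ENNReal.rpow_mul,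
          ← ENNReal.rpow_mul]
        congr 2 <;> field_simp

theorem setLIntegral_fourier_le_norm (f : L2 d) (S : Set (Space d)) :
    ∫⁻ ξ in S, ‖(𝓕 f : L2 d) ξ‖ₑ ^ 2 ≤ ENNReal.ofReal (‖f‖ ^ 2) := by
  refine (setLIntegral_le_lintegral _ _).trans ?_
  rw [lintegral_enorm_sq, Lp.norm_fourier_eq]

/-- The low-frequency part of an `L²` function lies in `L^q`. -/
theorem eLpNorm_lowpass_le (Λ : ℝ) {q : ℝ} (hq : 2 < q) :
    ∃ C : ℝ, 0 ≤ C ∧ ∀ f : L2 d,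
      eLpNorm (bandpass (measurableSet_ball (x := 0) (ε := Λ)) f) (ENNReal.ofReal q) volume ≤
        ENNReal.ofReal (C * ‖f‖) := by
  refine ⟨((volume (Metric.ball (0 : Space d) Λ)) ^ (1 / 2 - 1 / q)).toReal,
    ENNReal.toReal_nonneg, fun f => ?_⟩
  have hθ : 0 ≤ 1 / 2 - 1 / q := by
    rw [sub_nonneg]; exact one_div_le_one_div_of_le (by norm_num) hq.le
  refine (eLpNorm_bandpass_le measurableSet_ball measure_ball_lt_top.ne f hq).trans ?_
  rw [ENNReal.ofReal_mul ENNReal.toReal_nonneg, ENNReal.ofReal_toReal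
    (ENNReal.rpow_lt_top_of_nonneg hθ measure_ball_lt_top.ne).ne]
  gcongr
  refine (ENNReal.rpow_le_rpow (setLIntegral_fourier_le_norm f _) (by norm_num)).trans_eq ?_
  rw [ENNReal.ofReal_rpow_of_nonneg (by positivity) (by norm_num), ← Real.sqrt_eq_rpow,
    Real.sqrt_sq (norm_nonneg f)]

/-- The dyadic frequency annulus `2^k ≤ |ξ| < 2^m`. -/
def annulus (d k m : ℕ) : Set (Space d) := {ξ | (2 : ℝ) ^ k ≤ ‖ξ‖ ∧ ‖ξ‖ < 2 ^ m}

theorem measurableSet_annulus (k m : ℕ) : MeasurableSet (annulus d k m) :=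
  (measurableSet_le measurable_const measurable_norm).inter
    (measurableSet_lt measurable_norm measurable_const)

theorem annulus_subset_ball (k m : ℕ) : annulus d k m ⊆ Metric.ball 0 (2 ^ m) := fun ξ hξ => by
  simpa using hξ.2

theorem annulus_succ {k m : ℕ} (h : k ≤ m) :
    annulus d k (m + 1) = annulus d k m ∪ annulus d m (m + 1) := by
  ext ξ
  have h1 : (2 : ℝ) ^ k ≤ 2 ^ m := pow_le_pow_right₀ (by norm_num) h
  have h2 : (2 : ℝ) ^ m ≤ 2 ^ (m + 1) := pow_le_pow_right₀ (by norm_num) (by omega)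
  simp only [annulus, Set.mem_union, Set.mem_ofPred_eq]
  constructor
  · rintro ⟨h3, h4⟩
    rcases lt_or_ge ‖ξ‖ (2 ^ m) with h5 | h5
    · exact Or.inl ⟨h3, h5⟩
    · exact Or.inr ⟨h5, h4⟩
  · rintro (⟨h3, h4⟩ | ⟨h3, h4⟩)
    · exact ⟨h3, h4.trans_le h2⟩
    · exact ⟨h1.trans h3, h4⟩

theorem disjoint_annulus (k m n : ℕ) : Disjoint (annulus d k m) (annulus d m n) :=
  Set.disjoint_left.2 fun _ h h' => (h.2.trans_le h'.1).false

/-- The bound for a single dyadic frequency block. -/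
theorem eLpNorm_dyadic_le {q : ℝ} (hq : 2 < q) :
    ∃ C : ℝ, 0 ≤ C ∧ ∀ (u : H1 d) (k : ℕ),
      eLpNorm (bandpass (measurableSet_annulus k (k + 1)) u.1.1) (ENNReal.ofReal q) volume ≤
        ENNReal.ofReal (C * ((2 : ℝ) ^ (d * (1 / 2 - 1 / q) - 1)) ^ k * √(gradSq u)) := by
  have hθ : 0 ≤ 1 / 2 - 1 / q := by
    rw [sub_nonneg]; exact one_div_le_one_div_of_le (by norm_num) hq.le
  set θ := 1 / 2 - 1 / q with hθd
  set v := (volume (Metric.ball (0 : Space d) 1)).toReal with hv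
  refine ⟨(2 ^ d * v) ^ θ, by positivity, fun u k => ?_⟩
  have hfin : volume (annulus d k (k + 1)) ≠ ⊤ :=
    ((measure_mono (annulus_subset_ball k (k + 1))).trans_lt measure_ball_lt_top).ne
  refine (eLpNorm_bandpass_le (measurableSet_annulus k (k + 1)) hfin u.1.1 hq).trans ?_
  have hvol : volume (annulus d k (k + 1)) ≤ ENNReal.ofReal ((2 ^ (k + 1)) ^ d * v) := by
    refine (measure_mono (annulus_subset_ball k (k + 1))).trans ?_
    rw [Measure.addHaar_ball_of_pos volume 0 (by positivity), ENNReal.ofReal_mul (by positivity), hv,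
      ENNReal.ofReal_toReal measure_ball_lt_top.ne]
    simp
  have hA := setLIntegral_fourier_le u (r := 2 ^ k) (by positivity)
    (measurableSet_annulus k (k + 1)) (fun ξ hξ => hξ.1)
  refine (mul_le_mul' (ENNReal.rpow_le_rpow hvol hθ)
    (ENNReal.rpow_le_rpow hA (by norm_num))).trans ?_
  rw [ENNReal.ofReal_rpow_of_nonneg (by positivity) hθ,
    ENNReal.ofReal_rpow_of_nonneg (div_nonneg (gradSq_nonneg u) (by positivity)) (by norm_num),
    ← ENNReal.ofReal_mul (by positivity)]
  refine ENNReal.ofReal_le_ofReal (le_of_eq ?_)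
  rw [← Real.sqrt_eq_rpow, Real.sqrt_div (gradSq_nonneg u), Real.sqrt_sq (by positivity)]
  -- With θ = 1/2 - 1/q, the volume of the block contributes 2^(kdθ) and the gradient bound 2^(-k),
  -- which explains the ratio 2^(dθ-1).
  have h1 : ((2 : ℝ) ^ (k + 1)) ^ d * v = (2 ^ d * v) * ((2 : ℝ) ^ k) ^ d := by
    rw [pow_succ, mul_pow]; ring
  rw [h1, Real.mul_rpow (by positivity) (by positivity)]
  have h2 : (((2 : ℝ) ^ k) ^ d) ^ θ = ((2 : ℝ) ^ (d * θ)) ^ k := by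
    rw [← Real.rpow_natCast, ← Real.rpow_natCast, ← Real.rpow_natCast, ← Real.rpow_mul (by norm_num),
      ← Real.rpow_mul (by positivity), ← Real.rpow_mul (by positivity)]
    congr 1; ring
  rw [h2, Real.rpow_sub (x := 2) (by norm_num) (d * θ) 1, Real.rpow_one, div_pow]
  ring

/-- Subcriticality makes the ratio ρ of the dyadic bounds smaller than 1, so the blocks sum to a
geometric tail. The starting index K depends on δ but not on the outer radius, which can then be
sent to infinity. -/
theorem eLpNorm_annulus_le {q : ℝ} (hq : 2 < q) (hd : d * (1 / 2 - 1 / q) < 1) {δ : ℝ}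
    (hδ : 0 < δ) :
    ∃ K : ℕ, ∀ (u : H1 d) (n : ℕ),
      eLpNorm (bandpass (measurableSet_annulus K (K + n)) u.1.1) (ENNReal.ofReal q) volume ≤
        ENNReal.ofReal (δ * √(gradSq u)) := by
  obtain ⟨C, hC, hdy⟩ := eLpNorm_dyadic_le (d := d) hq
  set ρ : ℝ := (2 : ℝ) ^ (d * (1 / 2 - 1 / q) - 1) with hρ
  have hρ0 : 0 < ρ := by positivity
  have hρ1 : ρ < 1 := Real.rpow_lt_one_of_one_lt_of_neg (by norm_num) (by linarith)
  have hlim : Tendsto (fun K : ℕ => C * (1 - ρ)⁻¹ * ρ ^ K) atTop (𝓝 0) := by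
    simpa using (tendsto_pow_atTop_nhds_zero_of_lt_one hρ0.le hρ1).const_mul (C * (1 - ρ)⁻¹)
  obtain ⟨K, hK⟩ := (hlim.eventually (gt_mem_nhds hδ)).exists
  refine ⟨K, fun u n => ?_⟩
  have hsum : ∀ n : ℕ,
      eLpNorm (bandpass (measurableSet_annulus K (K + n)) u.1.1) (ENNReal.ofReal q) volume ≤
        ENNReal.ofReal (C * ρ ^ K * (∑ j ∈ Finset.range n, ρ ^ j) * √(gradSq u)) := by
    intro n
    induction n with
    | zero =>
      have hS : annulus d K (K + 0) = ∅ := by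
        ext ξ
        simp only [annulus, Set.mem_ofPred_eq, add_zero, Set.mem_empty_iff_false, iff_false]
        exact fun h => (h.1.trans_lt h.2).false
      have hv : volume (annulus d K (K + 0)) = 0 := by rw [hS]; exact measure_empty
      have hθ : 0 < 1 / 2 - 1 / q := by
        rw [sub_pos]; exact one_div_lt_one_div_of_lt (by norm_num) hq
      have h := eLpNorm_bandpass_le (measurableSet_annulus K (K + 0)) (by rw [hv]; simp) u.1.1 hq
      rw [hv, ENNReal.zero_rpow_of_pos hθ, zero_mul] at h
      exact h.trans zero_le
    | succ n ih =>
      have hS : annulus d K (K + (n + 1)) = annulus d K (K + n) ∪ annulus d (K + n) (K + n + 1) :=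
        annulus_succ (Nat.le_add_right K n)
      have hb : bandpass (measurableSet_annulus K (K + (n + 1))) u.1.1 =
          bandpass (measurableSet_annulus K (K + n)) u.1.1 +
            bandpass (measurableSet_annulus (K + n) (K + n + 1)) u.1.1 := by
        rw [← bandpass_union _ _ (disjoint_annulus _ _ _)]
        congr 1
      rw [hb, eLpNorm_congr_ae (Lp.coeFn_add _ _)]
      refine (eLpNorm_add_le (Lp.aestronglyMeasurable _) (Lp.aestronglyMeasurable _) ?_).trans
        ((add_le_add ih (hdy u (K + n))).trans_eq ?_)
      · exact ENNReal.one_le_ofReal.2 (by linarith)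
      · rw [← ENNReal.ofReal_add (by positivity) (by positivity), Finset.sum_range_succ, pow_add]
        congr 1; ring
  refine (hsum n).trans (ENNReal.ofReal_le_ofReal ?_)
  refine mul_le_mul_of_nonneg_right ?_ (Real.sqrt_nonneg _)
  have hg : ∑ j ∈ Finset.range n, ρ ^ j ≤ (1 - ρ)⁻¹ := by
    rw [← tsum_geometric_of_lt_one hρ0.le hρ1]
    exact (summable_geometric_of_lt_one hρ0.le hρ1).sum_le_tsum _ fun _ _ => by positivity
  calc C * ρ ^ K * (∑ j ∈ Finset.range n, ρ ^ j) ≤ C * ρ ^ K * (1 - ρ)⁻¹ := by gcongr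
    _ ≤ δ := by rw [mul_right_comm]; exact hK.le

/-- The high-frequency part of an `H¹` function is small in `L^q`, for subcritical `q`. -/
theorem eLpNorm_highpass_le {q : ℝ} (hq : 2 < q) (hd : d * (1 / 2 - 1 / q) < 1) {δ : ℝ}
    (hδ : 0 < δ) :
    ∃ Λ : ℝ, 0 < Λ ∧ ∀ u : H1 d,
      eLpNorm (bandpass (measurableSet_ball (x := 0) (ε := Λ)).compl u.1.1)
        (ENNReal.ofReal q) volume ≤ ENNReal.ofReal (δ * √(gradSq u)) := by
  obtain ⟨K, hK⟩ := eLpNorm_annulus_le (d := d) hq hd hδ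
  refine ⟨2 ^ K, by positivity, fun u => ?_⟩
  set h : L2 d := bandpass (measurableSet_ball (x := 0) (ε := (2 : ℝ) ^ K)).compl u.1.1 with hh
  set a : ℕ → L2 d := fun n => bandpass (measurableSet_annulus K (K + n)) u.1.1 with ha
  have hdiff : ∀ n, h - a n =
      bandpass (measurableSet_ball (x := 0) (ε := (2 : ℝ) ^ (K + n))).compl u.1.1 := by
    intro n
    have hle : (2 : ℝ) ^ K ≤ 2 ^ (K + n) := pow_le_pow_right₀ (by norm_num) (by omega)
    have hdis : Disjoint (annulus d K (K + n)) (Metric.ball 0 ((2 : ℝ) ^ (K + n)))ᶜ :=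
      Set.disjoint_left.2 fun ξ h1 h2 => h2 (annulus_subset_ball _ _ h1)
    have hun : (Metric.ball (0 : Space d) ((2 : ℝ) ^ K))ᶜ =
        annulus d K (K + n) ∪ (Metric.ball 0 ((2 : ℝ) ^ (K + n)))ᶜ := by
      ext ξ
      simp only [annulus, Set.mem_compl_iff, mem_ball_zero_iff, not_lt, Set.mem_union,
        Set.mem_ofPred_eq]
      constructor
      · intro h1
        rcases lt_or_ge ‖ξ‖ (2 ^ (K + n)) with h2 | h2
        · exact Or.inl ⟨h1, h2⟩
        · exact Or.inr h2
      · rintro (h1 | h1)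
        · exact h1.1
        · exact hle.trans h1
    have := bandpass_union (measurableSet_annulus K (K + n)) measurableSet_ball.compl hdis u.1.1
    rw [sub_eq_iff_eq_add', ← this, hh]
    congr 1
  have hlim : Tendsto a atTop (𝓝 h) := by
    rw [tendsto_iff_norm_sub_tendsto_zero]
    have hb : ∀ n, ‖a n - h‖ ≤ √(gradSq u) * (1 / 2) ^ n := by
      intro n
      rw [norm_sub_rev, hdiff n]
      have h1 := lintegral_bandpass
        (measurableSet_ball (x := (0 : Space d)) (ε := (2 : ℝ) ^ (K + n))).compl u.1.1
      rw [lintegral_enorm_sq] at h1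
      have h2 := h1.trans_le (setLIntegral_fourier_le u (r := 2 ^ (K + n)) (by positivity)
        measurableSet_ball.compl (fun ξ hξ => by simpa using hξ))
      rw [ENNReal.ofReal_le_ofReal_iff (div_nonneg (gradSq_nonneg u) (by positivity))] at h2
      have h3 := Real.le_sqrt_of_sq_le h2
      rw [Real.sqrt_div (gradSq_nonneg u), Real.sqrt_sq (by positivity)] at h3
      refine h3.trans ?_
      rw [div_eq_mul_inv, one_div, inv_pow]
      refine mul_le_mul_of_nonneg_left ?_ (Real.sqrt_nonneg _)
      exact inv_anti₀ (by positivity) (pow_le_pow_right₀ (by norm_num) (by omega))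
    refine squeeze_zero (fun n => norm_nonneg _) hb ?_
    simpa using (tendsto_pow_atTop_nhds_zero_of_lt_one (by norm_num : (0 : ℝ) ≤ 1 / 2)
      (by norm_num)).const_mul (√(gradSq u))
  -- The annular pieces converge in L² to the high-frequency part; along an a.e. convergent
  -- subsequence, Fatou transfers their uniform L^q bound.
  obtain ⟨ns, -, hns⟩ := (tendstoInMeasure_of_tendsto_Lp hlim).exists_seq_tendsto_ae
  refine (Lp.eLpNorm_lim_le_liminf_eLpNorm
    (fun n => Lp.aestronglyMeasurable (a (ns n))) _ hns).trans ?_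
  refine liminf_le_of_frequently_le' (Eventually.frequently (Eventually.of_forall fun n => ?_))
  exact hK u (ns n)

end

end LiebThirring

namespace LiebThirring

noncomputable section

variable {d : ℕ}

/-! ### Operations on `H¹` -/

theorem IsWeakPartial.unique_zero {i : Fin d} {g : L2 d} (h : IsWeakPartial i 0 g) : g = 0 := by
  rw [Lp.eq_zero_iff_ae_eq_zero]
  refine ae_eq_zero_of_integral_contDiff_smul_eq_zero ((Lp.memLp g).locallyIntegrable (by norm_num))
    fun φ hφ hc => ?_
  have h1 := h φ hφ hc
  rw [integral_eq_zero_of_ae] at h1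
  · exact (neg_eq_zero.1 h1.symm)
  · exact ae_of_all _ fun x => by simp

/-- The gradient is stored as separate data, so uniqueness of weak derivatives is needed here. As a
consequence, the L² norm separates points of `H1` and unit vectors for it exist in every nonzero
subspace. -/
theorem H1.eq_zero_of_norm_eq_zero {u : H1 d} (h : ‖u.1.1‖ = 0) : u = 0 := by
  have h0 : u.1.1 = 0 := norm_eq_zero.1 h
  refine Subtype.ext (Prod.ext h0 (funext fun i => ?_))
  have := u.2 i
  rw [h0] at this
  exact this.unique_zero

/-- Smooth real functions which are bounded together with their gradient. -/
structure IsMultiplier (φ : Space d → ℝ) : Prop where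
  smooth : ContDiff ℝ ∞ φ
  bdd : ∃ B : ℝ, ∀ x, |φ x| ≤ B
  bdd_fderiv : ∃ B : ℝ, ∀ x, ‖fderiv ℝ φ x‖ ≤ B

theorem isMultiplier_innerCut (c : Space d) {R : ℝ} (hR : 0 < R) : IsMultiplier (innerCut c R) :=
  ⟨contDiff_innerCut c R, ⟨1, abs_innerCut_le c R⟩, ⟨_, norm_fderiv_innerCut_le c hR⟩⟩

theorem isMultiplier_outerCut (c : Space d) {R : ℝ} (hR : 0 < R) : IsMultiplier (outerCut c R) :=
  ⟨contDiff_outerCut c R, ⟨1, abs_outerCut_le c R⟩, ⟨_, norm_fderiv_outerCut_le c hR⟩⟩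

theorem memLp_smul_L2 {φ : Space d → ℝ} (hφ : Continuous φ) (hB : ∃ B : ℝ, ∀ x, |φ x| ≤ B)
    (f : L2 d) : MemLp (fun x => φ x • f x) 2 volume := by
  obtain ⟨B, hB⟩ := hB
  refine (Lp.memLp f).of_le_mul (c := B)
    (hφ.aestronglyMeasurable.smul (Lp.aestronglyMeasurable f)) (ae_of_all _ fun x => ?_)
  rw [norm_smul]
  exact mul_le_mul_of_nonneg_right (hB x) (norm_nonneg _)

/-- Multiplication by a bounded continuous function on `L²`. -/
def mulL2 (φ : Space d → ℝ) (hφ : Continuous φ) (hB : ∃ B : ℝ, ∀ x, |φ x| ≤ B) :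
    L2 d →ₗ[ℂ] L2 d where
  toFun f := (memLp_smul_L2 hφ hB f).toLp _
  map_add' f g := by
    rw [← MemLp.toLp_add]
    refine MemLp.toLp_congr _ _ ?_
    filter_upwards [Lp.coeFn_add f g] with x hx
    rw [hx, Pi.add_apply, smul_add, Pi.add_apply]
  map_smul' c f := by
    rw [RingHom.id_apply, ← MemLp.toLp_const_smul]
    refine MemLp.toLp_congr _ _ ?_
    filter_upwards [Lp.coeFn_smul c f] with x hx
    rw [hx, Pi.smul_apply, smul_comm, Pi.smul_apply]

theorem coeFn_mulL2 {φ : Space d → ℝ} (hφ : Continuous φ) (hB : ∃ B : ℝ, ∀ x, |φ x| ≤ B)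
    (f : L2 d) : mulL2 φ hφ hB f =ᵐ[volume] fun x => φ x • f x :=
  (memLp_smul_L2 hφ hB f).coeFn_toLp

theorem IsMultiplier.continuous_partial {φ : Space d → ℝ} (h : IsMultiplier φ) (i : Fin d) :
    Continuous fun x => fderiv ℝ φ x (EuclideanSpace.single i 1) :=
  (h.smooth.continuous_fderiv (by simp)).clm_apply continuous_const

theorem IsMultiplier.bdd_partial {φ : Space d → ℝ} (h : IsMultiplier φ) (i : Fin d) :
    ∃ B : ℝ, ∀ x, |fderiv ℝ φ x (EuclideanSpace.single i 1)| ≤ B := by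
  obtain ⟨B, hB⟩ := h.bdd_fderiv
  exact ⟨B, fun x => (abs_fderiv_single_le φ x i).trans (hB x)⟩

theorem IsWeakPartial.mul {i : Fin d} {u g : L2 d} (hu : IsWeakPartial i u g) {φ : Space d → ℝ}
    (h : IsMultiplier φ) :
    IsWeakPartial i (mulL2 φ h.smooth.continuous h.bdd u)
      (mulL2 φ h.smooth.continuous h.bdd g +
        mulL2 _ (h.continuous_partial i) (h.bdd_partial i) u) := by
  intro ψ hψ hc
  set e : Space d := EuclideanSpace.single i 1 with he
  have hψφ : ContDiff ℝ ∞ fun x => ψ x * φ x := hψ.mul h.smooth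
  have hc' : HasCompactSupport fun x => ψ x * φ x := hc.mul_right
  have h1 := hu _ hψφ hc'
  have hfd : ∀ x, fderiv ℝ (fun x => ψ x * φ x) x e =
      fderiv ℝ ψ x e * φ x + ψ x * fderiv ℝ φ x e := by
    intro x
    have h2 := ((hψ.differentiable (by simp) x).hasFDerivAt.mul
      (h.smooth.differentiable (by simp) x).hasFDerivAt).fderiv
    have h3 := DFunLike.congr_fun h2 e
    refine h3.trans ?_
    simp
    ring
  rw [integral_congr_ae (ae_of_all _ fun x => congrArg (· • u x) (hfd x))] at h1
  have hdψ : Continuous fun x => fderiv ℝ ψ x e :=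
    (hψ.continuous_fderiv (by simp)).clm_apply continuous_const
  have i1 : Integrable fun x => (fderiv ℝ ψ x e * φ x) • u x :=
    integrable_smul_L2 (hdψ.mul h.smooth.continuous) (hc.fderiv_apply ℝ _).mul_right u
  have i2 : Integrable fun x => (ψ x * fderiv ℝ φ x e) • u x :=
    integrable_smul_L2 (hψ.continuous.mul (h.continuous_partial i)) hc.mul_right u
  have i3 : Integrable fun x => (ψ x * φ x) • g x :=
    integrable_smul_L2 hψφ.continuous hc' g
  have e1 : ∫ x, fderiv ℝ ψ x e • (mulL2 φ h.smooth.continuous h.bdd u) x =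
      ∫ x, (fderiv ℝ ψ x e * φ x) • u x := by
    refine integral_congr_ae ?_
    filter_upwards [coeFn_mulL2 h.smooth.continuous h.bdd u] with x hx
    rw [hx, smul_smul]
  have e2 : ∫ x, ψ x • (mulL2 φ h.smooth.continuous h.bdd g +
        mulL2 _ (h.continuous_partial i) (h.bdd_partial i) u : L2 d) x =
      (∫ x, (ψ x * φ x) • g x) + ∫ x, (ψ x * fderiv ℝ φ x e) • u x := by
    rw [← integral_add i3 i2]
    refine integral_congr_ae ?_
    filter_upwards [coeFn_mulL2 h.smooth.continuous h.bdd g,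
      coeFn_mulL2 (h.continuous_partial i) (h.bdd_partial i) u,
      Lp.coeFn_add (mulL2 φ h.smooth.continuous h.bdd g)
        (mulL2 _ (h.continuous_partial i) (h.bdd_partial i) u)] with x hx hy hz
    rw [hz, Pi.add_apply, hx, hy, smul_add, smul_smul, smul_smul]
  rw [e1, e2, neg_add, ← h1]
  simp_rw [add_smul]
  rw [integral_add i1 i2]
  abel

/-- Multiplication by a multiplier on `H¹`. -/
def mulH1 (φ : Space d → ℝ) (h : IsMultiplier φ) : H1 d →ₗ[ℂ] H1 d where
  toFun u := ⟨(mulL2 φ h.smooth.continuous h.bdd u.1.1, fun i =>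
    mulL2 φ h.smooth.continuous h.bdd (u.1.2 i) +
      mulL2 _ (h.continuous_partial i) (h.bdd_partial i) u.1.1), fun i => (u.2 i).mul h⟩
  map_add' u v := by
    refine Subtype.ext (Prod.ext ?_ (funext fun i => ?_))
    · simp
    · simp only [Submodule.coe_add, Prod.fst_add, Prod.snd_add, Pi.add_apply, map_add]
      abel
  map_smul' c u := by
    refine Subtype.ext (Prod.ext ?_ (funext fun i => ?_))
    · simp
    · simp

theorem coeFn_mulH1 {φ : Space d → ℝ} (h : IsMultiplier φ) (u : H1 d) :
    (mulH1 φ h u).1.1 =ᵐ[volume] fun x => φ x • u.1.1 x :=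
  coeFn_mulL2 _ _ _

theorem coeFn_mulH1_grad {φ : Space d → ℝ} (h : IsMultiplier φ) (u : H1 d) (i : Fin d) :
    (mulH1 φ h u).1.2 i =ᵐ[volume] fun x =>
      φ x • u.1.2 i x + fderiv ℝ φ x (EuclideanSpace.single i 1) • u.1.1 x := by
  filter_upwards [coeFn_mulL2 h.smooth.continuous h.bdd (u.1.2 i),
      coeFn_mulL2 (h.continuous_partial i) (h.bdd_partial i) u.1.1,
      Lp.coeFn_add (mulL2 φ h.smooth.continuous h.bdd (u.1.2 i))
        (mulL2 _ (h.continuous_partial i) (h.bdd_partial i) u.1.1)] with x hx hy hz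
  refine hz.trans ?_
  rw [Pi.add_apply, hx, hy]

/-- Translation `u ↦ u(· - a)` on `L²`. -/
def shiftL2 (a : Space d) : L2 d →ₗᵢ[ℂ] L2 d :=
  Lp.compMeasurePreservingₗᵢ ℂ (fun x => x - a) (measurePreserving_sub_right volume a)

theorem coeFn_shiftL2 (a : Space d) (f : L2 d) : shiftL2 a f =ᵐ[volume] fun x => f (x - a) :=
  Lp.coeFn_compMeasurePreserving f (measurePreserving_sub_right volume a)

theorem IsWeakPartial.shift {i : Fin d} {u g : L2 d} (hu : IsWeakPartial i u g) (a : Space d) :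
    IsWeakPartial i (shiftL2 a u) (shiftL2 a g) := by
  intro ψ hψ hc
  have h1 := hu (fun x => ψ (x + a)) (hψ.comp (contDiff_id.add contDiff_const))
    (hc.comp_homeomorph (Homeomorph.addRight a))
  have key : ∀ (k : Space d → ℝ) (v : L2 d), ∫ x, k x • shiftL2 a v x =
      ∫ x, k (x + a) • v x := by
    intro k v
    rw [← integral_sub_right_eq_self (fun x => k (x + a) • v x) a]
    refine integral_congr_ae ?_
    filter_upwards [coeFn_shiftL2 a v] with x hx
    rw [hx, sub_add_cancel]
  rw [key, key, ← h1]
  simp_rw [fderiv_comp_add_right]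

/-- Translation `u ↦ u(· - a)` on `H¹`. -/
def shiftH1 (a : Space d) : H1 d →ₗ[ℂ] H1 d where
  toFun u := ⟨(shiftL2 a u.1.1, fun i => shiftL2 a (u.1.2 i)), fun i => (u.2 i).shift a⟩
  map_add' u v := by
    refine Subtype.ext (Prod.ext ?_ (funext fun i => ?_)) <;> simp
  map_smul' c u := by
    refine Subtype.ext (Prod.ext ?_ (funext fun i => ?_)) <;> simp

theorem norm_shiftH1 (a : Space d) (u : H1 d) : ‖(shiftH1 a u).1.1‖ = ‖u.1.1‖ :=
  (shiftL2 a).norm_map _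

theorem gradSq_shiftH1 (a : Space d) (u : H1 d) : gradSq (shiftH1 a u) = gradSq u :=
  Finset.sum_congr rfl fun i _ => by
    rw [show ‖(shiftH1 a u).1.2 i‖ = ‖u.1.2 i‖ from (shiftL2 a).norm_map _]

theorem energy_shiftH1 (V : Space d → ℝ) (a : Space d) (u : H1 d) :
    energy V (shiftH1 a u) = energy (fun x => V (x + a)) u := by
  have h := gradSq_shiftH1 a u
  unfold gradSq at h
  unfold energy
  rw [h, ← integral_sub_right_eq_self (fun x => V (x + a) * ‖u.1.1 x‖ ^ 2) a]
  congr 1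
  refine integral_congr_ae ?_
  filter_upwards [coeFn_shiftL2 a u.1.1] with x hx
  rw [sub_add_cancel, ← hx]
  rfl

theorem memLp_ofReal_comp {φ : Space d → ℝ} (hφ : Continuous φ) (hc : HasCompactSupport φ) :
    MemLp (fun x => (φ x : ℂ)) 2 volume :=
  (Complex.continuous_ofReal.comp hφ).memLp_of_hasCompactSupport
    (hc.comp_left (g := Complex.ofReal) rfl)

/-- A real test function as an element of `H¹`. -/
def testH1 (φ : Space d → ℝ) (hφ : ContDiff ℝ ∞ φ) (hc : HasCompactSupport φ) : H1 d :=
  ⟨((memLp_ofReal_comp hφ.continuous hc).toLp _, fun i =>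
    (memLp_ofReal_comp ((hφ.continuous_fderiv (by simp)).clm_apply continuous_const)
      (hc.fderiv_apply ℝ (EuclideanSpace.single i 1))).toLp _), by
    intro i ψ hψ hψc
    set e : Space d := EuclideanSpace.single i 1
    have hdφ : Continuous fun x => fderiv ℝ φ x e :=
      (hφ.continuous_fderiv (by simp)).clm_apply continuous_const
    have hdψ : Continuous fun x => fderiv ℝ ψ x e :=
      (hψ.continuous_fderiv (by simp)).clm_apply continuous_const
    have h1 := integral_smul_fderiv_eq_neg_fderiv_smul_of_integrable (μ := volume) (f := φ) (g := ψ)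
      (v := e)
      ((hdφ.smul hψ.continuous).integrable_of_hasCompactSupport hψc.smul_left)
      ((hφ.continuous.smul hdψ).integrable_of_hasCompactSupport hc.smul_right)
      ((hφ.continuous.smul hψ.continuous).integrable_of_hasCompactSupport hc.smul_right)
      (fun x _ => hφ.differentiable (by simp) x) (fun x _ => hψ.differentiable (by simp) x)
    have e1 : ∫ x, fderiv ℝ ψ x e • ((memLp_ofReal_comp hφ.continuous hc).toLp _ : L2 d) x =
        ((∫ x, φ x • fderiv ℝ ψ x e : ℝ) : ℂ) := by
      rw [← integral_complex_ofReal]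
      refine integral_congr_ae ?_
      filter_upwards [(memLp_ofReal_comp hφ.continuous hc).coeFn_toLp] with x hx
      rw [hx]
      simp [mul_comm]
    have e2 : ∫ x, ψ x • ((memLp_ofReal_comp hdφ (hc.fderiv_apply ℝ e)).toLp _ : L2 d) x =
        ((∫ x, fderiv ℝ φ x e • ψ x : ℝ) : ℂ) := by
      rw [← integral_complex_ofReal]
      refine integral_congr_ae ?_
      filter_upwards [(memLp_ofReal_comp hdφ (hc.fderiv_apply ℝ e)).coeFn_toLp] with x hx
      rw [hx]
      simp [mul_comm]
    refine e1.trans (Eq.trans ?_ (congrArg Neg.neg e2.symm))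
    rw [h1, Complex.ofReal_neg]⟩

theorem coeFn_testH1 {φ : Space d → ℝ} (hφ : ContDiff ℝ ∞ φ) (hc : HasCompactSupport φ) :
    (testH1 φ hφ hc).1.1 =ᵐ[volume] fun x => (φ x : ℂ) :=
  (memLp_ofReal_comp hφ.continuous hc).coeFn_toLp

theorem coeFn_testH1_grad {φ : Space d → ℝ} (hφ : ContDiff ℝ ∞ φ) (hc : HasCompactSupport φ)
    (i : Fin d) : (testH1 φ hφ hc).1.2 i =ᵐ[volume] fun x =>
      (fderiv ℝ φ x (EuclideanSpace.single i 1) : ℂ) :=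
  (memLp_ofReal_comp ((hφ.continuous_fderiv (by simp)).clm_apply continuous_const)
    (hc.fderiv_apply ℝ (EuclideanSpace.single i 1))).coeFn_toLp

end

end LiebThirring

namespace LiebThirring

noncomputable section

/-! ### Hermitian quadratic forms -/

open ComplexConjugate in
/-- `Q` is the quadratic form of a Hermitian sesquilinear form. -/
def IsHermQuad {E : Type*} [AddCommGroup E] [Module ℂ E] (Q : E → ℝ) : Prop :=
  ∃ B : E → E → ℂ, (∀ u, IsLinearMap ℂ (B u)) ∧ (∀ u v, B v u = conj (B u v)) ∧
    ∀ u, B u u = Q u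

section HermQuad

variable {E F : Type*} [AddCommGroup E] [Module ℂ E] [AddCommGroup F] [Module ℂ F]

theorem IsHermQuad.norm_sq {H : Type*} [NormedAddCommGroup H] [InnerProductSpace ℂ H]
    (L : E →ₗ[ℂ] H) : IsHermQuad fun u => ‖L u‖ ^ 2 :=
  ⟨fun u v => inner ℂ (L u) (L v),
    fun u => ⟨fun v w => by beta_reduce; rw [map_add, inner_add_right],
      fun c v => by beta_reduce; rw [map_smul, inner_smul_right, smul_eq_mul]⟩,
    fun u v => (inner_conj_symm _ _).symm,
    fun u => by beta_reduce; rw [inner_self_eq_norm_sq_to_K]; simp⟩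

theorem IsHermQuad.add {P Q : E → ℝ} (hP : IsHermQuad P) (hQ : IsHermQuad Q) :
    IsHermQuad fun u => P u + Q u := by
  obtain ⟨B, h1, h2, h3⟩ := hP
  obtain ⟨C, k1, k2, k3⟩ := hQ
  refine ⟨fun u v => B u v + C u v, fun u => ⟨fun v w => ?_, fun c v => ?_⟩, fun u v => ?_,
    fun u => ?_⟩
  · beta_reduce; rw [(h1 u).map_add, (k1 u).map_add]; abel
  · beta_reduce; rw [(h1 u).map_smul, (k1 u).map_smul, smul_add]
  · beta_reduce; rw [h2 u v, k2 u v, map_add]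
  · beta_reduce; rw [h3, k3, Complex.ofReal_add]

theorem IsHermQuad.const_mul {P : E → ℝ} (hP : IsHermQuad P) (c : ℝ) :
    IsHermQuad fun u => c * P u := by
  obtain ⟨B, h1, h2, h3⟩ := hP
  refine ⟨fun u v => c * B u v, fun u => ⟨fun v w => ?_, fun a v => ?_⟩, fun u v => ?_,
    fun u => ?_⟩
  · beta_reduce; rw [(h1 u).map_add, mul_add]
  · beta_reduce; rw [(h1 u).map_smul, smul_eq_mul, smul_eq_mul]; ring
  · beta_reduce; rw [h2 u v, map_mul, Complex.conj_ofReal]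
  · beta_reduce; rw [h3, Complex.ofReal_mul]

theorem IsHermQuad.sum {ι : Type*} (s : Finset ι) {P : ι → E → ℝ} (hP : ∀ i, IsHermQuad (P i)) :
    IsHermQuad fun u => ∑ i ∈ s, P i u := by
  classical
  induction s using Finset.induction_on with
  | empty => exact ⟨fun _ _ => 0, fun _ => ⟨by simp, by simp⟩, by simp, by simp⟩
  | insert i s hi ih =>
    simp_rw [Finset.sum_insert hi]
    exact (hP i).add ih

theorem IsHermQuad.comp {P : F → ℝ} (hP : IsHermQuad P) (L : E →ₗ[ℂ] F) :
    IsHermQuad fun u => P (L u) := by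
  obtain ⟨B, h1, h2, h3⟩ := hP
  exact ⟨fun u v => B (L u) (L v), fun u => ⟨fun v w => by beta_reduce; rw [map_add, (h1 _).map_add],
    fun c v => by beta_reduce; rw [map_smul, (h1 _).map_smul]⟩, fun u v => h2 _ _, fun u => h3 _⟩

/-- If all subspaces on which a Hermitian form is negative have dimension at most `a`, then the form
is nonnegative on a subspace of codimension at most `a`. -/
theorem IsHermQuad.exists_nonneg [FiniteDimensional ℂ E] {Q : E → ℝ} (hQ : IsHermQuad Q) {a : ℕ}
    (h : ∀ F : Submodule ℂ E, (∀ u ∈ F, u ≠ 0 → Q u < 0) → Module.finrank ℂ F ≤ a) :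
    ∃ F : Submodule ℂ E, Module.finrank ℂ E ≤ Module.finrank ℂ F + a ∧ ∀ u ∈ F, 0 ≤ Q u := by
  obtain ⟨B, hlin, hsymm, hdiag⟩ := hQ
  set S : Set ℕ := {n | ∃ F : Submodule ℂ E, (∀ u ∈ F, u ≠ 0 → Q u < 0) ∧ Module.finrank ℂ F = n}
    with hS
  have hSn : S.Nonempty := ⟨_, ⊥, by simp, rfl⟩
  have hSb : BddAbove S := ⟨a, by rintro n ⟨F, hF, rfl⟩; exact h F hF⟩
  -- A is a negative subspace of maximal dimension. Its orthogonal complement for the form is the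
  -- kernel of the n functionals `T`, hence has codimension at most n ≤ a.
  obtain ⟨A, hA, hAn⟩ := Nat.sSup_mem hSn hSb
  set n := sSup S with hn
  let b := Module.finBasisOfFinrankEq ℂ A hAn
  let T : E →ₗ[ℂ] (Fin n → ℂ) := LinearMap.pi fun i => (hlin (b i)).mk'
  have hT : ∀ v ∈ LinearMap.ker T, ∀ w ∈ A, B v w = 0 := by
    intro v hv w hw
    have h1 : ∀ i, B v (b i) = 0 := fun i => by
      have : B (b i) v = 0 := congrFun (LinearMap.mem_ker.1 hv) i
      rw [hsymm (b i) v, this, map_zero]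
    have h2 : ((hlin v).mk' (B v)).comp A.subtype = 0 := b.ext fun i => h1 i
    exact DFunLike.congr_fun h2 (⟨w, hw⟩ : A)
  refine ⟨LinearMap.ker T, ?_, ?_⟩
  · have h1 := LinearMap.finrank_range_add_finrank_ker T
    have h2 : Module.finrank ℂ (LinearMap.range T) ≤ n := by
      simpa using Submodule.finrank_le (LinearMap.range T)
    have h3 : n ≤ a := hAn ▸ h A hA
    omega
  · intro v hv
    -- A negative vector v orthogonal to A could be adjoined to A, since Q(w + cv) = Q(w) + |c|²
    -- Q(v); this contradicts maximality.
    by_contra! hneg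
    have hvA : v ∉ A := by
      intro hvA
      have h1 := hT v hv v hvA
      rw [hdiag] at h1
      have : Q v = 0 := by exact_mod_cast h1
      linarith
    have hfin := Submodule.finrank_sup_span_singleton hvA
    have hmem : Module.finrank ℂ (A ⊔ Submodule.span ℂ {v} : Submodule ℂ E) ∈ S := by
      refine ⟨_, ?_, rfl⟩
      intro u hu hu0
      obtain ⟨w, hw, z, hz, rfl⟩ := Submodule.mem_sup.1 hu
      obtain ⟨c, rfl⟩ := Submodule.mem_span_singleton.1 hz
      have hvw : B v w = 0 := hT v hv w hw
      have hwv : B w v = 0 := by rw [hsymm v w, hvw, map_zero]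
      have hcv : B (c • v) w = 0 := by
        rw [hsymm w (c • v), (hlin w).map_smul, hwv, smul_zero, map_zero]
      have hcc : B (c • v) (c • v) = ((‖c‖ ^ 2 * Q v : ℝ) : ℂ) := by
        rw [(hlin (c • v)).map_smul, hsymm v (c • v), (hlin v).map_smul, hdiag, smul_eq_mul,
          smul_eq_mul, map_mul, Complex.conj_ofReal, ← mul_assoc, Complex.mul_conj,
          Complex.normSq_eq_norm_sq]
        push_cast
        rfl
      have hexp : Q (w + c • v) = Q w + ‖c‖ ^ 2 * Q v := by
        have h1 : B (w + c • v) (w + c • v) = ((Q w + ‖c‖ ^ 2 * Q v : ℝ) : ℂ) := by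
          have h2 : ∀ y, B (w + c • v) y = B w y + B (c • v) y := by
            intro y
            rw [hsymm y, (hlin y).map_add, map_add, ← hsymm, ← hsymm]
          rw [h2, (hlin _).map_add, (hlin _).map_add, (hlin w).map_smul, hwv, hcv, hcc, hdiag]
          push_cast
          simp
        rw [hdiag] at h1
        exact_mod_cast h1
      rw [hexp]
      by_cases hw0 : w = 0
      · have hc : c ≠ 0 := by
          rintro rfl
          exact hu0 (by simp [hw0])
        have hQ0 : Q w = 0 := by
          have h1 := hdiag w
          rw [hw0, (hlin 0).map_zero] at h1
          rw [hw0]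
          exact_mod_cast h1.symm
        have : 0 < ‖c‖ ^ 2 := by positivity
        rw [hQ0]
        nlinarith
      · have h1 := hA w hw hw0
        have : 0 ≤ ‖c‖ ^ 2 := by positivity
        nlinarith
    have := le_csSup hSb hmem
    rw [hfin, hAn] at this
    omega

theorem IsHermQuad.map_zero {Q : E → ℝ} (hQ : IsHermQuad Q) : Q 0 = 0 := by
  obtain ⟨B, hlin, -, hdiag⟩ := hQ
  have h1 := hdiag 0
  rw [(hlin 0).map_zero] at h1
  exact_mod_cast h1.symm

theorem exists_submodule_finrank_eq (E : Submodule ℂ F) {k : ℕ} (hk : k ≤ Module.finrank ℂ E) :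
    ∃ G ≤ E, Module.finrank ℂ G = k := by
  obtain ⟨f, hf⟩ := exists_linearIndependent_of_le_finrank hk
  have hf' : LinearIndependent ℂ (fun i => (f i : F)) :=
    hf.map' E.subtype (Submodule.ker_subtype E)
  refine ⟨Submodule.span ℂ (Set.range fun i => (f i : F)), Submodule.span_le.2 ?_, ?_⟩
  · rintro _ ⟨i, rfl⟩
    exact (f i).2
  · rw [finrank_span_eq_card hf', Fintype.card_fin]

/-- If `P (S u) + Q (T u) < 0` on a space of dimension `a + b + 1`, then `P` is negative on a space
of dimension `a + 1` or `Q` is negative on a space of dimension `b + 1`. -/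
theorem exists_neg_of_split {P Q : F → ℝ} (hP : IsHermQuad P) (hQ : IsHermQuad Q)
    (S T : F →ₗ[ℂ] F) {a b : ℕ} (E : Submodule ℂ F) (hE : Module.finrank ℂ E = a + b + 1)
    (hneg : ∀ u ∈ E, u ≠ 0 → P (S u) + Q (T u) < 0) :
    (∃ G : Submodule ℂ F, Module.finrank ℂ G = a + 1 ∧ ∀ u ∈ G, u ≠ 0 → P u < 0) ∨
      ∃ G : Submodule ℂ F, Module.finrank ℂ G = b + 1 ∧ ∀ u ∈ G, u ≠ 0 → Q u < 0 := by
  by_contra! hcon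
  -- `finrank` is 0 on infinite-dimensional spaces, so the value a + b + 1 forces finite dimension.
  have hfd : FiniteDimensional ℂ E := Module.finite_of_finrank_pos (by omega)
  -- A subspace on which the pulled-back form is negative maps injectively by `L`, because a kernel
  -- vector would have value 0. So a bound on negative dimensions passes to the pullback and yields
  -- a nonnegative subspace of codimension at most k.
  have key : ∀ (R : F → ℝ) (_ : IsHermQuad R) (L : F →ₗ[ℂ] F) (k : ℕ),
      (∀ G : Submodule ℂ F, Module.finrank ℂ G = k + 1 → ∃ u ∈ G, u ≠ 0 ∧ 0 ≤ R u) →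
      ∃ G : Submodule ℂ E, Module.finrank ℂ E ≤ Module.finrank ℂ G + k ∧
        ∀ u ∈ G, 0 ≤ R (L u) := by
    intro R hR L k hk
    refine (hR.comp (L.comp E.subtype)).exists_nonneg fun G hG => ?_
    by_contra! hlt
    have hinj : Function.Injective ((L.comp E.subtype).comp G.subtype) := by
      rw [← LinearMap.ker_eq_bot, LinearMap.ker_eq_bot']
      intro u hu
      by_contra hne
      have h1 := hG u u.2 (fun h0 => hne (Subtype.ext h0))
      have h2 : (L.comp E.subtype) (u : E) = 0 := hu
      rw [h2, hR.map_zero] at h1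
      exact h1.false
    obtain ⟨G', hG', hG'r⟩ := exists_submodule_finrank_eq
      (LinearMap.range ((L.comp E.subtype).comp G.subtype))
      (k := k + 1) (by rw [LinearMap.finrank_range_of_inj hinj]; exact hlt)
    obtain ⟨v, hv, hv0, hRv⟩ := hk G' hG'r
    obtain ⟨u, rfl⟩ := hG' hv
    have hu0 : (u : E) ≠ 0 := by
      intro h0
      have : u = 0 := Subtype.ext h0
      exact hv0 (by rw [this, _root_.map_zero])
    exact absurd (hG u u.2 hu0) (not_lt.2 hRv)
  obtain ⟨G, hG, hG'⟩ := key P hP S a hcon.1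
  obtain ⟨H, hH, hH'⟩ := key Q hQ T b hcon.2
  -- Codimensions at most a and b in dimension a + b + 1 leave a common nonzero vector, on which
  -- both forms are nonnegative.
  have hdim := Submodule.finrank_sup_add_finrank_inf_eq G H
  have hle := Submodule.finrank_le (G ⊔ H)
  have hpos : 0 < Module.finrank ℂ (G ⊓ H : Submodule ℂ E) := by omega
  have : Nontrivial (G ⊓ H : Submodule ℂ E) := Module.nontrivial_of_finrank_pos hpos
  obtain ⟨⟨u, hu⟩, hu0⟩ := exists_ne (0 : (G ⊓ H : Submodule ℂ E))
  have h1 := hG' u hu.1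
  have h2 := hH' u hu.2
  have h3 := hneg u u.2 (fun h0 => hu0 (Subtype.ext (Subtype.ext h0)))
  linarith

end HermQuad

end

end LiebThirring

namespace LiebThirring

noncomputable section

variable {d : ℕ} {p : ℝ}

/-! ### The quadratic form of the potential energy -/

/-- The potential `V` is nonnegative and lies in `L^p`. -/
def IsPot (p : ℝ) (V : Space d → ℝ) : Prop :=
  0 ≤ᵐ[volume] V ∧ MemLp V (ENNReal.ofReal p) volume

/-- `∫ V |u|²`. -/
def pot (V : Space d → ℝ) (u : H1 d) : ℝ := ∫ x, V x * ‖u.1.1 x‖ ^ 2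

theorem energy_eq (V : Space d → ℝ) (u : H1 d) : energy V u = gradSq u - pot V u := rfl

theorem lintegral_mul_enorm_sq_le (hp : 1 < p) {V : Space d → ℝ} {f : Space d → ℂ}
    (hV : AEStronglyMeasurable V volume) (hf : AEStronglyMeasurable f volume) :
    ∫⁻ x, ‖V x‖ₑ * ‖f x‖ₑ ^ 2 ≤ eLpNorm V (ENNReal.ofReal p) volume *
      eLpNorm f (ENNReal.ofReal (2 * p / (p - 1))) volume ^ 2 := by
  have hp0 : 0 < p - 1 := by linarith
  have hpq : p.HolderConjugate (p / (p - 1)) := Real.HolderConjugate.conjExponent hp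
  have h := ENNReal.lintegral_mul_le_Lp_mul_Lq volume hpq hV.aemeasurable.enorm
    (hf.aemeasurable.enorm.pow_const 2)
  refine h.trans_eq ?_
  rw [eLpNorm_ofReal_eq V (by linarith), eLpNorm_ofReal_eq f (by positivity)]
  congr 1
  have h1 : ∀ x, (‖f x‖ₑ ^ 2) ^ (p / (p - 1)) = ‖f x‖ₑ ^ (2 * p / (p - 1)) := fun x => by
    rw [← ENNReal.rpow_natCast, ← ENNReal.rpow_mul]
    congr 1
    push_cast; ring
  simp_rw [h1]
  rw [← ENNReal.rpow_natCast, ← ENNReal.rpow_mul]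
  congr 1
  push_cast
  field_simp

/-- The exponent q = 2p/(p-1) is the one paired with L^p by Hölder, and 1/2 - 1/q = 1/(2p). Sobolev
subcriticality thus reads d < 2p, which is γ > 0 when p = γ + d/2. -/
theorem sobolev_exponent (hp : 1 < p) (hpd : d < 2 * p) :
    2 < 2 * p / (p - 1) ∧ d * (1 / 2 - 1 / (2 * p / (p - 1))) < 1 := by
  have hp0 : 0 < p - 1 := by linarith
  constructor
  · rw [lt_div_iff₀ hp0]; linarith
  · have : 1 / 2 - 1 / (2 * p / (p - 1)) = 1 / (2 * p) := by field_simp; ring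
    rw [this, mul_one_div, div_lt_one (by linarith)]
    exact hpd

/-- The subcritical Sobolev inequality, with a small constant in front of the gradient. -/
theorem eLpNorm_H1_le (hp : 1 < p) (hpd : d < 2 * p) {δ : ℝ} (hδ : 0 < δ) :
    ∃ C : ℝ, 0 ≤ C ∧ ∀ u : H1 d, eLpNorm u.1.1 (ENNReal.ofReal (2 * p / (p - 1))) volume ≤
      ENNReal.ofReal (δ * √(gradSq u) + C * ‖u.1.1‖) := by
  obtain ⟨h2, h3⟩ := sobolev_exponent hp hpd
  obtain ⟨Λ, -, hΛ⟩ := eLpNorm_highpass_le h2 h3 hδ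
  obtain ⟨C, hC, hlow⟩ := eLpNorm_lowpass_le (d := d) Λ h2
  refine ⟨C, hC, fun u => ?_⟩
  have hsplit : u.1.1 = bandpass (measurableSet_ball (x := 0) (ε := Λ)).compl u.1.1 +
      bandpass (measurableSet_ball (x := 0) (ε := Λ)) u.1.1 := by
    rw [← bandpass_union measurableSet_ball.compl measurableSet_ball disjoint_compl_left]
    conv_lhs => rw [← bandpass_univ u.1.1]
    congr 1
    exact (Set.compl_union_self _).symm
  conv_lhs => rw [hsplit]
  rw [eLpNorm_congr_ae (Lp.coeFn_add _ _)]
  refine (eLpNorm_add_le (Lp.aestronglyMeasurable _) (Lp.aestronglyMeasurable _)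
    (ENNReal.one_le_ofReal.2 (by linarith))).trans ((add_le_add (hΛ u) (hlow u.1.1)).trans_eq ?_)
  rw [ENNReal.ofReal_add (by positivity) (by positivity)]

/-- Hölder followed by the Sobolev bound with small gradient constant δ. The relative form bound ε
is arbitrary, and C depends on V only through the norm bound m. -/
theorem lintegral_pot_le (hp : 1 < p) (hpd : d < 2 * p) {m : ℝ} (hm : 0 ≤ m) {ε : ℝ} (hε : 0 < ε) :
    ∃ C : ℝ, 0 ≤ C ∧ ∀ V : Space d → ℝ, AEStronglyMeasurable V volume →
      eLpNorm V (ENNReal.ofReal p) volume ≤ ENNReal.ofReal m → ∀ u : H1 d,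
        ∫⁻ x, ‖V x‖ₑ * ‖u.1.1 x‖ₑ ^ 2 ≤ ENNReal.ofReal (ε * gradSq u + C * ‖u.1.1‖ ^ 2) := by
  -- Chosen so that m · 2δ² ≤ ε after squaring the two-term Sobolev bound.
  set δ : ℝ := √(ε / (2 * (m + 1))) with hδd
  have hδ : 0 < δ := by positivity
  obtain ⟨C, hC, hS⟩ := eLpNorm_H1_le hp hpd hδ
  refine ⟨m * (2 * C ^ 2), by positivity, fun V hV hVm u => ?_⟩
  refine (lintegral_mul_enorm_sq_le hp hV (Lp.aestronglyMeasurable u.1.1)).trans ?_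
  refine (mul_le_mul' hVm (pow_le_pow_left' (hS u) 2)).trans ?_
  rw [← ENNReal.ofReal_pow (by positivity), ← ENNReal.ofReal_mul hm]
  refine ENNReal.ofReal_le_ofReal ?_
  have hg := gradSq_nonneg u
  have h1 : (δ * √(gradSq u) + C * ‖u.1.1‖) ^ 2 ≤
      2 * δ ^ 2 * gradSq u + 2 * C ^ 2 * ‖u.1.1‖ ^ 2 := by
    have h2 : √(gradSq u) ^ 2 = gradSq u := Real.sq_sqrt hg
    nlinarith [sq_nonneg (δ * √(gradSq u) - C * ‖u.1.1‖)]
  have h3 : δ ^ 2 = ε / (2 * (m + 1)) := Real.sq_sqrt (by positivity)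
  have h4 : m * (2 * δ ^ 2) ≤ ε := by
    rw [h3]
    have : m * (2 * (ε / (2 * (m + 1)))) = ε * (m / (m + 1)) := by field_simp
    rw [this]
    exact mul_le_of_le_one_right hε.le ((div_le_one (by linarith)).2 (by linarith))
  calc m * (δ * √(gradSq u) + C * ‖u.1.1‖) ^ 2
      ≤ m * (2 * δ ^ 2 * gradSq u + 2 * C ^ 2 * ‖u.1.1‖ ^ 2) := by gcongr
    _ = m * (2 * δ ^ 2) * gradSq u + m * (2 * C ^ 2) * ‖u.1.1‖ ^ 2 := by ring
    _ ≤ _ := by gcongr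

theorem enorm_pot_integrand (V : Space d → ℝ) (u : H1 d) (x : Space d) :
    ‖V x * ‖u.1.1 x‖ ^ 2‖ₑ = ‖V x‖ₑ * ‖u.1.1 x‖ₑ ^ 2 := by
  rw [enorm_mul, enorm_pow, enorm_norm]

theorem aestronglyMeasurable_pot {V : Space d → ℝ} (hV : AEStronglyMeasurable V volume) (u : H1 d) :
    AEStronglyMeasurable (fun x => V x * ‖u.1.1 x‖ ^ 2) volume :=
  hV.mul ((Lp.aestronglyMeasurable u.1.1).norm.pow 2)

theorem integrable_pot (hp : 1 < p) (hpd : d < 2 * p) {V : Space d → ℝ}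
    (hV : MemLp V (ENNReal.ofReal p) volume) (u : H1 d) :
    Integrable fun x => V x * ‖u.1.1 x‖ ^ 2 := by
  obtain ⟨C, -, hC⟩ := lintegral_pot_le hp hpd
    (m := (eLpNorm V (ENNReal.ofReal p) volume).toReal) ENNReal.toReal_nonneg one_pos
  refine ⟨aestronglyMeasurable_pot hV.1 u, ?_⟩
  rw [hasFiniteIntegral_iff_enorm]
  simp_rw [enorm_pot_integrand]
  refine (hC V hV.1 ?_ u).trans_lt ENNReal.ofReal_lt_top
  rw [ENNReal.ofReal_toReal hV.2.ne]

theorem abs_pot_le (hp : 1 < p) (hpd : d < 2 * p) {m : ℝ} (hm : 0 ≤ m) {ε : ℝ} (hε : 0 < ε) :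
    ∃ C : ℝ, 0 ≤ C ∧ ∀ V : Space d → ℝ, AEStronglyMeasurable V volume →
      eLpNorm V (ENNReal.ofReal p) volume ≤ ENNReal.ofReal m → ∀ u : H1 d,
        |pot V u| ≤ ε * gradSq u + C * ‖u.1.1‖ ^ 2 := by
  obtain ⟨C, hC, h⟩ := lintegral_pot_le (d := d) hp hpd hm hε
  refine ⟨C, hC, fun V hV hVm u => ?_⟩
  have hn : 0 ≤ ε * gradSq u + C * ‖u.1.1‖ ^ 2 :=
    add_nonneg (mul_nonneg hε.le (gradSq_nonneg u)) (by positivity)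
  rw [← Real.norm_eq_abs, ← ENNReal.ofReal_le_ofReal_iff hn, ofReal_norm, pot]
  refine (enorm_integral_le_lintegral_enorm _).trans ?_
  simp_rw [enorm_pot_integrand]
  exact h V hV hVm u

theorem pot_nonneg {V : Space d → ℝ} (hV : 0 ≤ᵐ[volume] V) (u : H1 d) : 0 ≤ pot V u :=
  integral_nonneg_of_ae (by
    filter_upwards [hV] with x hx
    exact mul_nonneg hx (by positivity))

theorem pot_mono (hp : 1 < p) (hpd : d < 2 * p) {V W : Space d → ℝ}
    (hV : MemLp V (ENNReal.ofReal p) volume) (hW : MemLp W (ENNReal.ofReal p) volume)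
    (h : V ≤ᵐ[volume] W) (u : H1 d) : pot V u ≤ pot W u :=
  integral_mono_ae (integrable_pot hp hpd hV u) (integrable_pot hp hpd hW u) (by
    filter_upwards [h] with x hx
    exact mul_le_mul_of_nonneg_right hx (by positivity))

/-- Writing ∫ V|u|² as ‖√V u‖² exhibits it as the quadratic form of an inner product, which
`isHermQuad_energy` requires. -/
theorem memLp_sqrt_mul (hp : 1 < p) (hpd : d < 2 * p) {V : Space d → ℝ}
    (hV : MemLp V (ENNReal.ofReal p) volume) (u : H1 d) :
    MemLp (fun x => √(V x) • u.1.1 x) 2 volume := by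
  have hm : AEStronglyMeasurable (fun x => √(V x) • u.1.1 x) volume :=
    (Real.continuous_sqrt.comp_aestronglyMeasurable hV.1).smul (Lp.aestronglyMeasurable u.1.1)
  rw [memLp_two_iff_integrable_sq_norm hm]
  refine (integrable_pot hp hpd hV u).mono (hm.norm.pow 2) (ae_of_all _ fun x => ?_)
  rw [norm_smul, mul_pow, norm_mul, norm_mul]
  refine mul_le_mul_of_nonneg_right ?_ (norm_nonneg _)
  rw [Real.norm_of_nonneg (Real.sqrt_nonneg _), Real.norm_of_nonneg (by positivity)]
  rcases le_total 0 (V x) with h | h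
  · rw [Real.sq_sqrt h]; exact le_abs_self _
  · rw [Real.sqrt_eq_zero_of_nonpos h]; simp

/-- Multiplication by `√V` as a map from `H¹` to `L²`. -/
def sqrtMul (hp : 1 < p) (hpd : d < 2 * p) {V : Space d → ℝ}
    (hV : MemLp V (ENNReal.ofReal p) volume) : H1 d →ₗ[ℂ] L2 d where
  toFun u := (memLp_sqrt_mul hp hpd hV u).toLp _
  map_add' u v := by
    rw [← MemLp.toLp_add]
    refine MemLp.toLp_congr _ _ ?_
    filter_upwards [Lp.coeFn_add u.1.1 v.1.1] with x hx
    rw [Submodule.coe_add, Prod.fst_add, hx, Pi.add_apply, smul_add, Pi.add_apply]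
  map_smul' c u := by
    rw [RingHom.id_apply, ← MemLp.toLp_const_smul]
    refine MemLp.toLp_congr _ _ ?_
    filter_upwards [Lp.coeFn_smul c u.1.1] with x hx
    rw [Submodule.coe_smul, Prod.smul_fst, hx, Pi.smul_apply, smul_comm, Pi.smul_apply]

theorem norm_sqrtMul_sq (hp : 1 < p) (hpd : d < 2 * p) {V : Space d → ℝ} (hV : IsPot p V)
    (u : H1 d) : ‖sqrtMul hp hpd hV.2 u‖ ^ 2 = pot V u := by
  rw [← integral_norm_sq, pot]
  refine integral_congr_ae ?_
  filter_upwards [(memLp_sqrt_mul hp hpd hV.2 u).coeFn_toLp, hV.1] with x hx hVx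
  rw [show (sqrtMul hp hpd hV.2 u) x = √(V x) • u.1.1 x from hx, norm_smul, mul_pow,
    Real.norm_of_nonneg (Real.sqrt_nonneg _), Real.sq_sqrt hVx]

theorem isHermQuad_energy (hp : 1 < p) (hpd : d < 2 * p) {V : Space d → ℝ} (hV : IsPot p V) :
    IsHermQuad (energy V) := by
  have h1 : IsHermQuad fun u : H1 d => ∑ i, ‖u.1.2 i‖ ^ 2 :=
    IsHermQuad.sum _ fun i => IsHermQuad.norm_sq
      ((LinearMap.proj i).comp ((LinearMap.snd ℂ _ _).comp (H1 d).subtype))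
  have h2 := (IsHermQuad.norm_sq (sqrtMul hp hpd hV.2)).const_mul (-1)
  have h3 := h1.add h2
  have h4 : energy V = fun u : H1 d =>
      (∑ i, ‖u.1.2 i‖ ^ 2) + (-1) * ‖sqrtMul hp hpd hV.2 u‖ ^ 2 := by
    funext u
    rw [norm_sqrtMul_sq hp hpd hV, energy_eq, gradSq]
    ring
  rw [h4]
  exact h3

theorem isHermQuad_normSq : IsHermQuad fun u : H1 d => ‖u.1.1‖ ^ 2 :=
  IsHermQuad.norm_sq ((LinearMap.fst ℂ _ _).comp (H1 d).subtype)

/-! ### Min-max levels and negative subspaces -/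

/-- The energy is at most `-t ‖u‖²` on a subspace of dimension `j`. -/
def HasNegSubspace (V : Space d → ℝ) (j : ℕ) (t : ℝ) : Prop :=
  ∃ E : Submodule ℂ (H1 d), Module.finrank ℂ E = j ∧ ∀ u ∈ E, energy V u ≤ -t * ‖u.1.1‖ ^ 2

theorem energy_smul (V : Space d → ℝ) (c : ℂ) (u : H1 d) :
    energy V (c • u) = ‖c‖ ^ 2 * energy V u := by
  have h1 : gradSq (c • u) = ‖c‖ ^ 2 * gradSq u := by
    unfold gradSq
    rw [Finset.mul_sum]
    refine Finset.sum_congr rfl fun i _ => ?_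
    rw [← mul_pow, ← norm_smul]
    rfl
  have h2 : pot V (c • u) = ‖c‖ ^ 2 * pot V u := by
    unfold pot
    rw [← integral_const_mul]
    refine integral_congr_ae ?_
    filter_upwards [Lp.coeFn_smul c u.1.1] with x hx
    rw [Submodule.coe_smul, Prod.smul_fst, hx, Pi.smul_apply, norm_smul]
    ring
  rw [energy_eq, energy_eq, h1, h2]
  ring

theorem energy_zero (V : Space d → ℝ) : energy V 0 = 0 := by
  have := energy_smul V 0 0
  simpa using this

theorem level_le_of_hasNegSubspace {V : Space d → ℝ} {j : ℕ} {t : ℝ} (h : HasNegSubspace V j t) :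
    level V j ≤ ((-t : ℝ) : EReal) := by
  obtain ⟨E, hE, hneg⟩ := h
  refine (iInf₂_le E hE).trans (iSup_le fun u => iSup_le fun hu => iSup_le fun hn => ?_)
  have := hneg u hu
  rw [hn, one_pow, mul_one] at this
  exact EReal.coe_le_coe_iff.2 this

/-- The infimum over subspaces need not be attained, so only a strict inequality produces a
subspace; homogeneity then removes the normalization of u. -/
theorem hasNegSubspace_of_level_lt {V : Space d → ℝ} {j : ℕ} {t : ℝ}
    (h : level V j < ((-t : ℝ) : EReal)) : HasNegSubspace V j t := by
  simp only [level, iInf_lt_iff] at h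
  obtain ⟨E, hE, hlt⟩ := h
  refine ⟨E, hE, fun u hu => ?_⟩
  by_cases h0 : ‖u.1.1‖ = 0
  · rw [H1.eq_zero_of_norm_eq_zero h0, energy_zero]
    simp
  · have hpos : 0 < ‖u.1.1‖ := lt_of_le_of_ne (norm_nonneg _) (Ne.symm h0)
    set c : ℂ := ((‖u.1.1‖⁻¹ : ℝ) : ℂ) with hc
    have hcn : ‖c‖ = ‖u.1.1‖⁻¹ := by
      rw [hc, Complex.norm_real, Real.norm_of_nonneg (by positivity)]
    have h1 : ‖(c • u).1.1‖ = 1 := by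
      rw [Submodule.coe_smul, Prod.smul_fst, norm_smul, hcn, inv_mul_cancel₀ h0]
    have h2 : ((energy V (c • u) : ℝ) : EReal) < ((-t : ℝ) : EReal) :=
      lt_of_le_of_lt (le_iSup_of_le (c • u) (le_iSup_of_le (E.smul_mem c hu)
        (le_iSup (fun _ : ‖(c • u).1.1‖ = 1 => ((energy V (c • u) : ℝ) : EReal)) h1))) hlt
    have h3 := (EReal.coe_lt_coe_iff.1 h2).le
    rw [energy_smul, hcn, inv_pow, inv_mul_le_iff₀ (by positivity)] at h3
    linarith

theorem HasNegSubspace.mono_dim {V : Space d → ℝ} {j k : ℕ} {t : ℝ} (h : HasNegSubspace V j t)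
    (hk : k ≤ j) : HasNegSubspace V k t := by
  obtain ⟨E, hE, hneg⟩ := h
  obtain ⟨F, hFE, hF⟩ := exists_submodule_finrank_eq E (hk.trans_eq hE.symm)
  exact ⟨F, hF, fun u hu => hneg u (hFE hu)⟩

/-- If the energy of `V` splits into those of `A` and `W` under a partition of `H¹`, then negative
subspaces of `V` produce negative subspaces of `A` or of `W`. -/
theorem HasNegSubspace.split (hp : 1 < p) (hpd : d < 2 * p) {V A W : Space d → ℝ} (hA : IsPot p A)
    (hW : IsPot p W) (S T : H1 d →ₗ[ℂ] H1 d) {κ : ℝ}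
    (hE : ∀ u, energy A (S u) + energy W (T u) ≤ energy V u + κ * ‖u.1.1‖ ^ 2)
    (hN : ∀ u, ‖(S u).1.1‖ ^ 2 + ‖(T u).1.1‖ ^ 2 = ‖u.1.1‖ ^ 2) {a b : ℕ} {t t' : ℝ}
    (ht : t' + κ < t) (h : HasNegSubspace V (a + b + 1) t) :
    HasNegSubspace A (a + 1) t' ∨ HasNegSubspace W (b + 1) t' := by
  obtain ⟨E, hEr, hneg⟩ := h
  have key : ∀ (B : Space d → ℝ) (k : ℕ), (∃ F : Submodule ℂ (H1 d), Module.finrank ℂ F = k ∧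
      ∀ u ∈ F, u ≠ 0 → energy B u + t' * ‖u.1.1‖ ^ 2 < 0) → HasNegSubspace B k t' := by
    rintro B k ⟨F, hF, hFneg⟩
    refine ⟨F, hF, fun u hu => ?_⟩
    by_cases hu0 : u = 0
    · rw [hu0, energy_zero]
      simp
    · have := hFneg u hu hu0
      linarith
  -- The dimension count is applied to the energies shifted by t'‖u‖². On E the sum of the shifted
  -- forms is at most (t' + κ - t)‖u‖², which is negative for u ≠ 0.
  refine (exists_neg_of_split
    ((isHermQuad_energy hp hpd hA).add (isHermQuad_normSq.const_mul t'))
    ((isHermQuad_energy hp hpd hW).add (isHermQuad_normSq.const_mul t')) S T E hEr ?_).imp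
    (key A _) (key W _)
  intro u hu hu0
  have hne : ‖u.1.1‖ ≠ 0 := fun h0 => hu0 (H1.eq_zero_of_norm_eq_zero h0)
  have h3 := hneg u hu
  have h4 := hE u
  have h5 := hN u
  have h6 : 0 < ‖u.1.1‖ ^ 2 := by positivity
  have h7 : t' * ‖(S u).1.1‖ ^ 2 + t' * ‖(T u).1.1‖ ^ 2 = t' * ‖u.1.1‖ ^ 2 := by
    rw [← mul_add, h5]
  have h8 : (t' + κ) * ‖u.1.1‖ ^ 2 < t * ‖u.1.1‖ ^ 2 := mul_lt_mul_of_pos_right ht h6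
  rw [add_mul] at h8
  linarith

end

end LiebThirring

namespace LiebThirring

noncomputable section

variable {d : ℕ} {p : ℝ}

/-! ### The min-max levels are nonpositive -/

/-- The cutoff function of scale `R` centred at the origin, as an element of `H¹`. -/
def bumpH1 (d : ℕ) {R : ℝ} (hR : 0 < R) : H1 d :=
  testH1 (innerCut 0 R) (contDiff_innerCut 0 R) (hasCompactSupport_innerCut 0 hR)

theorem bumpH1_norm_sq_ge {R : ℝ} (hR : 0 < R) :
    R ^ d * (volume (Metric.closedBall (0 : Space d) 1)).toReal ≤ ‖(bumpH1 d hR).1.1‖ ^ 2 := by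
  rw [← ENNReal.ofReal_le_ofReal_iff (by positivity), ← lintegral_enorm_sq,
    ENNReal.ofReal_mul (by positivity), ENNReal.ofReal_toReal measure_closedBall_lt_top.ne]
  have hv := Measure.addHaar_closedBall' (volume : Measure (Space d)) 0 hR.le
  rw [finrank_euclideanSpace_fin] at hv
  rw [← hv, ← setLIntegral_one]
  refine le_trans ?_ (setLIntegral_le_lintegral (Metric.closedBall (0 : Space d) R) _)
  refine lintegral_mono_ae ?_
  filter_upwards [ae_restrict_of_ae (coeFn_testH1 (contDiff_innerCut (0 : Space d) R)
    (hasCompactSupport_innerCut 0 hR)), ae_restrict_mem Metric.isClosed_closedBall.measurableSet]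
    with x hx hxm
  have h1 : innerCut 0 R x = 1 := innerCut_eq_one hR (by simpa using hxm)
  rw [bumpH1, hx, h1]
  simp

theorem bumpH1_gradSq_le {R : ℝ} (hR : 0 < R) :
    gradSq (bumpH1 d hR) ≤
      d * ((cutConst d / R) ^ 2 * ((2 * R) ^ d *
        (volume (Metric.closedBall (0 : Space d) 1)).toReal)) := by
  have key : ∀ i, ‖(bumpH1 d hR).1.2 i‖ ^ 2 ≤ (cutConst d / R) ^ 2 * ((2 * R) ^ d *
        (volume (Metric.closedBall (0 : Space d) 1)).toReal) := by
    intro i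
    rw [← ENNReal.ofReal_le_ofReal_iff (by positivity), ← lintegral_enorm_sq,
      ENNReal.ofReal_mul (by positivity), ENNReal.ofReal_mul (by positivity),
      ENNReal.ofReal_toReal measure_closedBall_lt_top.ne]
    have hv := Measure.addHaar_closedBall' (volume : Measure (Space d)) 0
      (by positivity : 0 ≤ 2 * R)
    rw [finrank_euclideanSpace_fin] at hv
    rw [← hv, ← setLIntegral_const, ← lintegral_indicator Metric.isClosed_closedBall.measurableSet]
    refine lintegral_mono_ae ?_
    filter_upwards [coeFn_testH1_grad (contDiff_innerCut (0 : Space d) R)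
      (hasCompactSupport_innerCut 0 hR) i] with x hx
    rw [bumpH1, hx]
    by_cases hxm : x ∈ Metric.closedBall (0 : Space d) (2 * R)
    · rw [Set.indicator_of_mem hxm, ← ofReal_norm, ← ENNReal.ofReal_pow (norm_nonneg _)]
      refine ENNReal.ofReal_le_ofReal (pow_le_pow_left₀ (norm_nonneg _) ?_ 2)
      rw [Complex.norm_real, Real.norm_eq_abs]
      exact (abs_fderiv_single_le _ x i).trans (norm_fderiv_innerCut_le 0 hR x)
    · have hts : tsupport (innerCut (0 : Space d) R) ⊆ Metric.closedBall 0 (2 * R) := by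
        refine closure_minimal (fun y hy => ?_) Metric.isClosed_closedBall
        by_contra h
        refine hy (innerCut_eq_zero hR ?_)
        rw [mem_closedBall_iff_norm, not_le] at h
        exact h.le
      have h0 : fderiv ℝ (innerCut 0 R) x = 0 := by
        by_contra h
        exact hxm (hts (support_fderiv_subset ℝ h))
      rw [h0, Set.indicator_of_notMem hxm]
      simp
  calc gradSq (bumpH1 d hR) ≤ ∑ _i : Fin d, _ := Finset.sum_le_sum fun i _ => key i
    _ = _ := by rw [Finset.sum_const, Finset.card_univ, Fintype.card_fin, nsmul_eq_mul]

/-- Scaling: the kinetic energy of the bump is O(R^(d-2)) while its squared norm is at least a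
multiple of R^d, so the quotient is O(R^-2). -/
theorem exists_bumpH1_gradSq_le {ε : ℝ} (hε : 0 < ε) :
    ∃ (R : ℝ) (hR : 0 < R), 0 < ‖(bumpH1 d hR).1.1‖ ∧
      gradSq (bumpH1 d hR) ≤ ε * ‖(bumpH1 d hR).1.1‖ ^ 2 := by
  set v := (volume (Metric.closedBall (0 : Space d) 1)).toReal with hv
  have hv0 : 0 < v := ENNReal.toReal_pos (Metric.measure_closedBall_pos volume 0 one_pos).ne'
    measure_closedBall_lt_top.ne
  set C := (d : ℝ) * cutConst d ^ 2 * 2 ^ d with hC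
  have hC0 : 0 ≤ C := by positivity
  set R := √(C / ε) + 1 with hRd
  have hR : 0 < R := by positivity
  have hR2 : C ≤ ε * R ^ 2 := by
    have h1 : √(C / ε) ^ 2 = C / ε := Real.sq_sqrt (by positivity)
    have h2 : C / ε ≤ R ^ 2 := by
      rw [← h1, hRd]
      exact pow_le_pow_left₀ (Real.sqrt_nonneg _) (by linarith) 2
    rwa [div_le_iff₀' hε] at h2
  refine ⟨R, hR, ?_, ?_⟩
  · have h1 := bumpH1_norm_sq_ge (d := d) hR
    have h2 : 0 < ‖(bumpH1 d hR).1.1‖ ^ 2 := lt_of_lt_of_le (by positivity) h1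
    exact lt_of_le_of_ne (norm_nonneg _) fun h => by simp [← h] at h2
  · refine (bumpH1_gradSq_le hR).trans ?_
    refine le_trans ?_ (mul_le_mul_of_nonneg_left (bumpH1_norm_sq_ge hR) hε.le)
    have : (d : ℝ) * ((cutConst d / R) ^ 2 * ((2 * R) ^ d * v)) = C / R ^ 2 * (R ^ d * v) := by
      rw [hC, div_pow, mul_pow]; ring
    rw [this]
    have h3 : C / R ^ 2 ≤ ε := by rw [div_le_iff₀ (by positivity)]; exact hR2
    exact mul_le_mul_of_nonneg_right h3 (by positivity)

theorem norm_sum_sq_of_orthogonal {H ι : Type*} [NormedAddCommGroup H] [InnerProductSpace ℂ H]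
    [Fintype ι] (f : ι → H) (hf : ∀ i k, i ≠ k → inner ℂ (f i) (f k) = 0) (c : ι → ℂ) :
    ‖∑ i, c i • f i‖ ^ 2 = ∑ i, ‖c i‖ ^ 2 * ‖f i‖ ^ 2 := by
  classical
  have h1 : ∀ s : Finset ι, ‖∑ i ∈ s, c i • f i‖ ^ 2 = ∑ i ∈ s, ‖c i‖ ^ 2 * ‖f i‖ ^ 2 := by
    intro s
    induction s using Finset.induction_on with
    | empty => simp
    | insert i s hi ih =>
      rw [Finset.sum_insert hi, Finset.sum_insert hi, ← ih, sq, sq ‖∑ _ ∈ _, _‖,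
        norm_add_sq_eq_norm_sq_add_norm_sq_of_inner_eq_zero (𝕜 := ℂ), ← sq ‖c i • f i‖, norm_smul,
        mul_pow]
      rw [inner_smul_left, inner_sum]
      rw [Finset.sum_eq_zero, mul_zero]
      intro k hk
      rw [inner_smul_right, hf i k (fun h => hi (h ▸ hk)), mul_zero]
  exact h1 Finset.univ

theorem inner_shift_bump_eq_zero {R : ℝ} (hR : 0 < R) {a b : Space d} (hab : 4 * R < ‖a - b‖) :
    inner ℂ (shiftH1 a (bumpH1 d hR)).1.1 (shiftH1 b (bumpH1 d hR)).1.1 = 0 := by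
  have hval : ∀ a : Space d, (shiftH1 a (bumpH1 d hR)).1.1 =ᵐ[volume]
      fun x => (innerCut 0 R (x - a) : ℂ) := by
    intro a
    have h1 := coeFn_testH1 (contDiff_innerCut (0 : Space d) R) (hasCompactSupport_innerCut 0 hR)
    have h2 := (measurePreserving_sub_right volume a).quasiMeasurePreserving.ae h1
    filter_upwards [coeFn_shiftL2 a (bumpH1 d hR).1.1, h2] with x hx hx2
    exact hx.trans hx2
  rw [L2.inner_def]
  refine integral_eq_zero_of_ae ?_
  filter_upwards [hval a, hval b] with x hx hy
  rw [hx, hy]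
  by_cases h : 2 * R ≤ ‖x - a‖
  · rw [innerCut_eq_zero hR (c := 0) (by rwa [sub_zero])]
    simp
  · have h2 : 2 * R ≤ ‖x - b‖ := by
      have : ‖a - b‖ ≤ ‖x - b‖ + ‖x - a‖ := by
        have := norm_sub_le (x - b) (x - a)
        simpa using this
      push Not at h
      linarith
    rw [innerCut_eq_zero hR (c := 0) (x := x - b) (by rwa [sub_zero])]
    simp

/-- Translates of one wide bump with disjoint supports span a space of tiny kinetic energy, and the
potential only lowers the energy. -/
theorem hasNegSubspace_neg (hd : 1 ≤ d) {V : Space d → ℝ} (hV : 0 ≤ᵐ[volume] V) (j : ℕ) {ε : ℝ}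
    (hε : 0 < ε) : HasNegSubspace V j (-ε) := by
  -- The gradient of a combination is bounded by Cauchy–Schwarz, without using orthogonality of the
  -- gradients; the factor j lost there is paid for by ε/(j + 1).
  obtain ⟨R, hR, hpos, hgrad⟩ := exists_bumpH1_gradSq_le (d := d)
    (ε := ε / (j + 1)) (by positivity)
  set ψ := bumpH1 d hR with hψ
  set e : Space d := EuclideanSpace.single ⟨0, hd⟩ 1 with he
  have hen : ‖e‖ = 1 := by simp [he]
  -- The bumps live in balls of radius 2R, so spacing 5R > 4R separates them.
  set a : Fin j → Space d := fun i => (5 * R * (i : ℝ)) • e with ha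
  have hsep : ∀ i k, i ≠ k → 4 * R < ‖a i - a k‖ := by
    intro i k hik
    rw [ha, ← sub_smul, norm_smul, hen, mul_one, ← mul_sub, norm_mul,
      Real.norm_of_nonneg (by positivity)]
    have h1 : (1 : ℝ) ≤ ‖((i : ℕ) : ℝ) - ((k : ℕ) : ℝ)‖ := by
      have h2 : (1 : ℤ) ≤ |((i : ℕ) : ℤ) - ((k : ℕ) : ℤ)| :=
        Int.one_le_abs (sub_ne_zero.2 (by exact_mod_cast fun h => hik (Fin.ext h)))
      rw [Real.norm_eq_abs]
      exact_mod_cast h2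
    nlinarith
  set w : Fin j → H1 d := fun i => shiftH1 (a i) ψ with hw
  have horth : ∀ i k, i ≠ k → inner ℂ (w i).1.1 (w k).1.1 = 0 := fun i k hik =>
    inner_shift_bump_eq_zero hR (hsep i k hik)
  have hwn : ∀ i, ‖(w i).1.1‖ = ‖ψ.1.1‖ := fun i => norm_shiftH1 _ _
  let π : H1 d →ₗ[ℂ] L2 d := (LinearMap.fst ℂ _ _).comp (H1 d).subtype
  have hli : LinearIndependent ℂ w := by
    refine LinearIndependent.of_comp π (linearIndependent_of_ne_zero_of_inner_eq_zero ?_ ?_)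
    · intro i h0
      have : ‖(w i).1.1‖ = 0 := by rw [show (w i).1.1 = 0 from h0, norm_zero]
      rw [hwn] at this
      exact hpos.ne' this
    · exact fun i k hik => horth i k hik
  refine ⟨Submodule.span ℂ (Set.range w), by rw [finrank_span_eq_card hli, Fintype.card_fin], ?_⟩
  intro u hu
  obtain ⟨c, rfl⟩ := (Submodule.mem_span_range_iff_exists_fun ℂ).1 hu
  set u := ∑ i, c i • w i with hu
  have hu1 : u.1.1 = ∑ i, c i • (w i).1.1 := by
    change π u = ∑ i, c i • π (w i)
    rw [hu, map_sum]
    simp_rw [map_smul]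
  have hu2 : ∀ l, u.1.2 l = ∑ i, c i • (w i).1.2 l := by
    intro l
    let ρ : H1 d →ₗ[ℂ] L2 d := (LinearMap.proj l).comp ((LinearMap.snd ℂ _ _).comp (H1 d).subtype)
    change ρ u = ∑ i, c i • ρ (w i)
    rw [hu, map_sum]
    simp_rw [map_smul]
  have hnorm : ‖u.1.1‖ ^ 2 = (∑ i, ‖c i‖ ^ 2) * ‖ψ.1.1‖ ^ 2 := by
    rw [hu1, norm_sum_sq_of_orthogonal _ horth, Finset.sum_mul]
    simp_rw [hwn]
  have hgr : gradSq u ≤ j * ((∑ i, ‖c i‖ ^ 2) * gradSq ψ) := by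
    rw [gradSq, gradSq, Finset.mul_sum, Finset.mul_sum]
    refine Finset.sum_le_sum fun l _ => ?_
    have hgn : ∀ i, ‖(w i).1.2 l‖ = ‖ψ.1.2 l‖ := fun i => (shiftL2 (a i)).norm_map _
    rw [hu2]
    calc ‖∑ i, c i • (w i).1.2 l‖ ^ 2 ≤ (∑ i, ‖c i‖ * ‖ψ.1.2 l‖) ^ 2 := by
          refine pow_le_pow_left₀ (norm_nonneg _) ((norm_sum_le _ _).trans_eq ?_) 2
          simp_rw [norm_smul, hgn]
      _ ≤ (Finset.univ : Finset (Fin j)).card * ∑ i, (‖c i‖ * ‖ψ.1.2 l‖) ^ 2 :=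
          sq_sum_le_card_mul_sum_sq
      _ = _ := by
          rw [Finset.card_univ, Fintype.card_fin, Finset.sum_mul]
          simp_rw [mul_pow]
  rw [energy_eq]
  have h1 := pot_nonneg hV u
  have hc : 0 ≤ ∑ i, ‖c i‖ ^ 2 := Finset.sum_nonneg fun _ _ => by positivity
  have h2 : (j : ℝ) * ((∑ i, ‖c i‖ ^ 2) * gradSq ψ) ≤
      ε * ((∑ i, ‖c i‖ ^ 2) * ‖ψ.1.1‖ ^ 2) := by
    have h3 : (j : ℝ) * (ε / (j + 1)) ≤ ε := by
      rw [← mul_div_assoc, div_le_iff₀ (by positivity)]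
      nlinarith
    calc (j : ℝ) * ((∑ i, ‖c i‖ ^ 2) * gradSq ψ)
        ≤ (j : ℝ) * ((∑ i, ‖c i‖ ^ 2) * (ε / (j + 1) * ‖ψ.1.1‖ ^ 2)) := by gcongr
      _ = ((j : ℝ) * (ε / (j + 1))) * ((∑ i, ‖c i‖ ^ 2) * ‖ψ.1.1‖ ^ 2) := by ring
      _ ≤ _ := mul_le_mul_of_nonneg_right h3 (by positivity)
  rw [hnorm]
  linarith

theorem level_nonpos (hd : 1 ≤ d) {V : Space d → ℝ} (hV : 0 ≤ᵐ[volume] V) (j : ℕ) :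
    level V j ≤ 0 := by
  refine le_of_forall_gt_imp_ge_of_dense fun e he => ?_
  obtain ⟨r, hr0, hr⟩ := EReal.lt_iff_exists_real_btwn.1 he
  have h := level_le_of_hasNegSubspace (hasNegSubspace_neg hd hV j (EReal.coe_pos.1 hr0))
  rw [neg_neg] at h
  exact h.trans hr.le

theorem ofReal_le_abs_level {V : Space d → ℝ} {j : ℕ} {t : ℝ} (ht : 0 ≤ t)
    (h : HasNegSubspace V j t) : ENNReal.ofReal t ≤ (level V j).abs := by
  have h1 := level_le_of_hasNegSubspace h
  induction hl : level V j with
  | bot => simp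
  | top => rw [hl] at h1; exact absurd h1 (by simp)
  | coe r =>
    rw [hl] at h1
    have h2 : r ≤ -t := EReal.coe_le_coe_iff.1 h1
    rw [EReal.abs_def]
    exact ENNReal.ofReal_le_ofReal (by rw [abs_of_nonpos (by linarith)]; linarith)

/-- The absolute value forgets the sign of the level; `level_nonpos` restores it. With
`ofReal_le_abs_level`, this lets all later comparisons of levels run through negative subspaces. -/
theorem hasNegSubspace_of_lt_abs_level (hd : 1 ≤ d) {V : Space d → ℝ} (hV : 0 ≤ᵐ[volume] V)
    {j : ℕ} {t : ℝ} (h : ENNReal.ofReal t < (level V j).abs) :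
    HasNegSubspace V j t := by
  refine hasNegSubspace_of_level_lt ?_
  have h0 := level_nonpos hd hV j
  induction hl : level V j with
  | bot => exact EReal.bot_lt_coe _
  | top => rw [hl] at h0; exact absurd h0 (by simp)
  | coe r =>
    rw [hl] at h h0
    have h2 : r ≤ 0 := by exact_mod_cast h0
    rw [EReal.abs_def, abs_of_nonpos h2, ENNReal.ofReal_lt_ofReal_iff'] at h
    exact EReal.coe_lt_coe_iff.2 (by linarith [h.1])

end

end LiebThirring

namespace LiebThirring

noncomputable section

variable {d : ℕ} {p : ℝ}

/-! ### Localization of the energy -/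

theorem integrable_norm_sq (f : L2 d) : Integrable fun x => ‖f x‖ ^ 2 :=
  (memLp_two_iff_integrable_sq_norm (Lp.aestronglyMeasurable f)).1 (Lp.memLp f)

theorem pot_mulH1 (V : Space d → ℝ) {φ : Space d → ℝ} (h : IsMultiplier φ) (u : H1 d) :
    pot V (mulH1 φ h u) = ∫ x, V x * (φ x ^ 2 * ‖u.1.1 x‖ ^ 2) := by
  refine integral_congr_ae ?_
  filter_upwards [coeFn_mulH1 h u] with x hx
  rw [hx, norm_smul, mul_pow, Real.norm_eq_abs, sq_abs]

/-- The smooth cutoffs overlap, but each vanishes off its own set, where the potential may be cut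
sharply at no cost. -/
theorem energy_indicator_mulH1 (V : Space d → ℝ) {φ : Space d → ℝ} (h : IsMultiplier φ)
    {S : Set (Space d)} (hS : ∀ x, x ∉ S → φ x = 0) (u : H1 d) :
    energy (S.indicator V) (mulH1 φ h u) = energy V (mulH1 φ h u) := by
  rw [energy_eq, energy_eq, pot_mulH1, pot_mulH1]
  congr 1
  refine integral_congr_ae (ae_of_all _ fun x => ?_)
  by_cases hx : x ∈ S
  · simp [hx]
  · simp [hx, hS x hx]

theorem IsPot.indicator {V : Space d → ℝ} (hV : IsPot p V) {S : Set (Space d)}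
    (hS : MeasurableSet S) : IsPot p (S.indicator V) := by
  refine ⟨?_, hV.2.indicator hS⟩
  filter_upwards [hV.1] with x hx
  exact Set.indicator_apply_nonneg fun _ => hx

theorem normSq_cut (c : Space d) {R : ℝ} (hR : 0 < R) (u : H1 d) :
    ‖(mulH1 _ (isMultiplier_innerCut c hR) u).1.1‖ ^ 2 +
      ‖(mulH1 _ (isMultiplier_outerCut c hR) u).1.1‖ ^ 2 = ‖u.1.1‖ ^ 2 := by
  rw [← integral_norm_sq, ← integral_norm_sq, ← integral_norm_sq, ← integral_add
    (integrable_norm_sq _) (integrable_norm_sq _)]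
  refine integral_congr_ae ?_
  filter_upwards [coeFn_mulH1 (isMultiplier_innerCut c hR) u,
    coeFn_mulH1 (isMultiplier_outerCut c hR) u] with x hx hy
  rw [hx, hy, norm_smul, norm_smul, mul_pow, mul_pow, Real.norm_eq_abs, Real.norm_eq_abs, sq_abs,
    sq_abs, ← add_mul, innerCut_sq_add_outerCut_sq, one_mul]

/-- IMS localization: since the cutoffs satisfy ∇α = -βD and ∇β = αD, the cross terms cancel
pointwise (`hid`) and only |D|²|u|² remains, with |D| = O(1/R). -/
theorem gradSq_cut (c : Space d) {R : ℝ} (hR : 0 < R) (u : H1 d) :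
    gradSq (mulH1 _ (isMultiplier_innerCut c hR) u) +
      gradSq (mulH1 _ (isMultiplier_outerCut c hR) u) ≤
        gradSq u + d * (cutConst d / R) ^ 2 * ‖u.1.1‖ ^ 2 := by
  have key : ∀ i, ‖(mulH1 _ (isMultiplier_innerCut c hR) u).1.2 i‖ ^ 2 +
      ‖(mulH1 _ (isMultiplier_outerCut c hR) u).1.2 i‖ ^ 2 ≤
        ‖u.1.2 i‖ ^ 2 + (cutConst d / R) ^ 2 * ‖u.1.1‖ ^ 2 := by
    intro i
    rw [← integral_norm_sq, ← integral_norm_sq, ← integral_norm_sq, ← integral_norm_sq,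
      ← integral_add (integrable_norm_sq _) (integrable_norm_sq _), ← integral_const_mul,
      ← integral_add (integrable_norm_sq _) ((integrable_norm_sq _).const_mul _)]
    refine integral_mono_ae ((integrable_norm_sq _).add (integrable_norm_sq _))
      ((integrable_norm_sq _).add ((integrable_norm_sq _).const_mul _)) ?_
    filter_upwards [coeFn_mulH1_grad (isMultiplier_innerCut c hR) u i,
      coeFn_mulH1_grad (isMultiplier_outerCut c hR) u i] with x hx hy
    rw [hx, hy, fderiv_innerCut, fderiv_outerCut]
    set e : Space d := EuclideanSpace.single i 1
    set D := (Real.pi / 2) • (R⁻¹ • fderiv ℝ ramp (R⁻¹ • (x - c))) with hD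
    have hDle : (D e) ^ 2 ≤ (cutConst d / R) ^ 2 := by
      rw [← sq_abs]
      refine pow_le_pow_left₀ (abs_nonneg _) ?_ 2
      have h1 := D.le_opNorm e
      rw [show ‖e‖ = 1 by simp [e], mul_one] at h1
      exact h1.trans (norm_rampDeriv_le c hR x)
    have hcs := innerCut_sq_add_outerCut_sq c R x
    set α := innerCut c R x
    set β := outerCut c R x
    have hid : ‖α • u.1.2 i x + ((-β) • D) e • u.1.1 x‖ ^ 2 +
        ‖β • u.1.2 i x + (α • D) e • u.1.1 x‖ ^ 2 =
        (α ^ 2 + β ^ 2) * (‖u.1.2 i x‖ ^ 2 + (D e) ^ 2 * ‖u.1.1 x‖ ^ 2) := by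
      simp only [← Complex.normSq_eq_norm_sq, Complex.normSq_apply, smul_apply,
        Complex.add_re, Complex.add_im, Complex.real_smul, Complex.mul_re, Complex.mul_im,
        Complex.ofReal_re, Complex.ofReal_im, smul_eq_mul]
      ring
    rw [hid, hcs, one_mul]
    gcongr
  unfold gradSq
  rw [← Finset.sum_add_distrib]
  refine (Finset.sum_le_sum fun i _ => key i).trans_eq ?_
  rw [Finset.sum_add_distrib, Finset.sum_const, Finset.card_univ, Fintype.card_fin, nsmul_eq_mul,
    mul_assoc]

theorem energy_cut (hp : 1 < p) (hpd : d < 2 * p) {V : Space d → ℝ} (hV : IsPot p V)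
    (c : Space d) {R : ℝ} (hR : 0 < R) (u : H1 d) :
    energy ((Metric.closedBall c (2 * R)).indicator V)
        (mulH1 _ (isMultiplier_innerCut c hR) u) +
      energy ((Metric.closedBall c R)ᶜ.indicator V) (mulH1 _ (isMultiplier_outerCut c hR) u) ≤
        energy V u + d * (cutConst d / R) ^ 2 * ‖u.1.1‖ ^ 2 := by
  rw [energy_indicator_mulH1 V (isMultiplier_innerCut c hR), energy_indicator_mulH1 V
    (isMultiplier_outerCut c hR), energy_eq, energy_eq, energy_eq]
  · have h1 := gradSq_cut c hR u
    have h2 : pot V (mulH1 _ (isMultiplier_innerCut c hR) u) +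
        pot V (mulH1 _ (isMultiplier_outerCut c hR) u) = pot V u := by
      unfold pot
      rw [← integral_add (integrable_pot hp hpd hV.2 _) (integrable_pot hp hpd hV.2 _)]
      refine integral_congr_ae ?_
      filter_upwards [coeFn_mulH1 (isMultiplier_innerCut c hR) u,
        coeFn_mulH1 (isMultiplier_outerCut c hR) u] with x hx hy
      rw [hx, hy, norm_smul, norm_smul, mul_pow, mul_pow, Real.norm_eq_abs, Real.norm_eq_abs,
        sq_abs, sq_abs, ← mul_add, ← add_mul, innerCut_sq_add_outerCut_sq, one_mul]
    linarith
  · intro x hx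
    refine outerCut_eq_zero hR ?_
    simpa [dist_eq_norm] using hx
  · intro x hx
    refine innerCut_eq_zero hR ?_
    rw [mem_closedBall_iff_norm, not_le] at hx
    exact hx.le

/-- Negative subspaces are inherited by the part of the potential in a ball or by the exterior
part. -/
theorem HasNegSubspace.cut (hp : 1 < p) (hpd : d < 2 * p) {V : Space d → ℝ} (hV : IsPot p V)
    (c : Space d) {R : ℝ} (hR : 0 < R) {a b : ℕ} {t t' : ℝ}
    (ht : t' + d * (cutConst d / R) ^ 2 < t) (h : HasNegSubspace V (a + b + 1) t) :
    HasNegSubspace ((Metric.closedBall c (2 * R)).indicator V) (a + 1) t' ∨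
      HasNegSubspace ((Metric.closedBall c R)ᶜ.indicator V) (b + 1) t' :=
  h.split hp hpd (hV.indicator Metric.isClosed_closedBall.measurableSet)
    (hV.indicator Metric.isClosed_closedBall.measurableSet.compl) _ _
    (energy_cut hp hpd hV c hR) (normSq_cut c hR) ht

theorem HasNegSubspace.shift {V : Space d → ℝ} {j : ℕ} {t : ℝ} (h : HasNegSubspace V j t)
    (a : Space d) : HasNegSubspace (fun x => V (x + a)) j t := by
  obtain ⟨E, hE, hneg⟩ := h
  have hinj : Function.Injective (shiftH1 (-a) : H1 d →ₗ[ℂ] H1 d) := by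
    rw [← LinearMap.ker_eq_bot, LinearMap.ker_eq_bot']
    intro u hu
    refine H1.eq_zero_of_norm_eq_zero ?_
    rw [← norm_shiftH1 (-a), hu]
    simp
  refine ⟨E.map (shiftH1 (-a)), ?_, ?_⟩
  · rw [← hE]
    exact (LinearEquiv.finrank_eq (Submodule.equivMapOfInjective _ hinj E)).symm
  · rintro _ ⟨u, hu, rfl⟩
    rw [energy_shiftH1, norm_shiftH1]
    simp only [neg_add_cancel_right]
    exact hneg u hu

/-- Seen as a function of the centre c, the cutoff is a convolution kernel; this allows the
averaging over c below. -/
theorem innerCut_eq_sub (c x : Space d) (R : ℝ) : innerCut c R x = innerCut 0 R (c - x) := by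
  unfold innerCut ramp
  rw [sub_zero, norm_smul, norm_smul, norm_sub_rev]

/-- The form bound with ε = 1/2 lets half of the kinetic energy absorb the gradient part of the
potential energy. -/
theorem gradSq_le_of_energy_nonpos (hp : 1 < p) (hpd : d < 2 * p) {m : ℝ} (hm : 0 ≤ m) :
    ∃ C : ℝ, 0 ≤ C ∧ ∀ V : Space d → ℝ, AEStronglyMeasurable V volume →
      eLpNorm V (ENNReal.ofReal p) volume ≤ ENNReal.ofReal m → ∀ u : H1 d, energy V u ≤ 0 →
        gradSq u ≤ C * ‖u.1.1‖ ^ 2 := by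
  obtain ⟨C, hC, h⟩ := abs_pot_le (d := d) hp hpd hm (ε := 1 / 2) (by norm_num)
  refine ⟨2 * C, by positivity, fun V hV hVm u hu => ?_⟩
  have h1 := (le_abs_self _).trans (h V hV hVm u)
  rw [energy_eq] at hu
  linarith

end

end LiebThirring

namespace LiebThirring

noncomputable section

variable {d : ℕ} {p : ℝ}

/-! ### Negative energy is attained in a ball of controlled size -/

/-- Tonelli and translation invariance: averaging a localized density over all centres returns the
full integral times the mass of the kernel. -/
theorem lintegral_lintegral_sub_mul {k F : Space d → ℝ≥0∞} (hk : Measurable k)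
    (hF : AEMeasurable F volume) :
    ∫⁻ c, ∫⁻ x, k (c - x) * F x = (∫⁻ x, k x) * ∫⁻ x, F x := by
  rw [lintegral_lintegral_swap]
  · have h1 : ∀ x, ∫⁻ c, k (c - x) * F x = (∫⁻ y, k y) * F x := fun x => by
      rw [lintegral_mul_const (f := fun c => k (c - x)) _ (hk.comp (measurable_id.sub_const x)),
        lintegral_sub_right_eq_self (fun y => k y) x]
    simp_rw [h1]
    rw [lintegral_const_mul'' _ hF]
  · exact (hk.comp (measurable_fst.sub measurable_snd)).aemeasurable.mul
      (hF.comp_quasiMeasurePreserving Measure.quasiMeasurePreserving_snd)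

/-- The square of the derivative of the inner cutoff is dominated by this kernel. -/
def cutKernel (d : ℕ) (R : ℝ) : Space d → ℝ :=
  (Metric.closedBall 0 (2 * R)).indicator fun _ => (cutConst d / R) ^ 2

theorem fderiv_innerCut_sq_le (c : Space d) {R : ℝ} (hR : 0 < R) (x : Space d) (i : Fin d) :
    fderiv ℝ (innerCut c R) x (EuclideanSpace.single i 1) ^ 2 ≤ cutKernel d R (c - x) := by
  unfold cutKernel
  by_cases hx : c - x ∈ Metric.closedBall (0 : Space d) (2 * R)
  · rw [Set.indicator_of_mem hx, ← sq_abs]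
    exact pow_le_pow_left₀ (abs_nonneg _)
      ((abs_fderiv_single_le _ x i).trans (norm_fderiv_innerCut_le c hR x)) 2
  · rw [Set.indicator_of_notMem hx]
    have h0 : innerCut c R =ᶠ[𝓝 x] fun _ => 0 := by
      have ho : IsOpen {y : Space d | 2 * R < ‖y - c‖} :=
        isOpen_lt continuous_const (continuous_id.sub continuous_const).norm
      have hxm : x ∈ {y : Space d | 2 * R < ‖y - c‖} := by
        rw [mem_closedBall_zero_iff, not_le, norm_sub_rev] at hx
        exact hx
      filter_upwards [ho.mem_nhds hxm] with y hy
      exact innerCut_eq_zero hR (le_of_lt hy)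
    rw [h0.fderiv_eq]
    simp

/-- Product rule with weighted Young. Without the outer cutoff the cross term does not cancel, which
costs the factor 1 + δ on the gradient. -/
theorem lintegral_grad_innerCut_le (c : Space d) {R δ : ℝ} (hR : 0 < R) (hδ : 0 < δ) (u : H1 d)
    (i : Fin d) :
    ENNReal.ofReal (‖(mulH1 _ (isMultiplier_innerCut c hR) u).1.2 i‖ ^ 2) ≤
      ENNReal.ofReal (1 + δ) *
        (∫⁻ x, ENNReal.ofReal (innerCut 0 R (c - x) ^ 2) * ‖u.1.2 i x‖ₑ ^ 2) +
      ENNReal.ofReal (1 + 1 / δ) *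
        ∫⁻ x, ENNReal.ofReal (cutKernel d R (c - x)) * ‖u.1.1 x‖ₑ ^ 2 := by
  have hm1 : AEMeasurable (fun x => ENNReal.ofReal (innerCut 0 R (c - x) ^ 2) * ‖u.1.2 i x‖ₑ ^ 2)
      volume := by
    refine AEMeasurable.mul ?_ ((Lp.aestronglyMeasurable _).aemeasurable.enorm.pow_const 2)
    exact (((contDiff_innerCut 0 R).continuous.measurable.comp
      (measurable_const.sub measurable_id)).pow_const 2).ennreal_ofReal.aemeasurable
  have hm2 : AEMeasurable (fun x => ENNReal.ofReal (cutKernel d R (c - x)) * ‖u.1.1 x‖ₑ ^ 2)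
      volume := by
    refine AEMeasurable.mul ?_ ((Lp.aestronglyMeasurable _).aemeasurable.enorm.pow_const 2)
    exact ((measurable_const.indicator Metric.isClosed_closedBall.measurableSet).comp
      (measurable_const.sub measurable_id)).ennreal_ofReal.aemeasurable
  rw [← lintegral_enorm_sq, ← lintegral_const_mul'' _ hm1, ← lintegral_const_mul'' _ hm2,
    ← lintegral_add_left' (hm1.const_mul _)]
  refine lintegral_mono_ae ?_
  filter_upwards [coeFn_mulH1_grad (isMultiplier_innerCut c hR) u i] with x hx
  have hk0 : 0 ≤ cutKernel d R (c - x) := (sq_nonneg _).trans (fderiv_innerCut_sq_le c hR x i)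
  have he : ∀ z : ℂ, ‖z‖ₑ ^ 2 = ENNReal.ofReal (‖z‖ ^ 2) := fun z => by
    rw [ENNReal.ofReal_pow (norm_nonneg _), ofReal_norm]
  rw [hx, he, he, he, ← ENNReal.ofReal_mul (by positivity), ← ENNReal.ofReal_mul (by positivity),
    ← ENNReal.ofReal_mul hk0, ← ENNReal.ofReal_mul (by positivity),
    ← ENNReal.ofReal_add (by positivity) (by positivity)]
  refine ENNReal.ofReal_le_ofReal ?_
  have hf := fderiv_innerCut_sq_le c hR x i
  rw [innerCut_eq_sub c x R]
  set α := innerCut 0 R (c - x)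
  set β := fderiv ℝ (innerCut c R) x (EuclideanSpace.single i 1)
  set a := ‖u.1.2 i x‖
  set b := ‖u.1.1 x‖
  have h1 : ‖α • u.1.2 i x + β • u.1.1 x‖ ≤ |α| * a + |β| * b := by
    refine (norm_add_le _ _).trans_eq ?_
    rw [norm_smul, norm_smul, Real.norm_eq_abs, Real.norm_eq_abs]
  have h2 : (|α| * a + |β| * b) ^ 2 ≤ (1 + δ) * (|α| * a) ^ 2 + (1 + 1 / δ) * (|β| * b) ^ 2 := by
    have hid : (1 + δ) * (|α| * a) ^ 2 + (1 + 1 / δ) * (|β| * b) ^ 2 - (|α| * a + |β| * b) ^ 2 =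
        (δ * (|α| * a) - |β| * b) ^ 2 / δ := by
      field_simp
      ring
    have : 0 ≤ (δ * (|α| * a) - |β| * b) ^ 2 / δ := by positivity
    linarith
  refine (pow_le_pow_left₀ (norm_nonneg _) h1 2).trans (h2.trans ?_)
  rw [mul_pow, mul_pow, sq_abs, sq_abs]
  gcongr

theorem lintegral_innerCut_sq_ge {R : ℝ} (hR : 0 < R) :
    volume (Metric.closedBall (0 : Space d) R) ≤
      ∫⁻ x, ENNReal.ofReal (innerCut (0 : Space d) R x ^ 2) := by
  rw [← setLIntegral_one]
  refine le_trans ?_ (setLIntegral_le_lintegral (Metric.closedBall (0 : Space d) R) _)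
  refine setLIntegral_mono' Metric.isClosed_closedBall.measurableSet fun x hx => ?_
  rw [innerCut_eq_one hR (by simpa using hx)]
  simp

theorem lintegral_innerCut_sq_lt_top {R : ℝ} (hR : 0 < R) :
    ∫⁻ x, ENNReal.ofReal (innerCut (0 : Space d) R x ^ 2) < ⊤ := by
  have hc : Continuous fun x => innerCut (0 : Space d) R x ^ 2 :=
    (contDiff_innerCut (0 : Space d) R).continuous.pow 2
  have hs : HasCompactSupport fun x => innerCut (0 : Space d) R x ^ 2 :=
    (hasCompactSupport_innerCut (0 : Space d) hR).comp_left (g := fun t : ℝ => t ^ 2) (by simp)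
  exact (hc.integrable_of_hasCompactSupport hs).lintegral_lt_top

theorem lintegral_cutKernel_le {R : ℝ} (hR : 0 < R) :
    ∫⁻ x, ENNReal.ofReal (cutKernel d R x) ≤ ENNReal.ofReal (2 ^ d * (cutConst d / R) ^ 2) *
      volume (Metric.closedBall (0 : Space d) R) := by
  have h1 : ∀ x, ENNReal.ofReal (cutKernel d R x) =
      (Metric.closedBall (0 : Space d) (2 * R)).indicator
        (fun _ => ENNReal.ofReal ((cutConst d / R) ^ 2)) x := fun x => by
    unfold cutKernel
    by_cases hx : x ∈ Metric.closedBall (0 : Space d) (2 * R) <;> simp [Set.indicator, hx]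
  simp_rw [h1]
  rw [lintegral_indicator Metric.isClosed_closedBall.measurableSet, setLIntegral_const,
    Measure.addHaar_closedBall' _ _ (by positivity : 0 ≤ 2 * R),
    Measure.addHaar_closedBall' _ _ hR.le, finrank_euclideanSpace_fin, ← mul_assoc, ← mul_assoc,
    ← ENNReal.ofReal_mul (by positivity), ← ENNReal.ofReal_mul (by positivity), mul_pow]
  refine le_of_eq ?_
  congr 2
  ring

/-- If every centre failed, integrating the failing inequalities over c and dividing by H = ∫
`innerCut`² would bound ∫ V|u|² for the original u, against `hE` and `hlt`. The integral of
`cutKernel` is itself at most 2^d (`cutConst` d/R)² H, so H cancels. -/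
theorem energy_innerCut_lt (hp : 1 < p) (hpd : d < 2 * p) {V : Space d → ℝ} (hV : IsPot p V)
    {R δ t t' : ℝ} (hR : 0 < R) (hδ : 0 < δ) (ht' : 0 ≤ t') {u : H1 d}
    (hE : energy V u ≤ -t * ‖u.1.1‖ ^ 2)
    (hlt : δ * gradSq u + ((1 + 1 / δ) * (d * (2 ^ d * (cutConst d / R) ^ 2)) + t') * ‖u.1.1‖ ^ 2 <
      t * ‖u.1.1‖ ^ 2) :
    ∃ c : Space d, energy V (mulH1 _ (isMultiplier_innerCut c hR) u) <
      -t' * ‖(mulH1 _ (isMultiplier_innerCut c hR) u).1.1‖ ^ 2 := by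
  by_contra! hcon
  set h : Space d → ℝ≥0∞ := fun y => ENNReal.ofReal (innerCut 0 R y ^ 2) with hh
  set k : Space d → ℝ≥0∞ := fun y => ENNReal.ofReal (cutKernel d R y) with hk
  have hhm : Measurable h :=
    ((contDiff_innerCut 0 R).continuous.measurable.pow_const 2).ennreal_ofReal
  have hkm : Measurable k :=
    (measurable_const.indicator Metric.isClosed_closedBall.measurableSet).ennreal_ofReal
  set FV : Space d → ℝ≥0∞ := fun x => ENNReal.ofReal (V x * ‖u.1.1 x‖ ^ 2) with hFV
  have hFVm : AEMeasurable FV volume :=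
    (aestronglyMeasurable_pot hV.2.1 u).aemeasurable.ennreal_ofReal
  have hF2m : AEMeasurable (fun x => ‖u.1.1 x‖ₑ ^ 2) volume :=
    (Lp.aestronglyMeasurable _).aemeasurable.enorm.pow_const 2
  have hgm : ∀ i, AEMeasurable (fun x => ‖u.1.2 i x‖ₑ ^ 2) volume := fun i =>
    (Lp.aestronglyMeasurable _).aemeasurable.enorm.pow_const 2
  have hhc : ∀ c, Measurable fun x => h (c - x) := fun c =>
    hhm.comp (measurable_const.sub measurable_id)
  have hkc : ∀ c, Measurable fun x => k (c - x) := fun c =>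
    hkm.comp (measurable_const.sub measurable_id)
  have hpw : ∀ c, ∫⁻ x, h (c - x) * FV x ≤
      ∑ i, (ENNReal.ofReal (1 + δ) * (∫⁻ x, h (c - x) * ‖u.1.2 i x‖ₑ ^ 2) +
        ENNReal.ofReal (1 + 1 / δ) * ∫⁻ x, k (c - x) * ‖u.1.1 x‖ₑ ^ 2) +
      ENNReal.ofReal t' * ∫⁻ x, h (c - x) * ‖u.1.1 x‖ₑ ^ 2 := by
    intro c
    set w := mulH1 _ (isMultiplier_innerCut c hR) u with hw
    have h1 : pot V w ≤ ∑ i, ‖w.1.2 i‖ ^ 2 + t' * ‖w.1.1‖ ^ 2 := by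
      have := hcon c
      rw [energy_eq] at this
      have h2 : gradSq w = ∑ i, ‖w.1.2 i‖ ^ 2 := rfl
      linarith
    have h2 : ENNReal.ofReal (pot V w) = ∫⁻ x, h (c - x) * FV x := by
      rw [pot, ofReal_integral_eq_lintegral_ofReal (integrable_pot hp hpd hV.2 _)]
      · refine lintegral_congr_ae ?_
        filter_upwards [coeFn_mulH1 (isMultiplier_innerCut c hR) u] with x hx
        rw [hx, innerCut_eq_sub, norm_smul, mul_pow, Real.norm_eq_abs, sq_abs, hh, hFV]
        beta_reduce
        rw [← ENNReal.ofReal_mul (sq_nonneg _)]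
        congr 1
        ring
      · filter_upwards [hV.1] with x hx
        exact mul_nonneg hx (by positivity)
    have h3 : ENNReal.ofReal (‖w.1.1‖ ^ 2) = ∫⁻ x, h (c - x) * ‖u.1.1 x‖ₑ ^ 2 := by
      rw [← lintegral_enorm_sq]
      refine lintegral_congr_ae ?_
      filter_upwards [coeFn_mulH1 (isMultiplier_innerCut c hR) u] with x hx
      rw [hx, innerCut_eq_sub, enorm_smul, mul_pow, hh]
      beta_reduce
      congr 1
      rw [← sq_abs, ENNReal.ofReal_pow (abs_nonneg _), ← Real.norm_eq_abs, ofReal_norm]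
    rw [← h2, ← h3]
    refine (ENNReal.ofReal_le_ofReal h1).trans ?_
    rw [ENNReal.ofReal_add (Finset.sum_nonneg fun i _ => by positivity) (by positivity),
      ENNReal.ofReal_mul ht', ENNReal.ofReal_sum_of_nonneg fun i _ => by positivity]
    gcongr with i
    exact lintegral_grad_innerCut_le c hR hδ u i
  have hmk : ∀ {k' F : Space d → ℝ≥0∞}, Measurable k' → AEMeasurable F volume →
      AEMeasurable (fun c => ∫⁻ x, k' (c - x) * F x) volume := by
    intro k' F hk' hF
    have h1 : AEMeasurable (fun q : Space d × Space d => k' (q.1 - q.2) * F q.2)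
        (volume.prod volume) := (hk'.comp (measurable_fst.sub measurable_snd)).aemeasurable.mul
      (hF.comp_quasiMeasurePreserving Measure.quasiMeasurePreserving_snd)
    exact h1.lintegral_prod_right'
  have hsm : ∀ i, AEMeasurable (fun c => ENNReal.ofReal (1 + δ) *
      (∫⁻ x, h (c - x) * ‖u.1.2 i x‖ₑ ^ 2) +
        ENNReal.ofReal (1 + 1 / δ) * ∫⁻ x, k (c - x) * ‖u.1.1 x‖ₑ ^ 2) volume := fun i =>
    ((hmk hhm (hgm i)).const_mul _).add ((hmk hkm hF2m).const_mul _)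
  have hint := lintegral_mono (μ := volume) hpw
  rw [lintegral_lintegral_sub_mul hhm hFVm, lintegral_add_right' _
    ((hmk hhm hF2m).const_mul _), lintegral_finsetSum' _ (fun i _ => hsm i)] at hint
  simp_rw [lintegral_add_right' _ ((hmk hkm hF2m).const_mul _),
    lintegral_const_mul'' _ (hmk hkm hF2m), lintegral_const_mul'' _ (hmk hhm hF2m),
    lintegral_const_mul'' _ (hmk hhm (hgm _)), lintegral_lintegral_sub_mul hhm hF2m,
    lintegral_lintegral_sub_mul hkm hF2m, lintegral_lintegral_sub_mul hhm (hgm _),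
    lintegral_enorm_sq] at hint
  have hFVi : ∫⁻ x, FV x = ENNReal.ofReal (pot V u) := by
    rw [pot, ofReal_integral_eq_lintegral_ofReal (integrable_pot hp hpd hV.2 _)]
    filter_upwards [hV.1] with x hx
    exact mul_nonneg hx (by positivity)
  set H := ∫⁻ x, h x with hH
  have hHtop : H ≠ ⊤ := (lintegral_innerCut_sq_lt_top hR).ne
  have hH1 : volume (Metric.closedBall (0 : Space d) R) ≤ H := lintegral_innerCut_sq_ge hR
  have hH0 : H ≠ 0 := ((Metric.measure_closedBall_pos volume (0 : Space d) hR).trans_le hH1).ne'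
  have hK : ∫⁻ x, k x ≤ ENNReal.ofReal (2 ^ d * (cutConst d / R) ^ 2) * H :=
    (lintegral_cutKernel_le hR).trans (mul_le_mul_right hH1 _)
  have hfin : H * ENNReal.ofReal (pot V u) ≤ H * ENNReal.ofReal ((1 + δ) * gradSq u +
      ((1 + 1 / δ) * (d * (2 ^ d * (cutConst d / R) ^ 2)) + t') * ‖u.1.1‖ ^ 2) := by
    rw [hFVi] at hint
    refine hint.trans ?_
    have hsum : ENNReal.ofReal ((1 + δ) * gradSq u +
      ((1 + 1 / δ) * (d * (2 ^ d * (cutConst d / R) ^ 2)) + t') * ‖u.1.1‖ ^ 2) =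
        ∑ i, (ENNReal.ofReal (1 + δ) * ENNReal.ofReal (‖u.1.2 i‖ ^ 2) +
          ENNReal.ofReal (1 + 1 / δ) * (ENNReal.ofReal (2 ^ d * (cutConst d / R) ^ 2) *
            ENNReal.ofReal (‖u.1.1‖ ^ 2))) + ENNReal.ofReal t' * ENNReal.ofReal (‖u.1.1‖ ^ 2) := by
      have h2 : (1 + δ) * gradSq u +
          ((1 + 1 / δ) * (d * (2 ^ d * (cutConst d / R) ^ 2)) + t') * ‖u.1.1‖ ^ 2 =
          ∑ i, ((1 + δ) * ‖u.1.2 i‖ ^ 2 + (1 + 1 / δ) *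
            ((2 ^ d * (cutConst d / R) ^ 2) * ‖u.1.1‖ ^ 2)) + t' * ‖u.1.1‖ ^ 2 := by
        rw [Finset.sum_add_distrib, ← Finset.mul_sum, Finset.sum_const, Finset.card_univ,
          Fintype.card_fin, nsmul_eq_mul, gradSq]
        ring
      rw [h2, ENNReal.ofReal_add (Finset.sum_nonneg fun i _ => by positivity) (by positivity),
        ENNReal.ofReal_sum_of_nonneg fun i _ => by positivity, ENNReal.ofReal_mul ht']
      congr 1
      refine Finset.sum_congr rfl fun i _ => ?_
      rw [ENNReal.ofReal_add (by positivity) (by positivity), ENNReal.ofReal_mul (by positivity),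
        ENNReal.ofReal_mul (p := 1 + 1 / δ) (by positivity),
        ENNReal.ofReal_mul (p := 2 ^ d * (cutConst d / R) ^ 2) (by positivity)]
    rw [hsum, mul_add, Finset.mul_sum]
    refine add_le_add (Finset.sum_le_sum fun i _ => ?_) (le_of_eq (by ring))
    rw [mul_add]
    refine add_le_add (le_of_eq (by ring)) ?_
    calc _ ≤ ENNReal.ofReal (1 + 1 / δ) * ((ENNReal.ofReal (2 ^ d * (cutConst d / R) ^ 2) * H) *
            ENNReal.ofReal (‖u.1.1‖ ^ 2)) := by gcongr
      _ = _ := by ring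
  rw [ENNReal.mul_le_mul_iff_right hH0 hHtop, ENNReal.ofReal_le_ofReal_iff] at hfin
  · rw [energy_eq] at hE
    linarith
  · have := gradSq_nonneg u
    positivity

/-- A potential with a negative energy level has one already in a ball of controlled radius. -/
theorem exists_localized (hp : 1 < p) (hpd : d < 2 * p) {m t : ℝ} (hm : 0 ≤ m) (ht : 0 < t) :
    ∃ R : ℝ, 0 < R ∧ ∀ V : Space d → ℝ, IsPot p V →
      eLpNorm V (ENNReal.ofReal p) volume ≤ ENNReal.ofReal m → HasNegSubspace V 1 t →
        ∃ c : Space d, HasNegSubspace ((Metric.closedBall c (2 * R)).indicator V) 1 (t / 2) := by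
  obtain ⟨C, hC, hgrad⟩ := gradSq_le_of_energy_nonpos (d := d) hp hpd hm
  -- δ and R make the gradient loss and the localization loss at most t/8 each; together with the
  -- target t/2 they stay below t.
  set δ := t / (8 * (C + 1)) with hδd
  have hδ : 0 < δ := by positivity
  set A := (1 + 1 / δ) * (d * (2 ^ d * cutConst d ^ 2)) with hA
  have hA0 : 0 ≤ A := by positivity
  set R := √(8 * A / t) + 1 with hRd
  have hR : 0 < R := by positivity
  refine ⟨R, hR, fun V hV hVm hneg => ?_⟩
  obtain ⟨E, hE1, hE⟩ := hneg
  have hne : E ≠ ⊥ := by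
    rintro rfl
    simp at hE1
  obtain ⟨u, huE, hu0⟩ := Submodule.exists_mem_ne_zero_of_ne_bot hne
  have hn : 0 < ‖u.1.1‖ ^ 2 := by
    have : ‖u.1.1‖ ≠ 0 := fun h0 => hu0 (H1.eq_zero_of_norm_eq_zero h0)
    positivity
  have hEu := hE u huE
  have hg := hgrad V hV.2.1 hVm u (by nlinarith)
  have h1 : δ * gradSq u ≤ t / 8 * ‖u.1.1‖ ^ 2 := by
    have h2 : δ * C ≤ t / 8 := by
      rw [hδd, div_mul_eq_mul_div, div_le_div_iff₀ (by positivity) (by norm_num)]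
      nlinarith
    calc δ * gradSq u ≤ δ * (C * ‖u.1.1‖ ^ 2) := by gcongr
      _ = δ * C * ‖u.1.1‖ ^ 2 := by ring
      _ ≤ _ := by gcongr
  have h3 : (1 + 1 / δ) * (d * (2 ^ d * (cutConst d / R) ^ 2)) ≤ t / 8 := by
    have h4 : (1 + 1 / δ) * (d * (2 ^ d * (cutConst d / R) ^ 2)) = A / R ^ 2 := by
      rw [hA, div_pow]
      ring
    rw [h4, div_le_iff₀ (by positivity)]
    have h5 : 8 * A / t ≤ R ^ 2 := by
      have h6 : √(8 * A / t) ^ 2 = 8 * A / t := Real.sq_sqrt (by positivity)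
      have h7 := Real.sqrt_nonneg (8 * A / t)
      rw [hRd]
      nlinarith
    rw [div_le_iff₀ ht] at h5
    linarith
  obtain ⟨c, hc⟩ := energy_innerCut_lt hp hpd hV hR hδ (by positivity : 0 ≤ t / 2) hEu (by
    have : ((1 + 1 / δ) * (d * (2 ^ d * (cutConst d / R) ^ 2)) + t / 2) * ‖u.1.1‖ ^ 2 ≤
      (t / 8 + t / 2) * ‖u.1.1‖ ^ 2 := by gcongr
    nlinarith)
  set w := mulH1 _ (isMultiplier_innerCut c hR) u with hw
  have hcw : energy ((Metric.closedBall c (2 * R)).indicator V) w < -(t / 2) * ‖w.1.1‖ ^ 2 := by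
    rw [hw, energy_indicator_mulH1]
    · exact hc
    · intro x hx
      refine innerCut_eq_zero hR ?_
      rw [mem_closedBall_iff_norm, not_le] at hx
      exact hx.le
  have hw0 : w ≠ 0 := by
    intro h0
    rw [h0, energy_zero] at hcw
    simp at hcw
  refine ⟨c, ℂ ∙ w, finrank_span_singleton hw0, fun v hv => ?_⟩
  obtain ⟨z, rfl⟩ := Submodule.mem_span_singleton.1 hv
  rw [energy_smul, Submodule.coe_smul, Prod.smul_fst, norm_smul, mul_pow, mul_left_comm]
  exact mul_le_mul_of_nonneg_left hcw.le (by positivity)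

end

end LiebThirring

namespace LiebThirring

noncomputable section

variable {d : ℕ} {p : ℝ}

/-! ### Weak convergence of potentials -/

/-- Banach–Alaoglu for countably many bounded sequences at once: the product of the metrizable
compact dual balls is sequentially compact, which replaces a diagonal argument. -/
theorem exists_subseq_weak {H : Type*} [NormedAddCommGroup H] [InnerProductSpace ℝ H]
    [CompleteSpace H] [TopologicalSpace.SeparableSpace H] (T : ℕ → ℕ → H)
    (hT : ∀ M, ∃ r : ℝ, ∀ n, ‖T M n‖ ≤ r) :
    ∃ φ : ℕ → ℕ, StrictMono φ ∧ ∃ v : ℕ → H, ∀ M g,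
      Tendsto (fun n => inner ℝ (T M (φ n)) g) atTop (𝓝 (inner ℝ (v M) g)) := by
  choose r hr using hT
  let K : ℕ → Set (WeakDual ℝ H) := fun M =>
    WeakDual.toStrongDual ⁻¹' Metric.closedBall (0 : StrongDual ℝ H) (r M)
  have hK : ∀ M, IsCompact (K M) := fun M => WeakDual.isCompact_closedBall 0 (r M)
  have : ∀ M, CompactSpace (K M) := fun M => isCompact_iff_compactSpace.1 (hK M)
  have : ∀ M, TopologicalSpace.MetrizableSpace (K M) := fun M =>
    WeakDual.metrizable_of_isCompact ℝ H (K M) (hK M)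
  let x : ℕ → ∀ M, K M := fun n M =>
    ⟨StrongDual.toWeakDual (InnerProductSpace.toDual ℝ H (T M n)), by
      simpa [K] using hr M n⟩
  obtain ⟨a, φ, hφ, ha⟩ := CompactSpace.tendsto_subseq x
  refine ⟨φ, hφ, fun M => (InnerProductSpace.toDual ℝ H).symm (WeakDual.toStrongDual (a M).1),
    fun M g => ?_⟩
  have h1 : Tendsto (fun n => (x (φ n) M).1) atTop (𝓝 (a M).1) :=
    (continuous_subtype_val.tendsto _).comp (tendsto_pi_nhds.1 ha M)
  have h2 := (WeakDual.eval_continuous g).tendsto (a M).1 |>.comp h1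
  rw [InnerProductSpace.toDual_symm_apply]
  exact h2

theorem tendsto_of_uniform_approx {a : ℕ → ℝ} {b : ℕ → ℕ → ℝ} {e c : ℕ → ℝ} {l : ℝ}
    (hb : ∀ M, Tendsto (b M) atTop (𝓝 (c M))) (hc : Tendsto c atTop (𝓝 l))
    (he : Tendsto e atTop (𝓝 0)) (h : ∀ᶠ M in atTop, ∀ n, |a n - b M n| ≤ e M) :
    Tendsto a atTop (𝓝 l) := by
  rw [Metric.tendsto_atTop']
  intro ε hε
  have h1 := (Metric.tendsto_nhds.1 hc (ε / 3) (by positivity))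
  have h2 := (Metric.tendsto_nhds.1 he (ε / 3) (by positivity))
  obtain ⟨M, hM1, hM2, hM3⟩ := (h1.and (h2.and h)).exists
  obtain ⟨n₀, hn⟩ := Metric.tendsto_atTop.1 (hb M) (ε / 3) (by positivity)
  refine ⟨n₀, fun n hn' => ?_⟩
  have h4 := hn n hn'.le
  have h5 := hM3 n
  rw [Real.dist_eq] at *
  have h6 : a n - l = (a n - b M n) + (b M n - c M) + (c M - l) := by ring
  rw [sub_zero] at hM2
  have h7 := le_abs_self (e M)
  rw [h6]
  refine (abs_add_three _ _ _).trans_lt ?_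
  linarith

/-- `∫ V_+^p`. -/
def powInt (p : ℝ) (V : Space d → ℝ) : ℝ≥0∞ := ∫⁻ x, ENNReal.ofReal (V x) ^ p

/-- Convergence tested against bounded functions of bounded support. -/
def WeakTo (U : ℕ → Space d → ℝ) (W : Space d → ℝ) : Prop :=
  ∀ g : Space d → ℝ, AEStronglyMeasurable g volume → (∃ B, ∀ x, |g x| ≤ B) →
    (∃ r, ∀ x, x ∉ Metric.closedBall (0 : Space d) r → g x = 0) →
      Tendsto (fun n => ∫ x, U n x * g x) atTop (𝓝 (∫ x, W x * g x))

/-- Truncation of a function in size and support. -/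
def trunc (k : ℕ) (V : Space d → ℝ) : Space d → ℝ :=
  (Metric.closedBall 0 (k : ℝ)).indicator fun x => max (min (V x) k) 0

theorem trunc_nonneg (k : ℕ) (V : Space d → ℝ) (x : Space d) : 0 ≤ trunc k V x :=
  Set.indicator_apply_nonneg fun _ => le_max_right _ _

theorem trunc_le (k : ℕ) (V : Space d → ℝ) (x : Space d) : trunc k V x ≤ k := by
  unfold trunc
  refine Set.indicator_apply_le' (fun _ => ?_) fun _ => k.cast_nonneg
  exact max_le (min_le_right _ _) k.cast_nonneg

theorem trunc_le_self (k : ℕ) {V : Space d → ℝ} {x : Space d} (h : 0 ≤ V x) : trunc k V x ≤ V x := by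
  unfold trunc
  refine Set.indicator_apply_le' (fun _ => ?_) fun _ => h
  exact max_le (min_le_left _ _) h

theorem trunc_mono (V : Space d → ℝ) (x : Space d) : Monotone fun k => trunc k V x := by
  intro j k hjk
  have hjk' : (j : ℝ) ≤ k := by exact_mod_cast hjk
  change trunc j V x ≤ trunc k V x
  by_cases hx : x ∈ Metric.closedBall (0 : Space d) j
  · rw [trunc, trunc, Set.indicator_of_mem hx,
      Set.indicator_of_mem (Metric.closedBall_subset_closedBall hjk' hx)]
    exact max_le_max (min_le_min le_rfl hjk') le_rfl
  · rw [trunc, Set.indicator_of_notMem hx]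
    exact trunc_nonneg k V x

theorem trunc_eq_zero (k : ℕ) (V : Space d → ℝ) {x : Space d}
    (hx : x ∉ Metric.closedBall (0 : Space d) k) : trunc k V x = 0 :=
  Set.indicator_of_notMem hx _

theorem tendsto_trunc {V : Space d → ℝ} {x : Space d} (h : 0 ≤ V x) :
    Tendsto (fun k => trunc k V x) atTop (𝓝 (V x)) := by
  refine tendsto_const_nhds.congr' ?_
  filter_upwards [eventually_ge_atTop ⌈‖x‖⌉₊, eventually_ge_atTop ⌈V x⌉₊] with k h1 h2
  have h1' : ‖x‖ ≤ k := Nat.ceil_le.1 h1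
  rw [trunc, Set.indicator_of_mem (by simpa using h1'), min_eq_left (Nat.ceil_le.1 h2),
    max_eq_left h]

theorem aestronglyMeasurable_trunc (k : ℕ) {V : Space d → ℝ} (hV : AEStronglyMeasurable V volume) :
    AEStronglyMeasurable (trunc k V) volume :=
  ((hV.inf aestronglyMeasurable_const).sup aestronglyMeasurable_const).indicator
    Metric.isClosed_closedBall.measurableSet

theorem integrable_of_bounded_support {g : Space d → ℝ} (hg : AEStronglyMeasurable g volume)
    {B r : ℝ} (hB : ∀ x, |g x| ≤ B) (hr : ∀ x, x ∉ Metric.closedBall (0 : Space d) r → g x = 0) :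
    Integrable g := by
  have h1 : (Metric.closedBall (0 : Space d) r).indicator g = g := by
    ext x
    by_cases hx : x ∈ Metric.closedBall (0 : Space d) r
    · simp [hx]
    · simp [hx, hr x hx]
  rw [← h1, integrable_indicator_iff Metric.isClosed_closedBall.measurableSet]
  exact Measure.integrableOn_of_bounded measure_closedBall_lt_top.ne hg
    (M := B) (ae_of_all _ hB)

theorem integrable_mul_of_bounded_support {f g : Space d → ℝ} (hf : LocallyIntegrable f)
    (hg : AEStronglyMeasurable g volume)
    {B r : ℝ} (hB : ∀ x, |g x| ≤ B) (hr : ∀ x, x ∉ Metric.closedBall (0 : Space d) r → g x = 0) :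
    Integrable fun x => f x * g x := by
  have h1 : (Metric.closedBall (0 : Space d) r).indicator (fun x => f x * g x) =
      fun x => f x * g x := by
    ext x
    by_cases hx : x ∈ Metric.closedBall (0 : Space d) r
    · simp [hx]
    · simp [hx, hr x hx]
  rw [← h1, integrable_indicator_iff Metric.isClosed_closedBall.measurableSet]
  exact (hf.integrableOn_isCompact (isCompact_closedBall 0 r)).mul_bdd hg.restrict (ae_of_all _ hB)

theorem rpow_mul_of_conj (hp : 1 < p) {a : ℝ} (ha : 0 ≤ a) : a * a ^ (p - 1) = a ^ p := by
  rcases ha.eq_or_lt with rfl | h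
  · rw [zero_mul, Real.zero_rpow (by linarith)]
  · nth_rewrite 1 [← Real.rpow_one a]
    rw [← Real.rpow_add h]
    congr 1
    ring

theorem powInt_eq_ofReal_integral {V : Space d → ℝ} (hV : 0 ≤ᵐ[volume] V) (hp : 0 ≤ p)
    (hi : Integrable fun x => V x ^ p) : powInt p V = ENNReal.ofReal (∫ x, V x ^ p) := by
  rw [ofReal_integral_eq_lintegral_ofReal hi]
  · refine lintegral_congr_ae ?_
    filter_upwards [hV] with x hx
    rw [ENNReal.ofReal_rpow_of_nonneg hx hp]
  · filter_upwards [hV] with x hx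
    exact Real.rpow_nonneg hx p

theorem integrable_rpow_of_powInt_lt_top {V : Space d → ℝ} (hV : 0 ≤ᵐ[volume] V)
    (hm : AEStronglyMeasurable V volume) (hp : 0 ≤ p) (h : powInt p V < ⊤) :
    Integrable fun x => V x ^ p := by
  refine ⟨(hm.aemeasurable.pow_const p).aestronglyMeasurable, ?_⟩
  rw [hasFiniteIntegral_iff_ofReal]
  · refine lt_of_eq_of_lt ?_ h
    refine lintegral_congr_ae ?_
    filter_upwards [hV] with x hx
    rw [ENNReal.ofReal_rpow_of_nonneg hx hp]
  · filter_upwards [hV] with x hx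
    exact Real.rpow_nonneg hx p

theorem tendsto_powInt_trunc (hp : 0 ≤ p) {W : Space d → ℝ} (hW : 0 ≤ᵐ[volume] W)
    (hm : AEStronglyMeasurable W volume) :
    Tendsto (fun k => powInt p (trunc k W)) atTop (𝓝 (powInt p W)) := by
  refine lintegral_tendsto_of_tendsto_of_monotone
    (fun k => (aestronglyMeasurable_trunc k hm).aemeasurable.ennreal_ofReal.pow_const p)
    (ae_of_all _ fun x j k hjk => ?_) ?_
  · exact ENNReal.rpow_le_rpow (ENNReal.ofReal_le_ofReal (trunc_mono W x hjk)) hp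
  · filter_upwards [hW] with x hx
    exact (ENNReal.continuous_rpow_const.tendsto _).comp
      ((ENNReal.continuous_ofReal.tendsto _).comp (tendsto_trunc hx))

/-- The powers of truncations are admissible test functions. -/
theorem trunc_rpow_test (hp : 1 < p) (k : ℕ) {W : Space d → ℝ}
    (hm : AEStronglyMeasurable W volume) :
    AEStronglyMeasurable (fun x => trunc k W x ^ (p - 1)) volume ∧
      (∀ x, |trunc k W x ^ (p - 1)| ≤ (k : ℝ) ^ (p - 1)) ∧
      ∀ x, x ∉ Metric.closedBall (0 : Space d) k → trunc k W x ^ (p - 1) = 0 := by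
  refine ⟨((aestronglyMeasurable_trunc k hm).aemeasurable.pow_const _).aestronglyMeasurable,
    fun x => ?_, fun x hx => ?_⟩
  · rw [abs_of_nonneg (Real.rpow_nonneg (trunc_nonneg k W x) _)]
    exact Real.rpow_le_rpow (trunc_nonneg k W x) (trunc_le k W x) (by linarith)
  · rw [trunc_eq_zero k W hx, Real.zero_rpow (by linarith)]

theorem integrable_trunc_rpow (hp : 0 < p) (k : ℕ) {W : Space d → ℝ}
    (hm : AEStronglyMeasurable W volume) : Integrable fun x => trunc k W x ^ p := by
  refine integrable_of_bounded_support
    ((aestronglyMeasurable_trunc k hm).aemeasurable.pow_const _).aestronglyMeasurable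
    (B := (k : ℝ) ^ p) (r := k) (fun x => ?_) fun x hx => ?_
  · rw [abs_of_nonneg (Real.rpow_nonneg (trunc_nonneg k W x) _)]
    exact Real.rpow_le_rpow (trunc_nonneg k W x) (trunc_le k W x) hp.le
  · rw [trunc_eq_zero k W hx, Real.zero_rpow hp.ne']

/-- Test against the power p - 1 of a truncation of W. With I the p-integral of the truncation,
Young gives I ≤ A/p + (1 - 1/p) I, and I is finite, so I ≤ A; then remove the truncation by monotone
convergence. -/
theorem WeakTo.powInt_le (hp : 1 < p) {U : ℕ → Space d → ℝ} {W : Space d → ℝ}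
    (hU0 : ∀ n, 0 ≤ᵐ[volume] U n) (hUl : ∀ n, LocallyIntegrable (U n)) (hW0 : 0 ≤ᵐ[volume] W)
    (hWl : LocallyIntegrable W) (h : WeakTo U W) {A : ℝ} (hA : 0 ≤ A)
    (hUA : ∃ᶠ n in atTop, powInt p (U n) ≤ ENNReal.ofReal A) : powInt p W ≤ ENNReal.ofReal A := by
  have hWm := hWl.aestronglyMeasurable
  refine le_of_tendsto (tendsto_powInt_trunc (by linarith) hW0 hWm) (Eventually.of_forall fun k => ?_)
  obtain ⟨hg1, hg2, hg3⟩ := trunc_rpow_test hp k hWm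
  have hti := integrable_trunc_rpow (by linarith : 0 < p) k hWm
  set I := ∫ x, trunc k W x ^ p with hI
  have h1 : I ≤ ∫ x, W x * trunc k W x ^ (p - 1) := by
    refine integral_mono_ae hti (integrable_mul_of_bounded_support hWl hg1 hg2 hg3) ?_
    filter_upwards [hW0] with x hx
    rw [← rpow_mul_of_conj hp (trunc_nonneg k W x)]
    exact mul_le_mul_of_nonneg_right (trunc_le_self k hx) (Real.rpow_nonneg (trunc_nonneg k W x) _)
  have hlim := h _ hg1 ⟨_, hg2⟩ ⟨_, hg3⟩
  have hpq : p.HolderConjugate (p / (p - 1)) := Real.HolderConjugate.conjExponent hp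
  have hp1 : 0 < p - 1 := by linarith
  have h2 : ∫ x, W x * trunc k W x ^ (p - 1) ≤ A / p + I / (p / (p - 1)) := by
    refine le_of_tendsto_of_frequently hlim (hUA.mono fun n hn => ?_)
    have hin := integrable_rpow_of_powInt_lt_top (hU0 n) (hUl n).aestronglyMeasurable
      (by linarith : 0 ≤ p) (hn.trans_lt ENNReal.ofReal_lt_top)
    have h3 : ∫ x, U n x ^ p ≤ A := by
      rw [powInt_eq_ofReal_integral (hU0 n) (by linarith) hin, ENNReal.ofReal_le_ofReal_iff hA] at hn
      exact hn
    calc ∫ x, U n x * trunc k W x ^ (p - 1)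
        ≤ ∫ x, (U n x ^ p / p + trunc k W x ^ p / (p / (p - 1))) := by
          refine integral_mono_ae (integrable_mul_of_bounded_support (hUl n) hg1 hg2 hg3)
            ((hin.div_const _).add (hti.div_const _)) ?_
          filter_upwards [hU0 n] with x hx
          refine (Real.young_inequality_of_nonneg hx (Real.rpow_nonneg (trunc_nonneg k W x) _)
            hpq).trans_eq ?_
          rw [← Real.rpow_mul (trunc_nonneg k W x), mul_div_cancel₀ _ hp1.ne']
      _ = (∫ x, U n x ^ p) / p + I / (p / (p - 1)) := by
          rw [integral_add (hin.div_const _) (hti.div_const _), integral_div, integral_div]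
      _ ≤ _ := by gcongr
  have h4 : I ≤ A := by
    have h5 := h1.trans h2
    have h6 : I / (p / (p - 1)) = I - I / p := by field_simp
    rw [h6] at h5
    have h7 : I / p ≤ A / p := by linarith
    exact (div_le_div_iff_of_pos_right (by linarith)).1 h7
  rw [powInt_eq_ofReal_integral (ae_of_all _ (trunc_nonneg k W)) (by linarith) hti]
  exact ENNReal.ofReal_le_ofReal h4

end

end LiebThirring

namespace LiebThirring

noncomputable section

variable {d : ℕ} {p : ℝ}

/-! ### Weak sequential compactness of bounded sets of potentials -/

theorem eLpNorm_rpow_eq_powInt (hp : 0 < p) {V : Space d → ℝ} (hV : 0 ≤ᵐ[volume] V) :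
    eLpNorm V (ENNReal.ofReal p) volume ^ p = powInt p V := by
  rw [eLpNorm_ofReal_eq V hp, ← ENNReal.rpow_mul, one_div, inv_mul_cancel₀ hp.ne',
    ENNReal.rpow_one]
  refine lintegral_congr_ae ?_
  filter_upwards [hV] with x hx
  rw [Real.enorm_of_nonneg hx]

theorem isPot_of_powInt_lt_top (hp : 0 < p) {V : Space d → ℝ} (hV : 0 ≤ᵐ[volume] V)
    (hm : AEStronglyMeasurable V volume) (h : powInt p V < ⊤) : IsPot p V := by
  refine ⟨hV, hm, ?_⟩
  rw [← eLpNorm_rpow_eq_powInt hp hV] at h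
  exact (ENNReal.rpow_lt_top_iff_of_pos hp).1 h

theorem IsPot.powInt_lt_top (hp : 0 < p) {V : Space d → ℝ} (hV : IsPot p V) : powInt p V < ⊤ := by
  rw [← eLpNorm_rpow_eq_powInt hp hV.1]
  exact ENNReal.rpow_lt_top_of_nonneg hp.le hV.2.2.ne

theorem IsPot.locallyIntegrable (hp : 1 ≤ p) {V : Space d → ℝ} (hV : IsPot p V) :
    LocallyIntegrable V :=
  hV.2.locallyIntegrable (ENNReal.one_le_ofReal.2 hp)

theorem memLp_trunc (k : ℕ) {V : Space d → ℝ} (hV : AEStronglyMeasurable V volume) :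
    MemLp (trunc k V) 2 volume := by
  have hm := aestronglyMeasurable_trunc k hV
  rw [memLp_two_iff_integrable_sq hm]
  refine integrable_of_bounded_support (hm.pow 2) (B := (k : ℝ) ^ 2) (r := k) (fun x => ?_)
    fun x hx => ?_
  · rw [abs_of_nonneg (sq_nonneg _)]
    exact pow_le_pow_left₀ (trunc_nonneg k V x) (trunc_le k V x) 2
  · rw [trunc_eq_zero k V hx]
    norm_num

theorem norm_trunc_toLp_le (k : ℕ) : ∃ r : ℝ, ∀ V : Space d → ℝ,
    ∀ hV : AEStronglyMeasurable V volume, ‖(memLp_trunc k hV).toLp (trunc k V)‖ ≤ r := by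
  refine ⟨(eLpNorm ((Metric.closedBall (0 : Space d) k).indicator fun _ => (k : ℝ)) 2
    volume).toReal, fun V hV => ?_⟩
  rw [Lp.norm_toLp]
  refine ENNReal.toReal_mono ?_ (eLpNorm_mono fun x => ?_)
  · exact (memLp_indicator_const 2 Metric.isClosed_closedBall.measurableSet _
      (Or.inr measure_closedBall_lt_top.ne)).2.ne
  · rw [Real.norm_of_nonneg (trunc_nonneg k V x)]
    by_cases hx : x ∈ Metric.closedBall (0 : Space d) k
    · rw [Set.indicator_of_mem hx]
      exact (trunc_le k V x).trans (le_abs_self _)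
    · rw [trunc_eq_zero k V hx]
      positivity

theorem inner_real_L2 (f g : Lp ℝ 2 (volume : Measure (Space d))) :
    inner ℝ f g = ∫ x, f x * g x := by
  rw [L2.inner_def]
  refine integral_congr_ae (ae_of_all _ fun x => ?_)
  simp [mul_comm]

theorem memLp_two_of_bounded_support {g : Space d → ℝ} (hg : AEStronglyMeasurable g volume)
    {B r : ℝ} (hB : ∀ x, |g x| ≤ B) (hr : ∀ x, x ∉ Metric.closedBall (0 : Space d) r → g x = 0) :
    MemLp g 2 volume := by
  rw [memLp_two_iff_integrable_sq hg]
  refine integrable_of_bounded_support (hg.pow 2) (B := B ^ 2) (r := r) (fun x => ?_)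
    fun x hx => ?_
  · rw [abs_of_nonneg (sq_nonneg _), ← sq_abs]
    exact pow_le_pow_left₀ (abs_nonneg _) (hB x) 2
  · rw [hr x hx]
    norm_num

theorem setIntegral_eq_integral_mul (f : Space d → ℝ) {s : Set (Space d)} (hs : MeasurableSet s) :
    ∫ x in s, f x = ∫ x, f x * s.indicator (fun _ => (1 : ℝ)) x := by
  rw [← integral_indicator hs]
  congr 1
  ext x
  by_cases hx : x ∈ s <;> simp [hx]

/-- Testing against indicators of sets of finite measure passes the order to the integrals of the
limits over all such sets. -/
theorem ae_le_of_weak_limits {T S : ℕ → Lp ℝ 2 (volume : Measure (Space d))}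
    {v w : Lp ℝ 2 (volume : Measure (Space d))}
    (hT : ∀ g, Tendsto (fun n => inner ℝ (T n) g) atTop (𝓝 (inner ℝ v g)))
    (hS : ∀ g, Tendsto (fun n => inner ℝ (S n) g) atTop (𝓝 (inner ℝ w g)))
    (h : ∀ n, T n ≤ᵐ[volume] S n) : v ≤ᵐ[volume] w := by
  have hint : ∀ (f : Lp ℝ 2 (volume : Measure (Space d))) (s : Set (Space d)), MeasurableSet s →
      volume s < ⊤ → IntegrableOn f s volume := fun f s _ hs => by
    have : IsFiniteMeasure (volume.restrict s) := ⟨by simpa using hs⟩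
    exact ((Lp.memLp f).restrict s).integrable (by norm_num)
  suffices hsub : 0 ≤ᵐ[volume] fun x => w x - v x by
    filter_upwards [hsub] with x hx
    exact sub_nonneg.1 hx
  refine ae_nonneg_of_forall_setIntegral_nonneg_of_sigmaFinite
    (fun s hs hsf => (hint w s hs hsf).sub (hint v s hs hsf)) fun s hs hsf => ?_
  rw [integral_sub (hint w s hs hsf) (hint v s hs hsf), sub_nonneg]
  have h1 : MemLp (s.indicator fun _ => (1 : ℝ)) 2 volume :=
    memLp_indicator_const 2 hs _ (Or.inr hsf.ne)
  have h2 : ∀ f : Lp ℝ 2 (volume : Measure (Space d)),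
      inner ℝ f (h1.toLp _) = ∫ x in s, f x := fun f => by
    rw [inner_real_L2, setIntegral_eq_integral_mul _ hs]
    refine integral_congr_ae ?_
    filter_upwards [h1.coeFn_toLp] with x hx
    rw [hx]
  have h3 := hT (h1.toLp _)
  have h4 := hS (h1.toLp _)
  simp_rw [h2] at h3 h4
  exact le_of_tendsto_of_tendsto' h3 h4 fun n =>
    setIntegral_mono_ae (hint _ s hs hsf) (hint _ s hs hsf) (h n)

/-- The error made by truncation, tested against a bounded function of bounded support. -/
theorem abs_integral_trunc_sub_le (hp : 1 < p) {V : Space d → ℝ} (hV : IsPot p V) {m : ℝ}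
    (hm : 0 ≤ m) (hVm : powInt p V ≤ ENNReal.ofReal m) {g : Space d → ℝ}
    (hg : AEStronglyMeasurable g volume) {B r : ℝ} (hB : ∀ x, |g x| ≤ B)
    (hr : ∀ x, x ∉ Metric.closedBall (0 : Space d) r → g x = 0) {k : ℕ} (hk : r ≤ k)
    (hk0 : 0 < k) :
    |(∫ x, V x * g x) - ∫ x, trunc k V x * g x| ≤ B * m * (k : ℝ) ^ (1 - p) := by
  have hB0 : 0 ≤ B := (abs_nonneg _).trans (hB 0)
  have hkr : (0 : ℝ) < k := by exact_mod_cast hk0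
  have hVl := hV.locallyIntegrable hp.le
  have hVi := integrable_rpow_of_powInt_lt_top hV.1 hV.2.1 (by linarith : 0 ≤ p)
    (hVm.trans_lt ENNReal.ofReal_lt_top)
  have h3 : ∫ x, V x ^ p ≤ m := by
    rw [powInt_eq_ofReal_integral hV.1 (by linarith) hVi, ENNReal.ofReal_le_ofReal_iff hm] at hVm
    exact hVm
  rw [← integral_sub (integrable_mul_of_bounded_support hVl hg hB hr)
    (integrable_mul_of_bounded_support ((memLp_trunc k hV.2.1).locallyIntegrable (by norm_num))
      hg hB hr)]
  refine (abs_integral_le_integral_abs).trans ?_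
  calc ∫ x, |V x * g x - trunc k V x * g x|
      ≤ ∫ x, B * (k : ℝ) ^ (1 - p) * V x ^ p := by
        refine integral_mono_of_nonneg (ae_of_all _ fun x => abs_nonneg _) (hVi.const_mul _) ?_
        filter_upwards [hV.1] with x hx
        change |V x * g x - trunc k V x * g x| ≤ B * (k : ℝ) ^ (1 - p) * V x ^ p
        have hx0 : 0 ≤ V x := hx
        have hpos : 0 ≤ B * (k : ℝ) ^ (1 - p) * V x ^ p := by positivity
        by_cases hxr : x ∈ Metric.closedBall (0 : Space d) r
        · rw [← sub_mul, abs_mul, trunc,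
            Set.indicator_of_mem (Metric.closedBall_subset_closedBall hk hxr)]
          by_cases hle : V x ≤ k
          · rw [min_eq_left hle, max_eq_left hx0, sub_self, abs_zero, zero_mul]
            exact hpos
          · push Not at hle
            rw [min_eq_right hle.le, max_eq_left hkr.le, abs_of_nonneg (by linarith), mul_comm,
              mul_assoc]
            refine mul_le_mul (hB x) ?_ (by linarith) hB0
            -- Where V > k the error is at most V ≤ k^(1-p) V^p, whose integral is controlled.
            have h5 : (1 : ℝ) ≤ (V x / k) ^ (p - 1) :=
              Real.one_le_rpow ((one_le_div hkr).2 hle.le) (by linarith)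
            have h6 : (k : ℝ) ^ (1 - p) * V x ^ p = V x * (V x / k) ^ (p - 1) := by
              rw [Real.div_rpow hx0 hkr.le, ← rpow_mul_of_conj hp hx0,
                show 1 - p = -(p - 1) by ring, Real.rpow_neg hkr.le]
              ring
            rw [h6]
            nlinarith
        · rw [hr x hxr, mul_zero, mul_zero, sub_zero, abs_zero]
          exact hpos
    _ = B * (k : ℝ) ^ (1 - p) * ∫ x, V x ^ p := integral_const_mul _ _
    _ ≤ B * (k : ℝ) ^ (1 - p) * m := by gcongr
    _ = _ := by ring

/-- Bounded sequences of potentials are weakly sequentially compact. -/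
theorem exists_weakTo_subseq (hp : 1 < p) {U : ℕ → Space d → ℝ} (hU : ∀ n, IsPot p (U n)) {m : ℝ}
    (hm : 0 ≤ m) (hUm : ∀ n, powInt p (U n) ≤ ENNReal.ofReal m) :
    ∃ (φ : ℕ → ℕ) (W : Space d → ℝ), StrictMono φ ∧ IsPot p W ∧ WeakTo (fun n => U (φ n)) W := by
  have hp0 : 0 < p := by linarith
  let T : ℕ → ℕ → Lp ℝ 2 (volume : Measure (Space d)) := fun M n =>
    (memLp_trunc M (hU n).2.1).toLp _
  have hTval : ∀ M n, T M n =ᵐ[volume] trunc M (U n) := fun M n =>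
    (memLp_trunc M (hU n).2.1).coeFn_toLp
  have : Fact ((2 : ℝ≥0∞) ≠ ⊤) := ⟨by norm_num⟩
  -- Truncations at a fixed level M are bounded in the Hilbert space L², so one subsequence makes
  -- all of them converge weakly. The limits increase with M.
  obtain ⟨φ, hφ, v, hv⟩ := exists_subseq_weak T fun M => by
    obtain ⟨r, hr⟩ := norm_trunc_toLp_le (d := d) M
    exact ⟨r, fun n => hr _ (hU n).2.1⟩
  have hvl : ∀ M, LocallyIntegrable (v M) := fun M =>
    (Lp.memLp (v M)).locallyIntegrable (by norm_num)
  have hmono : ∀ᵐ x, ∀ M, v M x ≤ v (M + 1) x := by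
    rw [ae_all_iff]
    intro M
    refine ae_le_of_weak_limits (hv M) (hv (M + 1)) fun n => ?_
    filter_upwards [hTval M (φ n), hTval (M + 1) (φ n)] with x h1 h2
    rw [h1, h2]
    exact trunc_mono _ x M.le_succ
  have hnn : ∀ᵐ x, ∀ M, 0 ≤ v M x := by
    rw [ae_all_iff]
    intro M
    have h0 : (0 : Lp ℝ 2 (volume : Measure (Space d))) ≤ᵐ[volume] v M := by
      refine ae_le_of_weak_limits (T := fun _ => 0) (v := 0) (fun g => ?_) (hv M) fun n => ?_
      · simp
      · filter_upwards [hTval M (φ n), Lp.coeFn_zero ℝ 2 (volume : Measure (Space d))] with x h1 h2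
        rw [h1, h2]
        exact trunc_nonneg _ _ x
    filter_upwards [h0, Lp.coeFn_zero ℝ 2 (volume : Measure (Space d))] with x h1 h2
    rwa [h2] at h1
  have hweak : ∀ M, WeakTo (fun n => trunc M (U (φ n))) (v M) := by
    rintro M g hg ⟨B, hB⟩ ⟨r, hr⟩
    have hg2 := memLp_two_of_bounded_support hg hB hr
    have h1 := hv M (hg2.toLp g)
    have h2 : ∀ (f : Lp ℝ 2 (volume : Measure (Space d))), inner ℝ f (hg2.toLp g) =
        ∫ x, f x * g x := fun f => by
      rw [inner_real_L2]
      refine integral_congr_ae ?_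
      filter_upwards [hg2.coeFn_toLp] with x hx
      rw [hx]
    simp_rw [h2] at h1
    refine h1.congr fun n => integral_congr_ae ?_
    filter_upwards [hTval M (φ n)] with x hx
    rw [hx]
  have hvm : ∀ M, powInt p (v M) ≤ ENNReal.ofReal m := by
    intro M
    refine (hweak M).powInt_le hp (fun n => ae_of_all _ (trunc_nonneg _ _))
      (fun n => (memLp_trunc M (hU _).2.1).locallyIntegrable (by norm_num))
      (hnn.mono fun x hx => hx M) (hvl M) hm (Eventually.frequently (Eventually.of_forall fun n =>
        le_trans (lintegral_mono_ae ?_) (hUm (φ n))))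
    filter_upwards [(hU (φ n)).1] with x hx
    exact ENNReal.rpow_le_rpow (ENNReal.ofReal_le_ofReal (trunc_le_self M hx)) hp0.le
  have hvmeas : ∀ M, AEMeasurable (fun x => ENNReal.ofReal (v M x)) volume := fun M =>
    (Lp.aestronglyMeasurable (v M)).aemeasurable.ennreal_ofReal
  have hmono' : ∀ᵐ x, Monotone fun M => ENNReal.ofReal (v M x) := by
    filter_upwards [hmono] with x hx
    exact monotone_nat_of_le_succ fun M => ENNReal.ofReal_le_ofReal (hx M)
  -- The weak limit is the monotone limit of the weak limits of the truncations; monotone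
  -- convergence keeps its p-integral below m, so it is a.e. finite.
  set S : Space d → ℝ≥0∞ := fun x => ⨆ M, ENNReal.ofReal (v M x) with hS
  have hSm : AEMeasurable S volume := AEMeasurable.iSup hvmeas
  have hSp : ∫⁻ x, S x ^ p ≤ ENNReal.ofReal m := by
    refine le_of_tendsto' (lintegral_tendsto_of_tendsto_of_monotone
      (f := fun M x => ENNReal.ofReal (v M x) ^ p) (fun M => (hvmeas M).pow_const p) ?_ ?_) hvm
    · filter_upwards [hmono'] with x hx j k hjk
      exact ENNReal.rpow_le_rpow (hx hjk) hp0.le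
    · filter_upwards [hmono'] with x hx
      exact (ENNReal.continuous_rpow_const.tendsto _).comp (tendsto_atTop_iSup hx)
  have hSfin : ∀ᵐ x, S x < ⊤ := by
    have := ae_lt_top' (hSm.pow_const p) (hSp.trans_lt ENNReal.ofReal_lt_top).ne
    filter_upwards [this] with x hx
    exact (ENNReal.rpow_lt_top_iff_of_pos hp0).1 hx
  set W : Space d → ℝ := fun x => (S x).toReal with hW
  have hW0 : ∀ x, 0 ≤ W x := fun x => ENNReal.toReal_nonneg
  have hWm : AEStronglyMeasurable W volume := hSm.ennreal_toReal.aestronglyMeasurable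
  have hWp : IsPot p W := by
    refine isPot_of_powInt_lt_top hp0 (ae_of_all _ hW0) hWm
      (lt_of_le_of_lt (lintegral_mono fun x => ?_) (hSp.trans_lt ENNReal.ofReal_lt_top))
    exact ENNReal.rpow_le_rpow ENNReal.ofReal_toReal_le hp0.le
  have hlim : ∀ᵐ x, Tendsto (fun M => v M x) atTop (𝓝 (W x)) := by
    filter_upwards [hmono', hSfin, hnn] with x h1 h2 h3
    have h4 := (ENNReal.tendsto_toReal h2.ne).comp (tendsto_atTop_iSup h1)
    refine h4.congr fun M => ?_
    simp [ENNReal.toReal_ofReal (h3 M)]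
  have hle : ∀ᵐ x, ∀ M, v M x ≤ W x := by
    filter_upwards [hSfin, hnn] with x h2 h3 M
    rw [← ENNReal.toReal_ofReal (h3 M)]
    exact ENNReal.toReal_mono h2.ne (le_iSup (fun M => ENNReal.ofReal (v M x)) M)
  refine ⟨φ, W, hφ, hWp, ?_⟩
  rintro g hg ⟨B, hB⟩ ⟨r, hr⟩
  -- The limits in n and M may be exchanged because the truncation error is O(M^(1-p)) uniformly in
  -- n.
  refine tendsto_of_uniform_approx (c := fun M => ∫ x, v M x * g x)
    (e := fun M => B * m * (M : ℝ) ^ (1 - p)) (fun M => hweak M g hg ⟨B, hB⟩ ⟨r, hr⟩) ?_ ?_ ?_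
  · refine tendsto_integral_of_dominated_convergence (fun x => W x * |g x|)
      (fun M => (Lp.aestronglyMeasurable (v M)).mul hg) ?_ ?_ ?_
    · refine integrable_mul_of_bounded_support (hWp.locallyIntegrable hp.le) hg.norm (B := B)
        (r := r) (fun x => by simpa using hB x) fun x hx => by simp [hr x hx]
    · intro M
      filter_upwards [hle, hnn] with x h1 h2
      rw [norm_mul, Real.norm_of_nonneg (h2 M), Real.norm_eq_abs]
      exact mul_le_mul_of_nonneg_right (h1 M) (abs_nonneg _)
    · filter_upwards [hlim] with x hx
      exact hx.mul_const _
  · have h1 : Tendsto (fun M : ℕ => (M : ℝ) ^ (-(p - 1))) atTop (𝓝 0) :=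
      (tendsto_rpow_neg_atTop (by linarith : 0 < p - 1)).comp tendsto_natCast_atTop_atTop
    have h2 := h1.const_mul (B * m)
    rw [mul_zero] at h2
    simpa [neg_sub] using h2
  · filter_upwards [eventually_ge_atTop ⌈r⌉₊, eventually_gt_atTop 0] with M h1 h2 n
    exact abs_integral_trunc_sub_le hp (hU _) hm (hUm _) hg hB hr (Nat.ceil_le.1 h1) h2

end

end LiebThirring

namespace LiebThirring

noncomputable section

variable {d : ℕ} {p : ℝ}

/-! ### Weak convergence and convergence of norms imply strong convergence -/

theorem rpow_tangent_lt (hp : 1 < p) {a b : ℝ} (ha : 0 ≤ a) (hb : 0 ≤ b) (hab : a ≠ b) :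
    0 < b ^ p - a ^ p - p * a ^ (p - 1) * (b - a) := by
  rcases ha.eq_or_lt with rfl | ha
  · rw [Real.zero_rpow (by linarith), Real.zero_rpow (by linarith)]
    have : 0 < b := lt_of_le_of_ne hb hab
    have := Real.rpow_pos_of_pos this p
    linarith
  · have h1 : (-1 : ℝ) ≤ b / a - 1 := by
      have : 0 ≤ b / a := by positivity
      linarith
    have h2 : b / a - 1 ≠ 0 := by
      intro h
      rw [sub_eq_zero, div_eq_one_iff_eq ha.ne'] at h
      exact hab h.symm
    have h3 := one_add_mul_self_lt_rpow_one_add h1 h2 hp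
    rw [add_sub_cancel, Real.div_rpow hb ha.le, lt_div_iff₀ (by positivity)] at h3
    have h4 : (1 + p * (b / a - 1)) * a ^ p = a ^ p + p * a ^ (p - 1) * (b - a) := by
      rw [← rpow_mul_of_conj hp ha.le]
      field_simp
    linarith

/-- A quantitative form of strict convexity of s ↦ s^p. By homogeneity take a + b = 1. The
inequality without the C-term can fail only on a compact set avoiding the diagonal, where the
convexity defect has a positive minimum while the left side is at most 1. -/
theorem exists_abs_sub_rpow_le (hp : 1 < p) {δ : ℝ} (hδ : 0 < δ) :
    ∃ C : ℝ, 0 ≤ C ∧ ∀ a b : ℝ, 0 ≤ a → 0 ≤ b → |b - a| ^ p ≤ δ * (a ^ p + b ^ p) +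
      C * (b ^ p - a ^ p - p * a ^ (p - 1) * (b - a)) := by
  have hp0 : 0 < p := by linarith
  let E : ℝ → ℝ → ℝ := fun a b => b ^ p - a ^ p - p * a ^ (p - 1) * (b - a)
  let F : ℝ → ℝ → ℝ := fun a b => |b - a| ^ p - δ * (a ^ p + b ^ p)
  have hE0 : ∀ a b, 0 ≤ a → 0 ≤ b → 0 ≤ E a b := by
    intro a b ha hb
    by_cases hab : a = b
    · simp [E, hab]
    · exact (rpow_tangent_lt hp ha hb hab).le
  have hcont : ∀ r : ℝ, 0 ≤ r → Continuous fun s : ℝ => s ^ r := fun r hr =>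
    Real.continuous_rpow_const hr
  have hEc : Continuous fun s : ℝ => E s (1 - s) := by
    have h1 := hcont p hp0.le
    have h2 := hcont (p - 1) (by linarith)
    have h3 := h1.comp (continuous_const.sub continuous_id : Continuous fun s : ℝ => 1 - s)
    exact (h3.sub h1).sub ((continuous_const.mul h2).mul
      ((continuous_const.sub continuous_id).sub continuous_id))
  have hFc : Continuous fun s : ℝ => F s (1 - s) := by
    have h1 := hcont p hp0.le
    have h3 := h1.comp (continuous_const.sub continuous_id : Continuous fun s : ℝ => 1 - s)
    have h4 := h1.comp (((continuous_const.sub continuous_id).sub continuous_id).abs :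
      Continuous fun s : ℝ => |1 - s - s|)
    exact h4.sub (continuous_const.mul (h1.add h3))
  obtain ⟨C, hC, hCs⟩ : ∃ C : ℝ, 0 ≤ C ∧ ∀ s ∈ Set.Icc (0 : ℝ) 1, F s (1 - s) ≤ C * E s (1 - s) := by
    have hK : IsCompact (Set.Icc (0 : ℝ) 1 ∩ {s | 0 ≤ F s (1 - s)}) :=
      isCompact_Icc.inter_right (isClosed_le continuous_const hFc)
    rcases (Set.Icc (0 : ℝ) 1 ∩ {s | 0 ≤ F s (1 - s)}).eq_empty_or_nonempty with he | hne
    · refine ⟨0, le_rfl, fun s hs => ?_⟩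
      rw [zero_mul]
      by_contra! hlt
      have : s ∈ Set.Icc (0 : ℝ) 1 ∩ {s | 0 ≤ F s (1 - s)} := ⟨hs, hlt.le⟩
      rw [he] at this
      exact this
    · obtain ⟨s₀, ⟨hs₀, hFs₀⟩, hmin⟩ := hK.exists_isMinOn hne hEc.continuousOn
      have hpos : 0 < E s₀ (1 - s₀) := by
        refine rpow_tangent_lt hp hs₀.1 (by linarith [hs₀.2]) fun heq => ?_
        have hFs : 0 ≤ F s₀ (1 - s₀) := hFs₀
        have hs2 : s₀ = 1 / 2 := by linarith
        simp only [F] at hFs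
        rw [← heq, sub_self, abs_zero, Real.zero_rpow hp0.ne', hs2] at hFs
        have : (0 : ℝ) < (1 / 2) ^ p := Real.rpow_pos_of_pos (by norm_num) p
        nlinarith
      refine ⟨1 / E s₀ (1 - s₀), by positivity, fun s hs => ?_⟩
      by_cases hF : 0 ≤ F s (1 - s)
      · have h1 : E s₀ (1 - s₀) ≤ E s (1 - s) := hmin ⟨hs, hF⟩
        have h2 : F s (1 - s) ≤ 1 := by
          have h3 : |1 - s - s| ^ p ≤ 1 :=
            Real.rpow_le_one (abs_nonneg _) (abs_le.2 ⟨by linarith [hs.2], by linarith [hs.1]⟩) hp0.le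
          have h4 : 0 ≤ δ * (s ^ p + (1 - s) ^ p) := by
            have := Real.rpow_nonneg hs.1 p
            have := Real.rpow_nonneg (by linarith [hs.2] : 0 ≤ 1 - s) p
            positivity
          simp only [F]
          linarith
        refine h2.trans ?_
        rw [one_div, inv_mul_eq_div, one_le_div hpos]
        exact h1
      · push Not at hF
        exact hF.le.trans (mul_nonneg (by positivity) (hE0 s _ hs.1 (by linarith [hs.2])))
  refine ⟨C, hC, fun a b ha hb => ?_⟩
  rcases (add_nonneg ha hb).eq_or_lt with h0 | h0
  · have ha0 : a = 0 := by linarith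
    have hb0 : b = 0 := by linarith
    simp [ha0, hb0, Real.zero_rpow hp0.ne']
  · set l := a + b with hl
    have hs : a / l ∈ Set.Icc (0 : ℝ) 1 :=
      ⟨by positivity, (div_le_one h0).2 (by linarith)⟩
    have hb' : 1 - a / l = b / l := by field_simp; linarith
    have h1 := hCs _ hs
    rw [hb'] at h1
    have hlp : 0 < l ^ p := Real.rpow_pos_of_pos h0 p
    have hFh : F (a / l) (b / l) = F a b / l ^ p := by
      simp only [F]
      rw [← sub_div, abs_div, abs_of_pos h0, Real.div_rpow (abs_nonneg _) h0.le,
        Real.div_rpow ha h0.le, Real.div_rpow hb h0.le]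
      ring
    have hEh : E (a / l) (b / l) = E a b / l ^ p := by
      simp only [E]
      rw [Real.div_rpow ha h0.le, Real.div_rpow hb h0.le, Real.div_rpow ha h0.le,
        ← rpow_mul_of_conj hp h0.le]
      have : 0 < l ^ (p - 1) := Real.rpow_pos_of_pos h0 _
      field_simp
    rw [hFh, hEh, ← mul_div_assoc, div_le_div_iff_of_pos_right hlp] at h1
    simp only [F, E] at h1
    linarith

theorem eLpNorm_rpow_eq_ofReal_integral (hp : 0 < p) {f : Space d → ℝ}
    (hf : MemLp f (ENNReal.ofReal p) volume) :
    eLpNorm f (ENNReal.ofReal p) volume = ENNReal.ofReal (∫ x, |f x| ^ p) ^ (1 / p) := by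
  rw [eLpNorm_ofReal_eq f hp]
  congr 1
  have hi := hf.integrable_norm_rpow (by simpa using hp) ENNReal.ofReal_ne_top
  rw [ENNReal.toReal_ofReal hp.le] at hi
  rw [ofReal_integral_eq_lintegral_ofReal (f := fun x => |f x| ^ p) hi
    (ae_of_all _ fun x => Real.rpow_nonneg (abs_nonneg _) p)]
  refine lintegral_congr fun x => ?_
  rw [← ENNReal.ofReal_rpow_of_nonneg (abs_nonneg _) hp.le, ← Real.norm_eq_abs, ofReal_norm]

/-- Integrate `exists_abs_sub_rpow_le` with a = W and b = U_n: the convexity defect tends to zero by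
convergence of the masses and weak convergence. As `WeakTo` admits only bounded test functions of
bounded support, W^(p-1) is replaced by the power of a truncation, which only increases the bound.
-/
theorem WeakTo.tendsto_eLpNorm_sub (hp : 1 < p) {U : ℕ → Space d → ℝ} {W : Space d → ℝ}
    (hU : ∀ n, IsPot p (U n)) (hW : IsPot p W) (h : WeakTo U W)
    (hm : Tendsto (fun n => powInt p (U n)) atTop (𝓝 (powInt p W))) :
    Tendsto (fun n => eLpNorm (U n - W) (ENNReal.ofReal p) volume) atTop (𝓝 0) := by
  have hp0 : 0 < p := by linarith
  have hUi := fun n => integrable_rpow_of_powInt_lt_top (hU n).1 (hU n).2.1 hp0.le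
    ((hU n).powInt_lt_top hp0)
  have hWi := integrable_rpow_of_powInt_lt_top hW.1 hW.2.1 hp0.le (hW.powInt_lt_top hp0)
  set I : ℝ := ∫ x, W x ^ p with hI
  set J : ℕ → ℝ := fun n => ∫ x, U n x ^ p with hJ
  have hI0 : 0 ≤ I := integral_nonneg_of_ae (hW.1.mono fun x hx => Real.rpow_nonneg hx p)
  have hJ0 : ∀ n, 0 ≤ J n := fun n =>
    integral_nonneg_of_ae ((hU n).1.mono fun x hx => Real.rpow_nonneg hx p)
  have hWI : powInt p W = ENNReal.ofReal I := powInt_eq_ofReal_integral hW.1 hp0.le hWi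
  have hJI : Tendsto J atTop (𝓝 I) := by
    have h1 := (ENNReal.tendsto_toReal (hW.powInt_lt_top hp0).ne).comp hm
    rw [hWI, ENNReal.toReal_ofReal hI0] at h1
    refine h1.congr fun n => ?_
    rw [Function.comp_apply, powInt_eq_ofReal_integral (hU n).1 hp0.le (hUi n),
      ENNReal.toReal_ofReal (hJ0 n)]
  have hmain : Tendsto (fun n => ∫ x, |(U n - W) x| ^ p) atTop (𝓝 0) := by
    rw [tendsto_order]
    refine ⟨fun ε hε => Eventually.of_forall fun n => hε.trans_le
      (integral_nonneg fun x => Real.rpow_nonneg (abs_nonneg _) p), fun ε hε => ?_⟩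
    set δ := ε / (4 * (I + 1)) with hδd
    have hδ : 0 < δ := by positivity
    obtain ⟨C, hC, hCab⟩ := exists_abs_sub_rpow_le hp hδ
    -- The truncation loses at most η in I, which contributes at most C p η ≤ ε/4; the choice of δ
    -- contributes at most ε/2.
    set η := ε / (4 * p * (C + 1)) with hηd
    have hη : 0 < η := by positivity
    obtain ⟨k, hk⟩ : ∃ k : ℕ, I - η < ∫ x, trunc k W x ^ p := by
      have h1 := (ENNReal.tendsto_toReal (hW.powInt_lt_top hp0).ne).comp
        (tendsto_powInt_trunc hp0.le hW.1 hW.2.1)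
      rw [hWI, ENNReal.toReal_ofReal hI0] at h1
      obtain ⟨k, hk⟩ := (h1.eventually_const_lt (by linarith : I - η < I)).exists
      refine ⟨k, ?_⟩
      rw [Function.comp_apply, powInt_eq_ofReal_integral (ae_of_all _ (trunc_nonneg k W)) hp0.le
        (integrable_trunc_rpow hp0 k hW.2.1), ENNReal.toReal_ofReal
        (integral_nonneg fun x => Real.rpow_nonneg (trunc_nonneg k W x) p)] at hk
      exact hk
    obtain ⟨hg1, hg2, hg3⟩ := trunc_rpow_test hp k hW.2.1
    have hWg := integrable_mul_of_bounded_support (hW.locallyIntegrable hp.le) hg1 hg2 hg3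
    have hUg := fun n =>
      integrable_mul_of_bounded_support ((hU n).locallyIntegrable hp.le) hg1 hg2 hg3
    set L := ∫ x, W x * trunc k W x ^ (p - 1) with hL
    have hLI : I - η < L := by
      refine hk.trans_le (integral_mono_ae (integrable_trunc_rpow hp0 k hW.2.1) hWg ?_)
      filter_upwards [hW.1] with x hx
      rw [← rpow_mul_of_conj hp (trunc_nonneg k W x)]
      exact mul_le_mul_of_nonneg_right (trunc_le_self k hx)
        (Real.rpow_nonneg (trunc_nonneg k W x) _)
    have hlim := h _ hg1 ⟨_, hg2⟩ ⟨_, hg3⟩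
    have hbound : ∀ n, ∫ x, |(U n - W) x| ^ p ≤ δ * (I + J n) +
        C * (J n + (p - 1) * I - p * ∫ x, U n x * trunc k W x ^ (p - 1)) := by
      intro n
      have hsubi : Integrable fun x => |(U n - W) x| ^ p := by
        have hi := ((hU n).2.sub hW.2).integrable_norm_rpow (by simpa using hp0)
          ENNReal.ofReal_ne_top
        rw [ENNReal.toReal_ofReal hp0.le] at hi
        exact hi
      have hA : Integrable fun x => δ * (W x ^ p + U n x ^ p) := (hWi.add (hUi n)).const_mul δ
      have hB1 : Integrable fun x => U n x ^ p + (p - 1) * W x ^ p :=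
        (hUi n).add (hWi.const_mul _)
      have hB2 : Integrable fun x => p * (U n x * trunc k W x ^ (p - 1)) := (hUg n).const_mul p
      have hB : Integrable fun x => C * (U n x ^ p + (p - 1) * W x ^ p -
          p * (U n x * trunc k W x ^ (p - 1))) := (hB1.sub hB2).const_mul C
      calc ∫ x, |(U n - W) x| ^ p
          ≤ ∫ x, (δ * (W x ^ p + U n x ^ p) + C * (U n x ^ p + (p - 1) * W x ^ p -
              p * (U n x * trunc k W x ^ (p - 1)))) := by
            refine integral_mono_ae hsubi (hA.add hB) ?_
            filter_upwards [(hU n).1, hW.1] with x hx hy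
            refine (hCab (W x) (U n x) hy hx).trans ?_
            have h1 : trunc k W x ^ (p - 1) ≤ W x ^ (p - 1) :=
              Real.rpow_le_rpow (trunc_nonneg k W x) (trunc_le_self k hy) (by linarith)
            have h2 : U n x * trunc k W x ^ (p - 1) ≤ U n x * W x ^ (p - 1) :=
              mul_le_mul_of_nonneg_left h1 hx
            have h3 := rpow_mul_of_conj hp hy
            have h4 : U n x ^ p - W x ^ p - p * W x ^ (p - 1) * (U n x - W x) ≤
                U n x ^ p + (p - 1) * W x ^ p - p * (U n x * trunc k W x ^ (p - 1)) := by
              have h5 : p * W x ^ (p - 1) * (U n x - W x) =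
                  p * (U n x * W x ^ (p - 1)) - p * W x ^ p := by
                rw [← h3]
                ring
              rw [h5]
              nlinarith
            have := mul_le_mul_of_nonneg_left h4 hC
            linarith
        _ = _ := by
            rw [integral_add hA hB, integral_const_mul, integral_const_mul,
              integral_add hWi (hUi n), integral_sub hB1 hB2,
              integral_add (hUi n) (hWi.const_mul _), integral_const_mul, integral_const_mul]
    have hlim2 : Tendsto (fun n => δ * (I + J n) +
        C * (J n + (p - 1) * I - p * ∫ x, U n x * trunc k W x ^ (p - 1))) atTop
        (𝓝 (δ * (I + I) + C * (I + (p - 1) * I - p * L))) :=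
      ((tendsto_const_nhds.add hJI).const_mul δ).add
        (((hJI.add tendsto_const_nhds).sub (hlim.const_mul p)).const_mul C)
    have hsmall : δ * (I + I) + C * (I + (p - 1) * I - p * L) < ε := by
      have h1 : δ * (I + I) ≤ ε / 2 := by
        have : δ * (I + I) = ε / 2 * (I / (I + 1)) := by rw [hδd]; field_simp; ring
        rw [this]
        exact mul_le_of_le_one_right (by positivity) ((div_le_one (by linarith)).2 (by linarith))
      have h2 : C * (I + (p - 1) * I - p * L) ≤ ε / 4 := by
        have h3 : C * (I + (p - 1) * I - p * L) = C * p * (I - L) := by ring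
        have h4 : C * p * (I - L) ≤ C * p * η :=
          mul_le_mul_of_nonneg_left (by linarith) (by positivity)
        have h5 : C * p * η = ε / 4 * (C / (C + 1)) := by rw [hηd]; field_simp
        rw [h3]
        refine h4.trans ?_
        rw [h5]
        exact mul_le_of_le_one_right (by positivity) ((div_le_one (by linarith)).2 (by linarith))
      linarith
    filter_upwards [hlim2.eventually_lt_const hsmall] with n hn
    exact (hbound n).trans_lt hn
  have h2 := (ENNReal.continuous_rpow_const (y := 1 / p)).tendsto 0 |>.comp
    ((ENNReal.continuous_ofReal.tendsto 0).comp hmain |>.trans_eq (by rw [ENNReal.ofReal_zero]))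
  rw [ENNReal.zero_rpow_of_pos (by positivity)] at h2
  refine h2.congr fun n => ?_
  exact (eLpNorm_rpow_eq_ofReal_integral hp0 ((hU n).2.sub hW.2)).symm

end

end LiebThirring

namespace LiebThirring

noncomputable section

variable {d : ℕ} {p : ℝ}

/-! ### Compactness of the potential energy under weak convergence -/

theorem norm_fourierChar_smul_sub_le (a b : ℝ) (z : ℂ) :
    ‖Real.fourierChar a • z - Real.fourierChar b • z‖ ≤ 2 * Real.pi * |a - b| * ‖z‖ := by
  have h1 : Real.fourierChar a • z - Real.fourierChar b • z =
      Real.fourierChar b • (((Real.fourierChar (a - b) : Circle) : ℂ) * z - z) := by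
    rw [smul_sub]
    congr 1
    rw [Circle.smul_def, Circle.smul_def, smul_eq_mul, smul_eq_mul, ← mul_assoc, ← Circle.coe_mul,
      ← AddChar.map_add_eq_mul, add_sub_cancel]
  rw [h1, Circle.norm_smul, Real.fourierChar_apply, mul_comm (_ : ℂ) Complex.I, ← sub_one_mul,
    norm_mul]
  refine mul_le_mul_of_nonneg_right (Real.norm_exp_I_mul_ofReal_sub_one_le.trans_eq ?_)
    (norm_nonneg _)
  rw [Real.norm_eq_abs, abs_mul, abs_of_pos Real.two_pi_pos]

/-- The low-frequency part of an `L²` function is bounded and Lipschitz continuous. -/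
theorem exists_lowpass_rep (d : ℕ) {Λ : ℝ} (hΛ : 0 < Λ) :
    ∃ C : ℝ, 0 ≤ C ∧ ∀ f : L2 d, ∃ L : Space d → ℂ,
      bandpass (measurableSet_ball (x := 0) (ε := Λ)) f =ᵐ[volume] L ∧ (∀ x, ‖L x‖ ≤ C * ‖f‖) ∧
        ∀ x y, ‖L x - L y‖ ≤ C * ‖f‖ * ‖x - y‖ := by
  set S := Metric.ball (0 : Space d) Λ with hS
  have hSm : MeasurableSet S := measurableSet_ball
  have hfin : volume S ≠ ⊤ := measure_ball_lt_top.ne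
  set c : ℝ := ((volume S) ^ (1 / 2 : ℝ)).toReal with hc
  have hc0 : 0 ≤ c := ENNReal.toReal_nonneg
  have hpi := Real.pi_pos
  refine ⟨c * (1 + 2 * Real.pi * Λ), by positivity, fun f => ?_⟩
  set g : Space d → ℂ := ⇑(𝓕 (bandpass hSm f) : L2 d) with hg
  have hgi : Integrable g := integrable_fourier_bandpass hSm hfin f
  have hg1 : ∫ ξ, ‖g ξ‖ ≤ c * ‖f‖ := by
    rw [integral_norm_eq_lintegral_enorm hgi.1]
    refine ENNReal.toReal_le_of_le_ofReal (by positivity) ?_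
    refine (lintegral_enorm_fourier_bandpass_le hSm f).trans ?_
    rw [ENNReal.ofReal_mul hc0, hc,
      ENNReal.ofReal_toReal (ENNReal.rpow_lt_top_of_nonneg (by norm_num) hfin).ne]
    gcongr
    refine (ENNReal.rpow_le_rpow (setLIntegral_fourier_le_norm f S) (by norm_num)).trans_eq ?_
    rw [ENNReal.ofReal_rpow_of_nonneg (by positivity) (by norm_num), ← Real.sqrt_eq_rpow,
      Real.sqrt_sq (norm_nonneg _)]
  have hg0 : ∀ᵐ ξ, ξ ∉ S → g ξ = 0 := by
    filter_upwards [fourier_bandpass hSm f] with ξ h1 h2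
    rw [hg, h1, Set.indicator_of_notMem h2]
  refine ⟨𝓕⁻ g, ae_eq_fourierInv _ hgi, fun x => ?_, fun x y => ?_⟩
  · rw [Real.fourierInv_eq]
    refine (norm_integral_le_integral_norm _).trans ?_
    simp_rw [Circle.norm_smul]
    refine hg1.trans ?_
    have : 0 ≤ c * ‖f‖ * (2 * Real.pi * Λ) := by positivity
    linarith
  · have hint : ∀ w : Space d, Integrable fun v => Real.fourierChar (inner ℝ v w) • g v := by
      intro w
      have := (Real.fourierIntegral_convergent_iff (V := Space d) (-w) (f := g)).2 hgi
      simpa using this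
    rw [Real.fourierInv_eq, Real.fourierInv_eq, ← integral_sub (hint x) (hint y)]
    refine (norm_integral_le_integral_norm _).trans ?_
    calc ∫ v, ‖Real.fourierChar (inner ℝ v x) • g v - Real.fourierChar (inner ℝ v y) • g v‖
        ≤ ∫ v, 2 * Real.pi * (Λ * ‖x - y‖) * ‖g v‖ := by
          refine integral_mono_ae ((hint x).sub (hint y)).norm (hgi.norm.const_mul _) ?_
          filter_upwards [hg0] with v hv
          refine (norm_fourierChar_smul_sub_le _ _ _).trans ?_
          by_cases hvS : v ∈ S
          · refine mul_le_mul_of_nonneg_right (mul_le_mul_of_nonneg_left ?_ (by positivity))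
              (norm_nonneg _)
            rw [← inner_sub_right]
            refine (abs_real_inner_le_norm _ _).trans (mul_le_mul_of_nonneg_right ?_ (norm_nonneg _))
            rw [hS, mem_ball_zero_iff] at hvS
            exact hvS.le
          · rw [hv hvS, norm_zero, mul_zero, mul_zero]
      _ = 2 * Real.pi * (Λ * ‖x - y‖) * ∫ v, ‖g v‖ := integral_const_mul _ _
      _ ≤ 2 * Real.pi * (Λ * ‖x - y‖) * (c * ‖f‖) := by gcongr
      _ ≤ c * (1 + 2 * Real.pi * Λ) * ‖f‖ * ‖x - y‖ := by
          have : 0 ≤ c * ‖f‖ * ‖x - y‖ := by positivity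
          linarith

/-- Total boundedness in measurable form: send each point to the nearest member of a finite net. -/
theorem exists_simpleFunc_dist_lt (R : ℝ) {ρ : ℝ} (hρ : 0 < ρ) :
    ∃ c : SimpleFunc (Space d) (Space d), ∀ x ∈ Metric.closedBall (0 : Space d) R,
      dist (c x) x < ρ := by
  set e := TopologicalSpace.denseSeq (Space d) with he
  let U : ℕ → Set (Space d) := fun N => ⋃ k ≤ N, Metric.ball (e k) ρ
  obtain ⟨N, hN⟩ := (isCompact_closedBall (0 : Space d) R).elim_directed_cover U
    (fun N => isOpen_biUnion fun _ _ => Metric.isOpen_ball) (fun x _ => by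
      obtain ⟨k, hk⟩ := Metric.denseRange_iff.1 (TopologicalSpace.denseRange_denseSeq (Space d))
        x ρ hρ
      exact Set.mem_iUnion.2 ⟨k, Set.mem_biUnion (le_refl k) hk⟩)
    (monotone_nat_of_le_succ (fun N => Set.biUnion_subset_biUnion_left
      fun k (hk : k ≤ N) => hk.trans N.le_succ)).directed_le
  refine ⟨SimpleFunc.nearestPt e N, fun x hx => ?_⟩
  obtain ⟨k, hk, hkx⟩ := Set.mem_iUnion₂.1 (hN hx)
  have h1 := SimpleFunc.edist_nearestPt_le e x hk
  rw [edist_dist, edist_dist, ENNReal.ofReal_le_ofReal_iff dist_nonneg] at h1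
  rw [Metric.mem_ball, dist_comm] at hkx
  exact h1.trans_lt hkx

theorem setIntegral_le_of_powInt (hp : 1 ≤ p) {V : Space d → ℝ} (hV : IsPot p V) {m : ℝ}
    (hm : 0 ≤ m) (hVm : powInt p V ≤ ENNReal.ofReal m) (R : ℝ) :
    ∫ x in Metric.closedBall (0 : Space d) R, V x ≤
      (volume (Metric.closedBall (0 : Space d) R)).toReal + m := by
  have hp0 : 0 < p := by linarith
  have hVi := integrable_rpow_of_powInt_lt_top hV.1 hV.2.1 hp0.le
    (hVm.trans_lt ENNReal.ofReal_lt_top)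
  have h3 : ∫ x, V x ^ p ≤ m := by
    rw [powInt_eq_ofReal_integral hV.1 hp0.le hVi, ENNReal.ofReal_le_ofReal_iff hm] at hVm
    exact hVm
  have hfin : IsFiniteMeasure (volume.restrict (Metric.closedBall (0 : Space d) R)) :=
    ⟨by simpa using measure_closedBall_lt_top⟩
  calc ∫ x in Metric.closedBall (0 : Space d) R, V x
      ≤ ∫ x in Metric.closedBall (0 : Space d) R, (1 + V x ^ p) := by
        refine integral_mono_ae ((hV.locallyIntegrable hp).integrableOn_isCompact
          (isCompact_closedBall 0 R)) ((integrable_const _).add hVi.integrableOn) ?_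
        filter_upwards [ae_restrict_of_ae hV.1] with x hx
        have hx0 : 0 ≤ V x := hx
        rcases le_total (V x) 1 with h | h
        · have := Real.rpow_nonneg hx0 p
          linarith
        · have := Real.self_le_rpow_of_one_le h hp
          linarith
    _ = (volume (Metric.closedBall (0 : Space d) R)).toReal +
          ∫ x in Metric.closedBall (0 : Space d) R, V x ^ p := by
        rw [integral_add (integrable_const _) hVi.integrableOn, setIntegral_const, smul_eq_mul,
          mul_one, Measure.real]
    _ ≤ _ := by
        gcongr
        refine (setIntegral_le_integral hVi ?_).trans h3
        filter_upwards [hV.1] with x hx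
        exact Real.rpow_nonneg hx p

theorem setIntegral_mul_simpleFunc {V : Space d → ℝ} {S : Set (Space d)}
    (hV : IntegrableOn V S) (c : SimpleFunc (Space d) (Space d)) (F : Space d → ℝ) :
    ∫ x in S, V x * F (c x) = ∑ y ∈ c.range, F y * ∫ x in S ∩ c ⁻¹' {y}, V x := by
  classical
  have h1 : ∀ x, V x * F (c x) = ∑ y ∈ c.range, F y * (c ⁻¹' {y}).indicator V x := by
    intro x
    rw [Finset.sum_eq_single (c x)]
    · rw [Set.indicator_of_mem (by simp), mul_comm]
    · intro y _ hy
      rw [Set.indicator_of_notMem (fun h => hy (by simpa using h.symm)), mul_zero]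
    · intro h
      exact absurd (c.mem_range_self x) h
  simp_rw [h1]
  rw [integral_finsetSum]
  · refine Finset.sum_congr rfl fun y _ => ?_
    rw [integral_const_mul, setIntegral_indicator (c.measurableSet_fiber y)]
  · intro y _
    exact (hV.indicator (c.measurableSet_fiber y)).const_mul _

/-- Weak convergence is uniform on bounded sets of Lipschitz functions. -/
theorem WeakTo.eventually_abs_setIntegral_sub_le (hp : 1 ≤ p) {U : ℕ → Space d → ℝ}
    {W : Space d → ℝ} (hU : ∀ n, IsPot p (U n)) (hW : IsPot p W) {m : ℝ} (hm : 0 ≤ m)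
    (hUm : ∀ n, powInt p (U n) ≤ ENNReal.ofReal m) (hWm : powInt p W ≤ ENNReal.ofReal m)
    (h : WeakTo U W) (R : ℝ) {K η : ℝ} (hK : 0 ≤ K) (hη : 0 < η) :
    ∀ᶠ n in atTop, ∀ F : Space d → ℝ, (∀ x, |F x| ≤ K) → (∀ x y, |F x - F y| ≤ K * ‖x - y‖) →
      |(∫ x in Metric.closedBall (0 : Space d) R, U n x * F x) -
        ∫ x in Metric.closedBall (0 : Space d) R, W x * F x| ≤ η := by
  classical
  set S := Metric.closedBall (0 : Space d) R with hS
  have hSm : MeasurableSet S := Metric.isClosed_closedBall.measurableSet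
  set A : ℝ := (volume S).toReal + m with hA
  have hA0 : 0 ≤ A := add_nonneg ENNReal.toReal_nonneg hm
  -- Replacing F by its values on a net of mesh ρ costs at most η/4 for U_n and for W. What is left
  -- is a finite sum over cells fixed before F, so weak convergence on these cells is uniform in F.
  set ρ : ℝ := η / (4 * (K + 1) * (A + 1)) with hρd
  have hρ : 0 < ρ := by positivity
  obtain ⟨c, hc⟩ := exists_simpleFunc_dist_lt (d := d) R hρ
  set η' : ℝ := η / (2 * (K + 1) * (c.range.card + 1)) with hη'
  have hη'0 : 0 < η' := by positivity
  have hVon : ∀ V : Space d → ℝ, IsPot p V → IntegrableOn V S := fun V hV =>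
    (hV.locallyIntegrable hp).integrableOn_isCompact (isCompact_closedBall 0 R)
  have hpart : ∀ y ∈ c.range, ∀ᶠ n in atTop,
      |(∫ x in S ∩ c ⁻¹' {y}, U n x) - ∫ x in S ∩ c ⁻¹' {y}, W x| ≤ η' := by
    intro y _
    have hms : MeasurableSet (S ∩ c ⁻¹' {y}) := hSm.inter (c.measurableSet_fiber y)
    have h1 := h ((S ∩ c ⁻¹' {y}).indicator fun _ => (1 : ℝ))
      (aestronglyMeasurable_const.indicator hms) ⟨1, fun x => by
        by_cases hx : x ∈ S ∩ c ⁻¹' {y} <;> simp [Set.indicator, hx]⟩ ⟨R, fun x hx =>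
        Set.indicator_of_notMem (fun hx' => hx hx'.1) _⟩
    simp_rw [← setIntegral_eq_integral_mul _ hms] at h1
    filter_upwards [Metric.tendsto_nhds.1 h1 η' hη'0] with n hn
    rw [Real.dist_eq] at hn
    exact hn.le
  filter_upwards [(Finset.eventually_all c.range).2 hpart] with n hn F hFK hFL
  have hFc : Continuous F := by
    refine (LipschitzWith.of_dist_le_mul (K := ⟨K, hK⟩) fun x y => ?_).continuous
    rw [Real.dist_eq, dist_eq_norm]
    exact hFL x y
  have herr : ∀ V : Space d → ℝ, IsPot p V → powInt p V ≤ ENNReal.ofReal m →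
      |(∫ x in S, V x * F x) - ∫ x in S, V x * F (c x)| ≤ η / 4 := by
    intro V hV hVm
    have hi1 : IntegrableOn (fun x => V x * F x) S :=
      (hVon V hV).mul_bdd hFc.aestronglyMeasurable (c := K) (ae_of_all _ hFK)
    have hi2 : IntegrableOn (fun x => V x * F (c x)) S :=
      (hVon V hV).mul_bdd (hFc.measurable.comp c.measurable).aestronglyMeasurable (c := K)
        (ae_of_all _ fun x => hFK _)
    rw [← integral_sub hi1 hi2]
    refine abs_integral_le_integral_abs.trans ?_
    calc ∫ x in S, |V x * F x - V x * F (c x)| ≤ ∫ x in S, K * ρ * V x := by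
          refine integral_mono_ae (hi1.sub hi2).abs ((hVon V hV).const_mul _) ?_
          filter_upwards [ae_restrict_of_ae hV.1, ae_restrict_mem hSm] with x hx hxS
          have hx0 : 0 ≤ V x := hx
          change |V x * F x - V x * F (c x)| ≤ K * ρ * V x
          rw [← mul_sub, abs_mul, abs_of_nonneg hx0, mul_comm]
          refine mul_le_mul_of_nonneg_right ((hFL _ _).trans ?_) hx0
          rw [← dist_eq_norm, dist_comm]
          exact mul_le_mul_of_nonneg_left (hc x hxS).le hK
      _ = K * ρ * ∫ x in S, V x := integral_const_mul _ _
      _ ≤ K * ρ * A := by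
          refine mul_le_mul_of_nonneg_left ?_ (by positivity)
          exact setIntegral_le_of_powInt hp hV hm hVm R
      _ = η / 4 * (K / (K + 1) * (A / (A + 1))) := by rw [hρd]; field_simp
      _ ≤ η / 4 := by
          refine mul_le_of_le_one_right (by positivity) (mul_le_one₀ ?_ (by positivity) ?_)
          · exact (div_le_one (by linarith)).2 (by linarith)
          · exact (div_le_one (by linarith)).2 (by linarith)
  have hmid : |(∫ x in S, U n x * F (c x)) - ∫ x in S, W x * F (c x)| ≤ η / 2 := by
    rw [setIntegral_mul_simpleFunc (hVon _ (hU n)), setIntegral_mul_simpleFunc (hVon _ hW),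
      ← Finset.sum_sub_distrib]
    refine (Finset.abs_sum_le_sum_abs _ _).trans ?_
    calc ∑ y ∈ c.range, |F y * (∫ x in S ∩ c ⁻¹' {y}, U n x) - F y * ∫ x in S ∩ c ⁻¹' {y}, W x|
        ≤ ∑ _y ∈ c.range, K * η' := by
          refine Finset.sum_le_sum fun y hy => ?_
          rw [← mul_sub, abs_mul]
          exact mul_le_mul (hFK y) (hn y hy) (abs_nonneg _) hK
      _ = η / 2 * (K / (K + 1) * (c.range.card / (c.range.card + 1))) := by
          rw [Finset.sum_const, nsmul_eq_mul, hη']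
          field_simp
      _ ≤ η / 2 := by
          refine mul_le_of_le_one_right (by positivity) (mul_le_one₀ ?_ (by positivity) ?_)
          · exact (div_le_one (by linarith)).2 (by linarith)
          · exact (div_le_one (by positivity)).2 (by linarith)
  have h1 := herr _ (hU n) (hUm n)
  have h2 := herr _ hW hWm
  rw [abs_le] at *
  constructor <;> linarith [h1.1, h1.2, h2.1, h2.2, hmid.1, hmid.2]

end

end LiebThirring

namespace LiebThirring

noncomputable section

variable {d : ℕ} {p : ℝ}

/-! ### Uniform convergence of potential energies on bounded sets of H¹ -/

theorem eLpNorm_le_of_powInt_le (hp : 0 < p) {V : Space d → ℝ} (hV : 0 ≤ᵐ[volume] V) {m : ℝ}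
    (hm : 0 ≤ m) (h : powInt p V ≤ ENNReal.ofReal m) :
    eLpNorm V (ENNReal.ofReal p) volume ≤ ENNReal.ofReal (m ^ (1 / p)) := by
  rw [← eLpNorm_rpow_eq_powInt hp hV] at h
  have h1 := ENNReal.rpow_le_rpow h (by positivity : 0 ≤ 1 / p)
  rw [← ENNReal.rpow_mul, mul_one_div_cancel hp.ne', ENNReal.rpow_one,
    ENNReal.ofReal_rpow_of_nonneg hm (by positivity)] at h1
  exact h1

theorem pot_indicator (V : Space d → ℝ) {S : Set (Space d)} (hS : MeasurableSet S) (u : H1 d) :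
    pot (S.indicator V) u = ∫ x in S, V x * ‖u.1.1 x‖ ^ 2 := by
  rw [← integral_indicator hS]
  refine integral_congr_ae (ae_of_all _ fun x => ?_)
  by_cases hx : x ∈ S <;> simp [hx]

/-- For use with u split into high part h and low part l: the error is a small multiple of |u|² plus
a multiple of |h|², both controlled in L^q. -/
theorem abs_norm_sq_sub_le {θ : ℝ} (hθ : 0 < θ) (a h l : ℂ) (hl : a = h + l) :
    |‖a‖ ^ 2 - ‖l‖ ^ 2| ≤ θ * ‖a‖ ^ 2 + (1 + 1 / θ) * ‖h‖ ^ 2 := by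
  have h1 : ‖l‖ ≤ ‖a‖ + ‖h‖ := by
    rw [show l = a - h by rw [hl]; ring]
    exact norm_sub_le _ _
  have h2 : ‖a‖ ≤ ‖h‖ + ‖l‖ := hl ▸ norm_add_le h l
  have h3 : 2 * ‖a‖ * ‖h‖ ≤ θ * ‖a‖ ^ 2 + 1 / θ * ‖h‖ ^ 2 := by
    have : θ * ‖a‖ ^ 2 + 1 / θ * ‖h‖ ^ 2 - 2 * ‖a‖ * ‖h‖ = (θ * ‖a‖ - ‖h‖) ^ 2 / θ := by
      field_simp
      ring
    have h5 : 0 ≤ (θ * ‖a‖ - ‖h‖) ^ 2 / θ := by positivity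
    linarith
  have ha := norm_nonneg a
  have hh := norm_nonneg h
  have hl0 := norm_nonneg l
  have h4 : |‖a‖ ^ 2 - ‖l‖ ^ 2| ≤ 2 * ‖a‖ * ‖h‖ + ‖h‖ ^ 2 := by
    rw [abs_le]
    constructor
    · nlinarith
    · rcases le_total ‖a‖ ‖h‖ with hc | hc
      · nlinarith [sq_nonneg ‖l‖, mul_le_mul_of_nonneg_left hc ha]
      · have h6 : (‖a‖ - ‖h‖) ^ 2 ≤ ‖l‖ ^ 2 := pow_le_pow_left₀ (by linarith) (by linarith) 2
        nlinarith [sq_nonneg ‖h‖]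
  linarith

/-- Weakly convergent potentials have convergent potential energies on bounded sets, uniformly on
bounded sets of `H¹`. -/
theorem WeakTo.eventually_pot_le (hp : 1 < p) (hpd : d < 2 * p) {U : ℕ → Space d → ℝ}
    {W : Space d → ℝ} (hU : ∀ n, IsPot p (U n)) (hW : IsPot p W) {m : ℝ} (hm : 0 ≤ m)
    (hUm : ∀ n, powInt p (U n) ≤ ENNReal.ofReal m) (hWm : powInt p W ≤ ENNReal.ofReal m)
    (h : WeakTo U W) (R : ℝ) {ε : ℝ} (hε : 0 < ε) :
    ∀ᶠ n in atTop, ∀ u : H1 d, pot ((Metric.closedBall 0 R).indicator (U n)) u ≤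
      pot ((Metric.closedBall 0 R).indicator W) u + ε * (gradSq u + ‖u.1.1‖ ^ 2) := by
  have hp0 : 0 < p := by linarith
  set S := Metric.closedBall (0 : Space d) R with hS
  have hSm : MeasurableSet S := Metric.isClosed_closedBall.measurableSet
  set M : ℝ := m ^ (1 / p) with hM
  have hM0 : 0 ≤ M := Real.rpow_nonneg hm _
  obtain ⟨C₁, hC₁, hpot⟩ := abs_pot_le (d := d) hp hpd hM0 one_pos
  -- θ limits the |u|² error and then δ, depending on θ, limits the high-frequency error, each to
  -- ε/8.
  set θ : ℝ := ε / (8 * (1 + C₁)) with hθd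
  have hθ : 0 < θ := by positivity
  set δ : ℝ := √(ε / (8 * ((1 + 1 / θ) * (M + 1)))) with hδd
  have hδ : 0 < δ := by positivity
  have hδ2 : δ ^ 2 = ε / (8 * ((1 + 1 / θ) * (M + 1))) := Real.sq_sqrt (by positivity)
  obtain ⟨hq, hqd⟩ := sobolev_exponent hp hpd
  obtain ⟨Λ, hΛ, hhigh⟩ := eLpNorm_highpass_le hq hqd hδ
  obtain ⟨C, hC, hlow⟩ := exists_lowpass_rep d hΛ
  filter_upwards [h.eventually_abs_setIntegral_sub_le hp.le hU hW hm hUm hWm R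
    (K := 2 * C ^ 2) (η := ε / 2) (by positivity) (by positivity)] with n hn u
  by_cases hu0 : ‖u.1.1‖ = 0
  · rw [H1.eq_zero_of_norm_eq_zero hu0]
    have h0 : ∀ V : Space d → ℝ, pot V (0 : H1 d) = 0 := fun V => by
      have h1 := energy_zero V
      have h2 : gradSq (0 : H1 d) = 0 := by simp [gradSq]
      rw [energy_eq, h2] at h1
      linarith
    rw [h0, h0]
    have := gradSq_nonneg (0 : H1 d)
    positivity
  have hun : 0 < ‖u.1.1‖ := lt_of_le_of_ne (norm_nonneg _) (Ne.symm hu0)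
  have hg := gradSq_nonneg u
  set hi : L2 d := bandpass (measurableSet_ball (x := 0) (ε := Λ)).compl u.1.1 with hhi
  obtain ⟨L, hLae, hLb, hLl⟩ := hlow u.1.1
  have hsplit : ∀ᵐ x, u.1.1 x = hi x + L x := by
    have h1 : u.1.1 = hi + bandpass (measurableSet_ball (x := 0) (ε := Λ)) u.1.1 := by
      rw [hhi, ← bandpass_union measurableSet_ball.compl measurableSet_ball disjoint_compl_left]
      conv_lhs => rw [← bandpass_univ u.1.1]
      congr 1
      exact (Set.compl_union_self _).symm
    have h2 := Lp.coeFn_add hi (bandpass (measurableSet_ball (x := 0) (ε := Λ)) u.1.1)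
    rw [← h1] at h2
    filter_upwards [h2, hLae] with x h3 h4
    rw [h3, Pi.add_apply, h4]
  have hLm : AEStronglyMeasurable L volume :=
    (Lp.aestronglyMeasurable _).congr hLae
  have herr : ∀ V : Space d → ℝ, IsPot p V → powInt p V ≤ ENNReal.ofReal m →
      |(∫ x in S, V x * ‖u.1.1 x‖ ^ 2) - ∫ x in S, V x * ‖L x‖ ^ 2| ≤
        ε / 4 * (gradSq u + ‖u.1.1‖ ^ 2) := by
    intro V hV hVm
    have hVM := eLpNorm_le_of_powInt_le hp0 hV.1 hm hVm
    have hu := integrable_pot hp hpd hV.2 u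
    have hlint : ∫⁻ x, ‖V x‖ₑ * ‖hi x‖ₑ ^ 2 ≤ ENNReal.ofReal (M * (δ ^ 2 * gradSq u)) := by
      refine (lintegral_mul_enorm_sq_le hp hV.2.1 (Lp.aestronglyMeasurable hi)).trans ?_
      refine (mul_le_mul' hVM (pow_le_pow_left' (hhigh u) 2)).trans_eq ?_
      rw [← ENNReal.ofReal_pow (by positivity), ← ENNReal.ofReal_mul hM0, mul_pow,
        Real.sq_sqrt hg]
    have henorm : ∀ x, ‖V x * ‖hi x‖ ^ 2‖ₑ = ‖V x‖ₑ * ‖hi x‖ₑ ^ 2 := fun x => by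
      rw [enorm_mul, enorm_pow, enorm_norm]
    have hhint : Integrable fun x => V x * ‖hi x‖ ^ 2 := by
      refine ⟨hV.2.1.mul ((Lp.aestronglyMeasurable hi).norm.pow 2), ?_⟩
      rw [hasFiniteIntegral_iff_enorm]
      simp_rw [henorm]
      exact hlint.trans_lt ENNReal.ofReal_lt_top
    have hhle : ∫ x, V x * ‖hi x‖ ^ 2 ≤ M * (δ ^ 2 * gradSq u) := by
      rw [← ENNReal.ofReal_le_ofReal_iff (by positivity)]
      refine le_trans ?_ hlint
      refine le_trans ?_ ((enorm_integral_le_lintegral_enorm _).trans_eq (lintegral_congr henorm))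
      rw [← ofReal_norm]
      exact ENNReal.ofReal_le_ofReal (le_abs_self _)
    have hLint : IntegrableOn (fun x => V x * ‖L x‖ ^ 2) S := by
      refine ((hV.locallyIntegrable hp.le).integrableOn_isCompact (isCompact_closedBall 0 R)).mul_bdd
        (hLm.norm.pow 2).restrict (c := (C * ‖u.1.1‖) ^ 2) (ae_of_all _ fun x => ?_)
      rw [Real.norm_eq_abs, abs_of_nonneg (sq_nonneg _)]
      exact pow_le_pow_left₀ (norm_nonneg _) (hLb x) 2
    rw [← integral_sub hu.integrableOn hLint]
    refine abs_integral_le_integral_abs.trans ?_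
    have hrhs : Integrable fun x => θ * (V x * ‖u.1.1 x‖ ^ 2) +
        (1 + 1 / θ) * (V x * ‖hi x‖ ^ 2) := (hu.const_mul θ).add (hhint.const_mul _)
    calc ∫ x in S, |V x * ‖u.1.1 x‖ ^ 2 - V x * ‖L x‖ ^ 2|
        ≤ ∫ x in S, (θ * (V x * ‖u.1.1 x‖ ^ 2) + (1 + 1 / θ) * (V x * ‖hi x‖ ^ 2)) := by
          refine integral_mono_ae (hu.integrableOn.sub hLint).abs hrhs.integrableOn ?_
          filter_upwards [ae_restrict_of_ae hV.1, ae_restrict_of_ae hsplit] with x hx hxs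
          have hx0 : 0 ≤ V x := hx
          change |V x * ‖u.1.1 x‖ ^ 2 - V x * ‖L x‖ ^ 2| ≤ _
          rw [← mul_sub, abs_mul, abs_of_nonneg hx0]
          refine (mul_le_mul_of_nonneg_left (abs_norm_sq_sub_le hθ _ _ _ hxs) hx0).trans_eq ?_
          ring
      _ ≤ ∫ x, (θ * (V x * ‖u.1.1 x‖ ^ 2) + (1 + 1 / θ) * (V x * ‖hi x‖ ^ 2)) := by
          refine setIntegral_le_integral hrhs ?_
          filter_upwards [hV.1] with x hx
          have hx0 : 0 ≤ V x := hx
          change 0 ≤ θ * (V x * ‖u.1.1 x‖ ^ 2) + (1 + 1 / θ) * (V x * ‖hi x‖ ^ 2)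
          positivity
      _ = θ * pot V u + (1 + 1 / θ) * ∫ x, V x * ‖hi x‖ ^ 2 := by
          rw [integral_add (hu.const_mul θ) (hhint.const_mul _), integral_const_mul,
            integral_const_mul, pot]
      _ ≤ θ * (gradSq u + C₁ * ‖u.1.1‖ ^ 2) + (1 + 1 / θ) * (M * (δ ^ 2 * gradSq u)) := by
          have h1 := (le_abs_self _).trans (hpot V hV.2.1 hVM u)
          rw [one_mul] at h1
          gcongr
      _ ≤ ε / 8 * (gradSq u + ‖u.1.1‖ ^ 2) + ε / 8 * gradSq u := by
          refine add_le_add ?_ ?_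
          · have h1 : θ * (gradSq u + C₁ * ‖u.1.1‖ ^ 2) ≤
                θ * ((1 + C₁) * (gradSq u + ‖u.1.1‖ ^ 2)) := by
              refine mul_le_mul_of_nonneg_left ?_ hθ.le
              have : 0 ≤ C₁ * gradSq u := mul_nonneg hC₁ hg
              nlinarith [sq_nonneg ‖u.1.1‖]
            refine h1.trans_eq ?_
            rw [hθd]
            field_simp
          · rw [hδ2]
            have h1 : (1 + 1 / θ) * (M * (ε / (8 * ((1 + 1 / θ) * (M + 1))) * gradSq u)) =
                ε / 8 * gradSq u * (M / (M + 1)) := by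
              field_simp
            rw [h1]
            exact mul_le_of_le_one_right (by positivity)
              ((div_le_one (by linarith)).2 (by linarith))
      _ ≤ _ := by nlinarith [sq_nonneg ‖u.1.1‖]
  -- Dividing by ‖u‖² puts all low-frequency densities into one class of functions with common sup
  -- and Lipschitz bound 2C², so the same n works for every u.
  have hF := hn (fun x => ‖L x‖ ^ 2 / ‖u.1.1‖ ^ 2) (fun x => by
      rw [abs_of_nonneg (by positivity), div_le_iff₀ (by positivity)]
      have := pow_le_pow_left₀ (norm_nonneg _) (hLb x) 2
      nlinarith [sq_nonneg (C * ‖u.1.1‖)]) (fun x y => by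
      rw [← sub_div, abs_div, abs_of_nonneg (sq_nonneg ‖u.1.1‖), div_le_iff₀ (by positivity)]
      have h1 : ‖L x‖ ^ 2 - ‖L y‖ ^ 2 = (‖L x‖ - ‖L y‖) * (‖L x‖ + ‖L y‖) := by ring
      rw [h1, abs_mul]
      have h2 := (abs_norm_sub_norm_le (L x) (L y)).trans (hLl x y)
      have h3 : |‖L x‖ + ‖L y‖| ≤ 2 * (C * ‖u.1.1‖) := by
        rw [abs_of_nonneg (by positivity)]
        linarith [hLb x, hLb y]
      refine (mul_le_mul h2 h3 (abs_nonneg _) (by positivity)).trans_eq ?_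
      ring)
  have hdiv : ∀ V : Space d → ℝ, ∫ x in S, V x * (‖L x‖ ^ 2 / ‖u.1.1‖ ^ 2) =
      (∫ x in S, V x * ‖L x‖ ^ 2) / ‖u.1.1‖ ^ 2 := fun V => by
    rw [← integral_div]
    simp_rw [mul_div_assoc]
  rw [hdiv, hdiv, ← sub_div, abs_div, abs_of_nonneg (sq_nonneg ‖u.1.1‖),
    div_le_iff₀ (by positivity)] at hF
  rw [pot_indicator _ hSm, pot_indicator _ hSm]
  have h1 := (abs_le.1 (herr _ (hU n) (hUm n))).2
  have h2 := (abs_le.1 (herr _ hW hWm)).1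
  have h3 := (abs_le.1 hF).2
  nlinarith [sq_nonneg ‖u.1.1‖]

/-- Negative subspaces of localized potentials survive in the weak limit. -/
theorem WeakTo.eventually_hasNegSubspace (hp : 1 < p) (hpd : d < 2 * p) {U : ℕ → Space d → ℝ}
    {W : Space d → ℝ} (hU : ∀ n, IsPot p (U n)) (hW : IsPot p W) {m : ℝ} (hm : 0 ≤ m)
    (hUm : ∀ n, powInt p (U n) ≤ ENNReal.ofReal m) (hWm : powInt p W ≤ ENNReal.ofReal m)
    (h : WeakTo U W) (R : ℝ) {ε : ℝ} (hε : 0 < ε) :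
    ∀ᶠ n in atTop, ∀ (j : ℕ) (t : ℝ), 0 ≤ t →
      HasNegSubspace ((Metric.closedBall 0 R).indicator (U n)) j t →
        HasNegSubspace W j (t - ε) := by
  have hp0 : 0 < p := by linarith
  set S := Metric.closedBall (0 : Space d) R with hS
  have hSm : MeasurableSet S := Metric.isClosed_closedBall.measurableSet
  set M : ℝ := m ^ (1 / p) with hM
  have hM0 : 0 ≤ M := Real.rpow_nonneg hm _
  obtain ⟨C, hC, hgrad⟩ := gradSq_le_of_energy_nonpos (d := d) hp hpd hM0
  filter_upwards [h.eventually_pot_le hp hpd hU hW hm hUm hWm R (ε := ε / (C + 1))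
    (by positivity)] with n hn j t ht hneg
  obtain ⟨E, hE, hEn⟩ := hneg
  -- The same subspace works for W: negativity bounds the kinetic energy by ‖u‖², which turns the
  -- form error into ε‖u‖², and W outside the ball only lowers the energy.
  refine ⟨E, hE, fun u hu => ?_⟩
  have h1 := hEn u hu
  have hUn := (hU n).indicator hSm
  have h2 := hgrad _ hUn.2.1 (((eLpNorm_indicator_le _)).trans
    (eLpNorm_le_of_powInt_le hp0 (hU n).1 hm (hUm n))) u
    (h1.trans (by nlinarith [sq_nonneg ‖u.1.1‖]))
  have h3 := hn u
  have h4 : pot (S.indicator W) u ≤ pot W u := by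
    refine pot_mono hp hpd (hW.indicator hSm).2 hW.2 ?_ u
    filter_upwards [hW.1] with x hx
    exact Set.indicator_le_self' (fun _ _ => hx) x
  have h5 : ε / (C + 1) * (gradSq u + ‖u.1.1‖ ^ 2) ≤ ε * ‖u.1.1‖ ^ 2 := by
    calc ε / (C + 1) * (gradSq u + ‖u.1.1‖ ^ 2)
        ≤ ε / (C + 1) * (C * ‖u.1.1‖ ^ 2 + ‖u.1.1‖ ^ 2) := by gcongr
      _ = ε * ‖u.1.1‖ ^ 2 := by field_simp
  rw [energy_eq] at h1 ⊢
  linarith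

end

end LiebThirring

namespace LiebThirring

noncomputable section

variable {d : ℕ} {p γ : ℝ}

/-! ### Levels, Riesz sums and the best constant -/

theorem HasNegSubspace.exists_ne_zero {V : Space d → ℝ} {j : ℕ} {t : ℝ} (hj : 1 ≤ j)
    (h : HasNegSubspace V j t) : ∃ u : H1 d, 0 < ‖u.1.1‖ ∧ energy V u ≤ -t * ‖u.1.1‖ ^ 2 := by
  obtain ⟨E, hE, hneg⟩ := h
  have hne : E ≠ ⊥ := by
    rintro rfl
    rw [finrank_bot] at hE
    omega
  obtain ⟨u, huE, hu0⟩ := Submodule.exists_mem_ne_zero_of_ne_bot hne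
  exact ⟨u, lt_of_le_of_ne (norm_nonneg _) fun h0 => hu0 (H1.eq_zero_of_norm_eq_zero h0.symm),
    hneg u huE⟩

/-- A form bound with constant 1 in front of the gradient bounds the energy below. It is used to
show that the best constant is finite. -/
theorem exists_abs_level_le (hd : 1 ≤ d) (hp : 1 < p) (hpd : d < 2 * p) {m : ℝ} (hm : 0 ≤ m) :
    ∃ C : ℝ, ∀ V : Space d → ℝ, IsPot p V →
      eLpNorm V (ENNReal.ofReal p) volume ≤ ENNReal.ofReal m → ∀ j, 1 ≤ j →
        (level V j).abs ≤ ENNReal.ofReal C := by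
  obtain ⟨C, hC, h⟩ := abs_pot_le (d := d) hp hpd hm one_pos
  refine ⟨C + 1, fun V hV hVm j hj => ?_⟩
  by_contra! hlt
  obtain ⟨u, hu, hE⟩ := (hasNegSubspace_of_lt_abs_level hd hV.1 hlt).exists_ne_zero hj
  have h1 := (le_abs_self _).trans (h V hV.2.1 hVm u)
  rw [energy_eq] at hE
  have : 0 < ‖u.1.1‖ ^ 2 := by positivity
  linarith

theorem abs_level_le_of_le (hd : 1 ≤ d) {V : Space d → ℝ} (hV : 0 ≤ᵐ[volume] V) {j k : ℕ}
    (hjk : j ≤ k) : (level V k).abs ≤ (level V j).abs := by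
  by_contra! hlt
  obtain ⟨t, ht0, h1, h2⟩ := ENNReal.lt_iff_exists_real_btwn.1 hlt
  have h3 := ofReal_le_abs_level ht0
    ((hasNegSubspace_of_lt_abs_level hd hV h2).mono_dim hjk)
  exact absurd (h1.trans_le h3) (lt_irrefl _)

theorem abs_level_eq_zero_of_ae_eq_zero (hd : 1 ≤ d) {V : Space d → ℝ} (hV : V =ᵐ[volume] 0)
    {j : ℕ} (hj : 1 ≤ j) : (level V j).abs = 0 := by
  by_contra hne
  obtain ⟨t, ht0, h1, h2⟩ := ENNReal.lt_iff_exists_real_btwn.1 (pos_iff_ne_zero.2 hne)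
  obtain ⟨u, hu, hE⟩ := (hasNegSubspace_of_lt_abs_level hd
    (hV.mono fun x hx => by rw [hx]) h2).exists_ne_zero hj
  have h3 : pot V u = 0 := by
    refine integral_eq_zero_of_ae ?_
    filter_upwards [hV] with x hx
    simp [hx]
  rw [energy_eq, h3] at hE
  have h4 := gradSq_nonneg u
  have h5 : 0 < t := by simpa using h1
  have : 0 < t * ‖u.1.1‖ ^ 2 := by positivity
  linarith

theorem mass_eq_powInt (γ : ℝ) (V : Space d → ℝ) : mass γ V = powInt (γ + d / 2) V := rfl

theorem powInt_eq_zero_iff (hp : 0 < p) {V : Space d → ℝ} (hV : IsPot p V) :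
    powInt p V = 0 ↔ V =ᵐ[volume] 0 := by
  rw [← eLpNorm_rpow_eq_powInt hp hV.1, ENNReal.rpow_eq_zero_iff_of_pos hp,
    eLpNorm_eq_zero_iff hV.2.1 (by simpa using hp)]

theorem rieszSum_succ (γ : ℝ) (N : ℕ) (V : Space d → ℝ) :
    rieszSum γ (N + 1) V = rieszSum γ N V + (level V (N + 1)).abs ^ γ := by
  unfold rieszSum
  rw [Finset.sum_Icc_succ_top (by omega)]

theorem rieszSum_mono (γ : ℝ) (V : Space d → ℝ) : Monotone fun N => rieszSum γ N V :=
  monotone_nat_of_le_succ fun N => by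
    rw [rieszSum_succ]
    exact le_self_add

theorem bestConst_mono (d : ℕ) (γ : ℝ) : Monotone (bestConst d γ) := fun _ _ hMN =>
  iSup₂_mono fun V _ => iSup_mono fun _ => ENNReal.div_le_div_right (rieszSum_mono γ V hMN) _

theorem rieszSum_le_bestConst_mul (hd : 1 ≤ d) (hγ : 0 < γ) (N : ℕ) {V : Space d → ℝ}
    (hV : IsPot (γ + d / 2) V) : rieszSum γ N V ≤ bestConst d γ N * powInt (γ + d / 2) V := by
  have hp : 0 < γ + (d : ℝ) / 2 := by positivity
  by_cases h0 : V =ᵐ[volume] 0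
  · have h1 : rieszSum γ N V = 0 := by
      refine Finset.sum_eq_zero fun j hj => ?_
      rw [abs_level_eq_zero_of_ae_eq_zero hd h0 (Finset.mem_Icc.1 hj).1, ENNReal.zero_rpow_of_pos hγ]
    rw [h1]
    exact zero_le
  · have h1 : powInt (γ + d / 2) V ≠ 0 := fun h => h0 ((powInt_eq_zero_iff hp hV).1 h)
    rw [← ENNReal.div_le_iff h1 (hV.powInt_lt_top hp).ne]
    exact le_iSup₂_of_le V hV (le_iSup_of_le h0 le_rfl)

theorem bestConst_zero (d : ℕ) (γ : ℝ) : bestConst d γ 0 = 0 := by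
  unfold bestConst rieszSum
  simp

/-- A constant well on the support of a bump, with depth one above the Rayleigh quotient of its
kinetic energy, has energy -‖u‖² at that bump. -/
theorem bestConst_pos (hd : 1 ≤ d) (hγ : 0 < γ) {N : ℕ} (hN : 1 ≤ N) : 0 < bestConst d γ N := by
  have hp : 0 < γ + (d : ℝ) / 2 := by positivity
  set u := bumpH1 d one_pos with hu
  set S := Metric.closedBall (0 : Space d) (2 * 1) with hS
  have hSm : MeasurableSet S := Metric.isClosed_closedBall.measurableSet
  have hu0 : 0 < ‖u.1.1‖ ^ 2 := by
    refine lt_of_lt_of_le ?_ (bumpH1_norm_sq_ge (d := d) one_pos)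
    have := ENNReal.toReal_pos (Metric.measure_closedBall_pos volume (0 : Space d) one_pos).ne'
      measure_closedBall_lt_top.ne
    positivity
  have hg := gradSq_nonneg u
  set c : ℝ := gradSq u / ‖u.1.1‖ ^ 2 + 1 with hc
  have hc0 : 0 < c := by positivity
  set V : Space d → ℝ := S.indicator fun _ => c with hV
  have hVp : IsPot (γ + d / 2) V := by
    refine ⟨ae_of_all _ fun x => Set.indicator_apply_nonneg fun _ => hc0.le, ?_⟩
    exact memLp_indicator_const _ hSm _ (Or.inr measure_closedBall_lt_top.ne)
  have hpot : pot V u = c * ‖u.1.1‖ ^ 2 := by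
    rw [← integral_norm_sq, ← integral_const_mul]
    refine integral_congr_ae ?_
    filter_upwards [coeFn_testH1 (contDiff_innerCut (0 : Space d) 1)
      (hasCompactSupport_innerCut 0 one_pos)] with x hx
    by_cases hxS : x ∈ S
    · rw [hV, Set.indicator_of_mem hxS]
    · have h1 : u.1.1 x = 0 := by
        refine hx.trans ?_
        rw [innerCut_eq_zero one_pos]
        · simp
        · rw [hS, mem_closedBall_iff_norm, not_le] at hxS
          exact hxS.le
      rw [h1]
      simp
  have hneg : HasNegSubspace V 1 1 := by
    have hw0 : u ≠ 0 := by
      intro h0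
      rw [h0] at hu0
      simp at hu0
    refine ⟨ℂ ∙ u, finrank_span_singleton hw0, fun v hv => ?_⟩
    obtain ⟨z, rfl⟩ := Submodule.mem_span_singleton.1 hv
    rw [energy_smul, Submodule.coe_smul, Prod.smul_fst, norm_smul, mul_pow, mul_left_comm]
    refine mul_le_mul_of_nonneg_left ?_ (by positivity)
    rw [energy_eq, hpot, hc, add_mul, div_mul_cancel₀ _ hu0.ne']
    linarith
  have h1 := ofReal_le_abs_level zero_le_one hneg
  have h2 : 0 < rieszSum γ N V := by
    refine lt_of_lt_of_le ?_ (rieszSum_mono γ V hN)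
    change 0 < rieszSum γ 1 V
    unfold rieszSum
    rw [Finset.Icc_self, Finset.sum_singleton]
    refine ENNReal.rpow_pos_of_nonneg ?_ hγ.le
    exact lt_of_lt_of_le (by simp) h1
  by_contra! h0
  have h3 := rieszSum_le_bestConst_mul hd hγ N hVp
  rw [nonpos_iff_eq_zero.1 h0, zero_mul] at h3
  exact absurd (h2.trans_le h3) (lt_irrefl _)

/-- A potential which is optimal for fewer levels, with the same best constant, is optimal for all
levels, and has no further negative level. -/
theorem IsMaximizer.of_bestConst_eq (hd : 1 ≤ d) (hγ : 0 < γ) {M N : ℕ} (hMN : M ≤ N)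
    {W : Space d → ℝ} (hW : IsMaximizer γ M W) (hL : bestConst d γ M = bestConst d γ N)
    (hfin : bestConst d γ N ≠ ⊤) :
    IsMaximizer γ N W ∧ (M < N → level W (M + 1) = 0) := by
  have hp : 0 < γ + (d : ℝ) / 2 := by positivity
  obtain ⟨hWp, hW0, hWe⟩ := hW
  have hm0 : powInt (γ + d / 2) W ≠ 0 := fun h => hW0 ((powInt_eq_zero_iff hp hWp).1 h)
  have hmt : powInt (γ + d / 2) W ≠ ⊤ := (IsPot.powInt_lt_top hp hWp).ne
  have h1 : rieszSum γ M W = bestConst d γ N * powInt (γ + d / 2) W := by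
    rw [← hL, ← hWe, mass_eq_powInt, ENNReal.div_mul_cancel hm0 hmt]
  have h2 : rieszSum γ N W = bestConst d γ N * powInt (γ + d / 2) W :=
    le_antisymm (rieszSum_le_bestConst_mul hd hγ N hWp) (h1 ▸ rieszSum_mono γ W hMN)
  refine ⟨⟨hWp, hW0, ?_⟩, fun hlt => ?_⟩
  · rw [h2, mass_eq_powInt, ENNReal.mul_div_cancel_right hm0 hmt]
  · have h3 : rieszSum γ (M + 1) W ≤ rieszSum γ M W := by
      rw [h1, ← h2]
      exact rieszSum_mono γ W hlt
    rw [rieszSum_succ] at h3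
    have h4 : rieszSum γ M W ≠ ⊤ := by
      rw [h1]
      exact ENNReal.mul_ne_top hfin hmt
    -- The Riesz sums of orders M and N coincide and are finite, so the added term can be cancelled.
    have h5 : (level W (M + 1)).abs ^ γ = 0 := by
      have h6 : rieszSum γ M W + (level W (M + 1)).abs ^ γ ≤ rieszSum γ M W + 0 := by simpa using h3
      exact nonpos_iff_eq_zero.1 ((ENNReal.add_le_add_iff_left h4).1 h6)
    rw [ENNReal.rpow_eq_zero_iff_of_pos hγ, EReal.abs_eq_zero_iff] at h5
    exact h5

end

end LiebThirring

namespace LiebThirring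

noncomputable section

variable {d : ℕ} {p γ : ℝ}

/-! ### Extraction of one bubble -/

theorem IsPot.translate {V : Space d → ℝ} (hV : IsPot p V) (a : Space d) :
    IsPot p fun y => V (y + a) :=
  ⟨(measurePreserving_add_right volume a).quasiMeasurePreserving.ae hV.1,
    hV.2.comp_measurePreserving (measurePreserving_add_right volume a)⟩

theorem powInt_translate (p : ℝ) (V : Space d → ℝ) (a : Space d) :
    powInt p (fun y => V (y + a)) = powInt p V :=
  lintegral_add_right_eq_self (fun y => ENNReal.ofReal (V y) ^ p) a

theorem powInt_indicator (hp : 0 < p) (V : Space d → ℝ) {S : Set (Space d)}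
    (hS : MeasurableSet S) : powInt p (S.indicator V) = ∫⁻ x in S, ENNReal.ofReal (V x) ^ p := by
  rw [← lintegral_indicator hS]
  refine lintegral_congr fun x => ?_
  by_cases hx : x ∈ S
  · simp [hx]
  · simp [hx, ENNReal.zero_rpow_of_pos hp]

theorem powInt_indicator_add_compl (hp : 0 < p) (V : Space d → ℝ) {S : Set (Space d)}
    (hS : MeasurableSet S) :
    powInt p (S.indicator V) + powInt p (Sᶜ.indicator V) = powInt p V := by
  rw [powInt_indicator hp V hS, powInt_indicator hp V hS.compl]
  exact lintegral_add_compl _ hS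

theorem abs_level_translate_le (hd : 1 ≤ d) {V : Space d → ℝ} (hV : 0 ≤ᵐ[volume] V)
    (a : Space d) (j : ℕ) : (level V j).abs ≤ (level (fun y => V (y + a)) j).abs := by
  by_contra! hlt
  obtain ⟨t, ht0, h1, h2⟩ := ENNReal.lt_iff_exists_real_btwn.1 hlt
  have h3 := ofReal_le_abs_level ht0 ((hasNegSubspace_of_lt_abs_level hd hV h2).shift a)
  exact absurd (h1.trans_le h3) (lt_irrefl _)

theorem abs_level_translate (hd : 1 ≤ d) {V : Space d → ℝ} (hV : IsPot p V)
    (a : Space d) (j : ℕ) : (level (fun y => V (y + a)) j).abs = (level V j).abs := by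
  refine le_antisymm ?_ (abs_level_translate_le hd hV.1 a j)
  have h := abs_level_translate_le hd (hV.translate a).1 (-a) j
  simpa only [neg_add_cancel_right] using h

theorem rieszSum_translate (hd : 1 ≤ d) (γ : ℝ) (N : ℕ) {V : Space d → ℝ} (hV : IsPot p V)
    (a : Space d) : rieszSum γ N (fun y => V (y + a)) = rieszSum γ N V :=
  Finset.sum_congr rfl fun j _ => by rw [abs_level_translate hd hV]

theorem rieszSum_le_card_mul (hd : 1 ≤ d) (hγ : 0 < γ) (N : ℕ) {V : Space d → ℝ}
    (hV : 0 ≤ᵐ[volume] V) : rieszSum γ N V ≤ N * (level V 1).abs ^ γ := by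
  unfold rieszSum
  refine (Finset.sum_le_card_nsmul _ _ _ fun j hj => ENNReal.rpow_le_rpow
    (abs_level_le_of_le hd hV (Finset.mem_Icc.1 hj).1) hγ.le).trans_eq ?_
  rw [Nat.card_Icc, nsmul_eq_mul, Nat.add_sub_cancel]

theorem exists_pos_mul_rpow_lt (hγ : 0 < γ) (N : ℕ) {L : ℝ≥0∞} (hL : 0 < L) :
    ∃ t : ℝ, 0 < t ∧ N * ENNReal.ofReal t ^ γ < L := by
  have h1 : Tendsto (fun t : ℝ => (N : ℝ≥0∞) * ENNReal.ofReal t ^ γ) (𝓝[>] 0) (𝓝 0) := by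
    have h2 : Tendsto (fun t : ℝ => ENNReal.ofReal t ^ γ) (𝓝 0) (𝓝 0) := by
      have h3 := (ENNReal.continuous_rpow_const (y := γ)).comp ENNReal.continuous_ofReal
      have h4 := h3.tendsto 0
      rwa [Function.comp_apply, ENNReal.ofReal_zero, ENNReal.zero_rpow_of_pos hγ] at h4
    have h5 := ENNReal.Tendsto.const_mul (a := (N : ℝ≥0∞)) h2 (Or.inr (ENNReal.natCast_ne_top N))
    rw [mul_zero] at h5
    exact h5.mono_left nhdsWithin_le_nhds
  obtain ⟨t, ht, ht0⟩ := ((h1.eventually_lt_const hL).and self_mem_nhdsWithin).exists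
  exact ⟨t, ht0, ht⟩

theorem WeakTo.powInt_le_of_forall (hp : 1 < p) {U : ℕ → Space d → ℝ} {W : Space d → ℝ}
    (hU : ∀ n, IsPot p (U n)) (hW : IsPot p W) (h : WeakTo U W) {m : ℝ} (hm : 0 ≤ m)
    (hUm : ∀ n, powInt p (U n) ≤ ENNReal.ofReal m) : powInt p W ≤ ENNReal.ofReal m :=
  h.powInt_le hp (fun n => (hU n).1) (fun n => (hU n).locallyIntegrable hp.le) hW.1
    (hW.locallyIntegrable hp.le) hm (Eventually.frequently (Eventually.of_forall hUm))

/-- A sequence whose Riesz sums do not vanish has, up to translations and extraction, a nonzero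
weak limit. -/
theorem exists_profile (hd : 1 ≤ d) (hγ : 0 < γ) (hp : 1 < p) (hpd : d < 2 * p) {N : ℕ}
    {V : ℕ → Space d → ℝ} (hV : ∀ n, IsPot p (V n)) {m : ℝ} (hm : 0 ≤ m)
    (hVm : ∀ n, powInt p (V n) ≤ ENNReal.ofReal m) {L : ℝ≥0∞} (hL : 0 < L)
    (hS : Tendsto (fun n => rieszSum γ N (V n)) atTop (𝓝 L)) :
    ∃ (φ : ℕ → ℕ) (x : ℕ → Space d) (W : Space d → ℝ), StrictMono φ ∧ IsPot p W ∧
      ¬ W =ᵐ[volume] 0 ∧ WeakTo (fun n y => V (φ n) (y + x n)) W := by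
  have hp0 : 0 < p := by linarith
  -- All N levels are dominated by the first, so a Riesz sum above N t^γ forces |λ₁| > t.
  obtain ⟨t, ht, htL⟩ := exists_pos_mul_rpow_lt hγ N hL
  obtain ⟨n₀, hn₀⟩ := eventually_atTop.1 (hS.eventually_const_lt htL)
  have hneg : ∀ n, HasNegSubspace (V (n + n₀)) 1 t := by
    intro n
    refine hasNegSubspace_of_lt_abs_level hd (hV _).1 ?_
    have h1 := (hn₀ (n + n₀) (by omega)).trans_le (rieszSum_le_card_mul hd hγ N (hV _).1)
    by_contra! hle
    exact absurd (h1.trans_le (mul_le_mul_right (ENNReal.rpow_le_rpow hle hγ.le) _)) (lt_irrefl _)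
  obtain ⟨R, hR, hloc⟩ := exists_localized (d := d) hp hpd (m := m ^ (1 / p))
    (Real.rpow_nonneg hm _) ht
  choose x hx using fun n => hloc (V (n + n₀)) (hV _)
    (eLpNorm_le_of_powInt_le hp0 (hV _).1 hm (hVm _)) (hneg n)
  have hUp : ∀ n, IsPot p fun y => V (n + n₀) (y + x n) := fun n => (hV _).translate _
  have hUm : ∀ n, powInt p (fun y => V (n + n₀) (y + x n)) ≤ ENNReal.ofReal m := fun n => by
    rw [powInt_translate]
    exact hVm _
  obtain ⟨φ, W, hφ, hW, hweak⟩ := exists_weakTo_subseq hp hUp hm hUm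
  refine ⟨fun n => φ n + n₀, fun n => x (φ n), W, fun i j hij => ?_, hW, ?_, hweak⟩
  · exact Nat.add_lt_add_right (hφ hij) n₀
  · intro hW0
    have hWm := hweak.powInt_le_of_forall hp (fun n => hUp _) hW hm (fun n => hUm _)
    -- The recentred ball carries a state of energy at most -t/2, so W inherits one at -t/4, which
    -- is impossible for W = 0.
    obtain ⟨n, hn⟩ := (hweak.eventually_hasNegSubspace hp hpd (fun n => hUp _) hW hm
      (fun n => hUm _) hWm (2 * R) (ε := t / 4) (by positivity)).exists
    have h1 := (hx (φ n)).shift (x (φ n))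
    have h2 : (fun y => (Metric.closedBall (x (φ n)) (2 * R)).indicator (V (φ n + n₀))
        (y + x (φ n))) = (Metric.closedBall 0 (2 * R)).indicator
          fun y => V (φ n + n₀) (y + x (φ n)) := by
      ext y
      have h3 : y + x (φ n) ∈ Metric.closedBall (x (φ n)) (2 * R) ↔
          y ∈ Metric.closedBall (0 : Space d) (2 * R) := by
        simp [dist_eq_norm]
      by_cases hy : y ∈ Metric.closedBall (0 : Space d) (2 * R)
      · rw [Set.indicator_of_mem hy, Set.indicator_of_mem (h3.2 hy)]
      · rw [Set.indicator_of_notMem hy, Set.indicator_of_notMem fun h => hy (h3.1 h)]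
    rw [h2] at h1
    have h4 := ofReal_le_abs_level (by linarith) (hn 1 (t / 2) (by positivity) h1)
    rw [abs_level_eq_zero_of_ae_eq_zero hd hW0 le_rfl] at h4
    have h5 : 0 < ENNReal.ofReal (t / 2 - t / 4) := ENNReal.ofReal_pos.2 (by linarith)
    exact absurd (h5.trans_le h4) (lt_irrefl _)

/-- The levels of a sequence which splits into a localized part and a remainder. -/
theorem level_limit_le (hd : 1 ≤ d) (hp : 1 < p) (hpd : d < 2 * p) {U : ℕ → Space d → ℝ}
    (hU : ∀ n, IsPot p (U n)) {W : Space d → ℝ} {r ε : ℕ → ℝ} (hr0 : ∀ n, 0 < r n)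
    (hr : Tendsto r atTop atTop) (hε : Tendsto ε atTop (𝓝 0))
    (hG : ∀ n j t, 0 ≤ t → HasNegSubspace ((Metric.closedBall 0 (2 * r n)).indicator (U n)) j t →
      HasNegSubspace W j (t - ε n)) {μ ν : ℕ → ℝ≥0∞}
    (hμ : ∀ j, Tendsto (fun n => (level (U n) j).abs) atTop (𝓝 (μ j)))
    (hν : ∀ j, Tendsto (fun n => (level ((Metric.closedBall 0 (r n))ᶜ.indicator (U n)) j).abs) atTop
      (𝓝 (ν j))) (a b : ℕ) : μ (a + b + 1) ≤ max (level W (a + 1)).abs (ν (b + 1)) := by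
  by_contra! hlt
  -- Two numbers s < t are inserted between the sides; for large n the cutting error and ε n both
  -- fit into the gap around their midpoint.
  obtain ⟨s, hs0, hs1, hs2⟩ := ENNReal.lt_iff_exists_real_btwn.1 hlt
  obtain ⟨t, ht0, ht1, ht2⟩ := ENNReal.lt_iff_exists_real_btwn.1 hs2
  have hst : s < t := (ENNReal.ofReal_lt_ofReal_iff_of_nonneg hs0).1 ht1
  have hκ : Tendsto (fun n => (s + t) / 2 + d * (cutConst d / r n) ^ 2) atTop
      (𝓝 ((s + t) / 2 + d * 0 ^ 2)) :=
    tendsto_const_nhds.add (((hr.const_div_atTop _).pow 2).const_mul _)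
  have hεl : Tendsto (fun n => (s + t) / 2 - ε n) atTop (𝓝 ((s + t) / 2 - 0)) :=
    tendsto_const_nhds.sub hε
  obtain ⟨n, h1, h2, h3, h4⟩ := (((hμ (a + b + 1)).eventually_const_lt ht2).and
    (((hν (b + 1)).eventually_lt_const ((le_max_right _ _).trans_lt hs1)).and
      ((hκ.eventually_lt_const (by norm_num; linarith : (s + t) / 2 + d * 0 ^ 2 < t)).and
        (hεl.eventually_const_lt (by linarith : s < (s + t) / 2 - 0))))).exists
  have hneg := hasNegSubspace_of_lt_abs_level hd (hU n).1 h1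
  rcases hneg.cut hp hpd (hU n) 0 (hr0 n) h3 with hA | hB
  · have h5 := ofReal_le_abs_level (by linarith) (hG n (a + 1) _ (by linarith) hA)
    have h6 := (ENNReal.ofReal_le_ofReal h4.le).trans h5
    exact absurd ((le_max_left _ _).trans_lt hs1) (not_lt.2 h6)
  · have h5 := ofReal_le_abs_level (by linarith) hB
    have h6 : ENNReal.ofReal s ≤ ENNReal.ofReal ((s + t) / 2) :=
      ENNReal.ofReal_le_ofReal (by linarith)
    exact absurd h2 (not_lt.2 (h6.trans h5))

/-- Distribution of levels obeying a Weyl-type inequality. -/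
theorem exists_sum_le_of_le_max {μ l ν : ℕ → ℝ≥0∞} (hγ : 0 ≤ γ)
    (h : ∀ a b, μ (a + b + 1) ≤ max (l (a + 1)) (ν (b + 1))) (N : ℕ) :
    ∃ a b, a + b = N ∧ ∑ j ∈ Finset.Icc 1 N, μ j ^ γ ≤
      ∑ j ∈ Finset.Icc 1 a, l j ^ γ + ∑ j ∈ Finset.Icc 1 b, ν j ^ γ := by
  induction N with
  | zero => exact ⟨0, 0, rfl, by simp⟩
  | succ N ih =>
    obtain ⟨a, b, hab, hle⟩ := ih
    have h1 := h a b
    rw [hab] at h1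
    -- Greedy choice: the next level is charged to whichever list has the larger next entry.
    rcases le_total (l (a + 1)) (ν (b + 1)) with h2 | h2
    · rw [max_eq_right h2] at h1
      refine ⟨a, b + 1, by omega, ?_⟩
      rw [Finset.sum_Icc_succ_top (by omega), Finset.sum_Icc_succ_top (by omega), ← add_assoc]
      exact add_le_add hle (ENNReal.rpow_le_rpow h1 hγ)
    · rw [max_eq_left h2] at h1
      refine ⟨a + 1, b, by omega, ?_⟩
      rw [Finset.sum_Icc_succ_top (by omega), Finset.sum_Icc_succ_top (by omega), add_right_comm]
      exact add_le_add hle (ENNReal.rpow_le_rpow h1 hγ)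

theorem tendsto_rieszSum (γ : ℝ) (N : ℕ) {U : ℕ → Space d → ℝ} {μ : ℕ → ℝ≥0∞}
    (h : ∀ j, Tendsto (fun n => (level (U n) j).abs) atTop (𝓝 (μ j))) :
    Tendsto (fun n => rieszSum γ N (U n)) atTop (𝓝 (∑ j ∈ Finset.Icc 1 N, μ j ^ γ)) :=
  tendsto_finsetSum _ fun j _ => (ENNReal.continuous_rpow_const.tendsto _).comp (h j)

/-- The chain of inequalities forcing optimality of both parts. -/
theorem splitting_eq {L La Lb m m₀ m₁ α s σ : ℝ≥0∞} (hL0 : L ≠ 0) (hLt : L ≠ ⊤) (hαt : α ≠ ⊤)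
    (hm₁t : m₁ ≠ ⊤) (hLa : La ≤ L) (hLb : Lb ≤ L) (hsum : α + m₁ = m) (hm₀ : m₀ ≤ α)
    (hs : s ≤ La * m₀) (hσ : σ ≤ Lb * m₁) (h : L * m ≤ s + σ) :
    α = m₀ ∧ s = La * m₀ ∧ σ = Lb * m₁ ∧ (m₀ ≠ 0 → La = L) ∧ (m₁ ≠ 0 → Lb = L) := by
  have hm₀t : m₀ ≠ ⊤ := (hm₀.trans_lt (lt_top_iff_ne_top.2 hαt)).ne
  have hs' : s ≤ L * α := hs.trans (mul_le_mul' hLa hm₀)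
  have hσ' : σ ≤ L * m₁ := hσ.trans (mul_le_mul' hLb le_rfl)
  rw [← hsum, mul_add] at h
  -- The bounds s ≤ Lα and σ ≤ L m₁ add up to Lm ≤ s + σ; finiteness allows each summand to be
  -- cancelled, so both are equalities.
  have h1 : L * α ≤ s :=
    (ENNReal.add_le_add_iff_right (ENNReal.mul_ne_top hLt hm₁t)).1 (h.trans (add_le_add le_rfl hσ'))
  have h2 : L * m₁ ≤ σ :=
    (ENNReal.add_le_add_iff_left (ENNReal.mul_ne_top hLt hαt)).1 (h.trans (add_le_add hs' le_rfl))
  have h3 : α = m₀ := by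
    refine le_antisymm ?_ hm₀
    exact (ENNReal.mul_le_mul_iff_right hL0 hLt).1
      ((h1.trans hs).trans (mul_le_mul' hLa le_rfl))
  subst h3
  have h4 : s = La * α := le_antisymm hs ((mul_le_mul' hLa le_rfl).trans h1)
  have h5 : σ = Lb * m₁ := le_antisymm hσ ((mul_le_mul' hLb le_rfl).trans h2)
  refine ⟨rfl, h4, h5, fun h0 => le_antisymm hLa ?_, fun h0 => le_antisymm hLb ?_⟩
  · rw [h4] at h1
    exact (ENNReal.mul_le_mul_iff_left h0 hαt).1 h1
  · rw [h5] at h2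
    exact (ENNReal.mul_le_mul_iff_left h0 hm₁t).1 h2

end

end LiebThirring

namespace LiebThirring

noncomputable section

variable {d : ℕ} {p γ : ℝ}

/-! ### Weak limits on growing balls and the one-bubble step -/

theorem WeakTo.subseq {U : ℕ → Space d → ℝ} {W : Space d → ℝ} (h : WeakTo U W) {φ : ℕ → ℕ}
    (hφ : Tendsto φ atTop atTop) : WeakTo (fun n => U (φ n)) W :=
  fun g hg hB hr => (h g hg hB hr).comp hφ

/-- Each test function has bounded support, which the growing balls eventually contain. -/
theorem WeakTo.indicator {U : ℕ → Space d → ℝ} {W : Space d → ℝ} (h : WeakTo U W) {r : ℕ → ℝ}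
    (hr : Tendsto r atTop atTop) :
    WeakTo (fun n => (Metric.closedBall 0 (r n)).indicator (U n)) W := by
  rintro g hg hB ⟨R, hR⟩
  refine (h g hg hB ⟨R, hR⟩).congr' ?_
  filter_upwards [hr.eventually_ge_atTop R] with n hn
  refine integral_congr_ae (ae_of_all _ fun x => ?_)
  by_cases hx : x ∈ Metric.closedBall (0 : Space d) (r n)
  · simp only [Set.indicator_of_mem hx]
  · have h0 : g x = 0 := hR x fun hxR => hx (Metric.closedBall_subset_closedBall hn hxR)
    simp [h0]

theorem WeakTo.powInt_le_of_tendsto (hp : 1 < p) {U : ℕ → Space d → ℝ} {W : Space d → ℝ}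
    (hU : ∀ n, IsPot p (U n)) (hW : IsPot p W) (h : WeakTo U W) {α : ℝ≥0∞}
    (hα : Tendsto (fun n => powInt p (U n)) atTop (𝓝 α)) : powInt p W ≤ α := by
  refine le_of_forall_gt_imp_ge_of_dense fun b hb => ?_
  obtain ⟨t, ht0, h1, h2⟩ := ENNReal.lt_iff_exists_real_btwn.1 hb
  refine le_trans ?_ h2.le
  exact h.powInt_le hp (fun n => (hU n).1) (fun n => (hU n).locallyIntegrable hp.le) hW.1
    (hW.locallyIntegrable hp.le) ht0
    ((hα.eventually_lt_const h1).mono fun n hn => hn.le).frequently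

/-- Extraction of one bubble from a maximizing sequence. -/
theorem exists_bubble (hd : 1 ≤ d) (hγ : 0 < γ) (hp : 1 < γ + d / 2) {N : ℕ} (hN : 1 ≤ N)
    {V : ℕ → Space d → ℝ} (hV : ∀ n, IsPot (γ + d / 2) (V n)) {m : ℝ≥0∞} (hm0 : m ≠ 0)
    (hmt : m ≠ ⊤) (hVm : Tendsto (fun n => powInt (γ + d / 2) (V n)) atTop (𝓝 m))
    (hS : Tendsto (fun n => rieszSum γ N (V n)) atTop (𝓝 (bestConst d γ N * m))) :
    bestConst d γ N ≠ ⊤ ∧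
    ∃ (φ : ℕ → ℕ) (x : ℕ → Space d) (r : ℕ → ℝ) (W : Space d → ℝ) (a b : ℕ), StrictMono φ ∧
      Tendsto r atTop atTop ∧ a + b = N ∧ 1 ≤ a ∧ bestConst d γ a = bestConst d γ N ∧
      IsMaximizer γ a W ∧
      Tendsto (fun n => eLpNorm (((Metric.closedBall 0 (r n)).indicator
        fun y => V (φ n) (y + x n)) - W) (ENNReal.ofReal (γ + d / 2)) volume) atTop (𝓝 0) ∧
      ∃ m₁ : ℝ≥0∞, m₁ ≠ ⊤ ∧ Tendsto (fun n => powInt (γ + d / 2)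
        ((Metric.closedBall 0 (r n))ᶜ.indicator fun y => V (φ n) (y + x n))) atTop (𝓝 m₁) ∧
      (b = 0 ∧ m₁ = 0 ∨ 1 ≤ b ∧ m₁ ≠ 0 ∧ bestConst d γ b = bestConst d γ N ∧
        Tendsto (fun n => rieszSum γ b ((Metric.closedBall 0 (r n))ᶜ.indicator
          fun y => V (φ n) (y + x n))) atTop (𝓝 (bestConst d γ b * m₁))) := by
  set p : ℝ := γ + d / 2 with hpdef
  have hp0 : 0 < p := by linarith
  have hpd : (d : ℝ) < 2 * p := by rw [hpdef]; linarith
  -- The mass only converges to m; dropping n₀ terms gives the uniform bound m + 1 needed for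
  -- compactness.
  obtain ⟨n₀, hn₀⟩ := eventually_atTop.1 (hVm.eventually_lt_const
    (ENNReal.lt_add_right hmt one_ne_zero))
  set M : ℝ := (m + 1).toReal with hM
  have hM0 : 0 ≤ M := ENNReal.toReal_nonneg
  have hMe : ENNReal.ofReal M = m + 1 := ENNReal.ofReal_toReal (by simp [hmt])
  have hVM : ∀ n, powInt p (V (n + n₀)) ≤ ENNReal.ofReal M := fun n => by
    rw [hMe]
    exact (hn₀ _ (by omega)).le
  have hL0 : bestConst d γ N ≠ 0 := (bestConst_pos hd hγ hN).ne'
  have hshift : Tendsto (fun n => n + n₀) atTop atTop := tendsto_add_atTop_nat n₀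
  have hLt : bestConst d γ N ≠ ⊤ := by
    obtain ⟨C, hC⟩ := exists_abs_level_le hd hp hpd (m := M ^ (1 / p)) (Real.rpow_nonneg hM0 _)
    have h1 : bestConst d γ N * m ≤ N * ENNReal.ofReal C ^ γ := by
      refine le_of_tendsto' (hS.comp hshift) fun n => ?_
      refine (rieszSum_le_card_mul hd hγ N (hV _).1).trans ?_
      gcongr
      exact hC _ (hV _) (eLpNorm_le_of_powInt_le hp0 (hV _).1 hM0 (hVM n)) 1 le_rfl
    intro htop
    rw [htop, ENNReal.top_mul hm0] at h1
    exact absurd h1 (not_le.2 (ENNReal.mul_lt_top (ENNReal.natCast_lt_top N)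
      (ENNReal.rpow_lt_top_of_nonneg hγ.le ENNReal.ofReal_ne_top)))
  refine ⟨hLt, ?_⟩
  obtain ⟨φ₁, x₁, W, hφ₁, hW, hW0, hweak₁⟩ := exists_profile hd hγ hp hpd
    (V := fun n => V (n + n₀)) (fun n => hV _) hM0 hVM
    (pos_iff_ne_zero.2 (mul_ne_zero hL0 hm0)) (hS.comp hshift)
  set U₁ : ℕ → Space d → ℝ := fun n y => V (φ₁ n + n₀) (y + x₁ n) with hU₁
  have hU₁p : ∀ n, IsPot p (U₁ n) := fun n => (hV _).translate _
  have hU₁m : ∀ n, powInt p (U₁ n) ≤ ENNReal.ofReal M := fun n =>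
    (powInt_translate p _ _).trans_le (hVM _)
  have hWm := hweak₁.powInt_le_of_forall hp hU₁p hW hM0 hU₁m
  -- Diagonal extraction fixing the rate of growth of the balls: along φ₂, the n-th potential
  -- transfers negative subspaces from the ball of radius 2(n + 1) to W with error 1/(n + 1).
  obtain ⟨φ₂, hφ₂, hG⟩ := extraction_forall_of_eventually'
    (P := fun k n => ∀ (j : ℕ) (t : ℝ), 0 ≤ t →
      HasNegSubspace ((Metric.closedBall 0 (2 * ((k : ℝ) + 1))).indicator (U₁ n)) j t →
        HasNegSubspace W j (t - 1 / ((k : ℝ) + 1)))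
    fun k => eventually_atTop.1 (hweak₁.eventually_hasNegSubspace hp hpd hU₁p hW hM0 hU₁m hWm _
      (by positivity))
  -- Levels and masses lie in the compact space [0, ∞], so one subsequence makes all of them
  -- converge at once without prior bounds.
  obtain ⟨⟨⟨μ, ν⟩, α, m₁⟩, φ₃, hφ₃, hlim⟩ := CompactSpace.tendsto_subseq
    (fun n : ℕ => (((fun j => (level (U₁ (φ₂ n)) j).abs,
      fun j => (level ((Metric.closedBall 0 ((n : ℝ) + 1))ᶜ.indicator (U₁ (φ₂ n))) j).abs),
      powInt p ((Metric.closedBall 0 ((n : ℝ) + 1)).indicator (U₁ (φ₂ n))),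
      powInt p ((Metric.closedBall 0 ((n : ℝ) + 1))ᶜ.indicator (U₁ (φ₂ n)))) :
        ((ℕ → ℝ≥0∞) × (ℕ → ℝ≥0∞)) × ℝ≥0∞ × ℝ≥0∞))
  obtain ⟨hlim1, hlim2⟩ := Prod.tendsto_iff _ _ |>.1 hlim
  obtain ⟨hμ, hν⟩ := Prod.tendsto_iff _ _ |>.1 hlim1
  obtain ⟨hα, hm₁⟩ := Prod.tendsto_iff _ _ |>.1 hlim2
  rw [tendsto_pi_nhds] at hμ hν
  set r : ℕ → ℝ := fun n => (φ₃ n : ℝ) + 1 with hr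
  have hr0 : ∀ n, 0 < r n := fun n => by positivity
  have hrt : Tendsto r atTop atTop :=
    tendsto_atTop_add_const_right _ _ (tendsto_natCast_atTop_atTop.comp hφ₃.tendsto_atTop)
  set U : ℕ → Space d → ℝ := fun n => U₁ (φ₂ (φ₃ n)) with hU
  have hUp : ∀ n, IsPot p (U n) := fun n => hU₁p _
  have hBm : ∀ s : ℝ, MeasurableSet (Metric.closedBall (0 : Space d) s) := fun s =>
    Metric.isClosed_closedBall.measurableSet
  have hεt : Tendsto (fun n => 1 / r n) atTop (𝓝 0) := hrt.const_div_atTop 1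
  have hmax := level_limit_le hd hp hpd hUp hr0 hrt hεt
    (fun n j t ht h => hG (φ₃ n) j t ht h) (μ := μ) (ν := ν) hμ hν
  obtain ⟨a, b, hab, hle⟩ := exists_sum_le_of_le_max (l := fun j => (level W j).abs)
    hγ.le hmax N
  set φ : ℕ → ℕ := fun n => φ₁ (φ₂ (φ₃ n)) + n₀ with hφ
  have hφmono : StrictMono φ := fun i j hij =>
    Nat.add_lt_add_right (hφ₁ (hφ₂ (hφ₃ hij))) n₀
  set x : ℕ → Space d := fun n => x₁ (φ₂ (φ₃ n)) with hx
  have hRU : Tendsto (fun n => rieszSum γ N (U n)) atTop (𝓝 (bestConst d γ N * m)) := by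
    refine (hS.comp hφmono.tendsto_atTop).congr fun n => ?_
    exact (rieszSum_translate hd γ N (hV (φ n)) (x n)).symm
  have hmU : Tendsto (fun n => powInt p (U n)) atTop (𝓝 m) := by
    refine (hVm.comp hφmono.tendsto_atTop).congr fun n => ?_
    exact (powInt_translate p (V (φ n)) (x n)).symm
  have hsum : α + m₁ = m := by
    refine tendsto_nhds_unique (hα.add hm₁) (hmU.congr fun n => ?_)
    exact (powInt_indicator_add_compl hp0 (U n) (hBm (r n))).symm
  have hαt : α ≠ ⊤ := fun h => hmt (by rw [← hsum, h, top_add])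
  have hm₁t : m₁ ≠ ⊤ := fun h => hmt (by rw [← hsum, h, add_top])
  have hAp : ∀ n, IsPot p ((Metric.closedBall 0 (r n)).indicator (U n)) := fun n =>
    (hUp n).indicator (hBm _)
  have hCp : ∀ n, IsPot p ((Metric.closedBall 0 (r n))ᶜ.indicator (U n)) := fun n =>
    (hUp n).indicator (hBm _).compl
  have hAweak : WeakTo (fun n => (Metric.closedBall 0 (r n)).indicator (U n)) W :=
    (hweak₁.subseq (hφ₂.comp hφ₃).tendsto_atTop).indicator hrt
  have hm₀ : powInt p W ≤ α := hAweak.powInt_le_of_tendsto hp hAp hW hα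
  have hσlim := tendsto_rieszSum γ b hν
  have hσ : ∑ j ∈ Finset.Icc 1 b, ν j ^ γ ≤ bestConst d γ b * m₁ := by
    refine le_of_tendsto_of_tendsto' hσlim
      (ENNReal.Tendsto.const_mul hm₁ (Or.inr ?_)) fun n => rieszSum_le_bestConst_mul hd hγ b (hCp n)
    exact ((bestConst_mono d γ (by omega : b ≤ N)).trans_lt (lt_top_iff_ne_top.2 hLt)).ne
  have hμN : bestConst d γ N * m = ∑ j ∈ Finset.Icc 1 N, μ j ^ γ :=
    tendsto_nhds_unique hRU (tendsto_rieszSum γ N hμ)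
  have hs : ∑ j ∈ Finset.Icc 1 a, (level W j).abs ^ γ ≤ bestConst d γ a * powInt p W :=
    rieszSum_le_bestConst_mul hd hγ a hW
  obtain ⟨hα0, hsa, hσb, hLa, hLb⟩ := splitting_eq hL0 hLt hαt hm₁t
    (bestConst_mono d γ (by omega : a ≤ N)) (bestConst_mono d γ (by omega : b ≤ N)) hsum hm₀ hs hσ
    (hμN.trans_le hle)
  have hWm0 : powInt p W ≠ 0 := fun h => hW0 ((powInt_eq_zero_iff hp0 hW).1 h)
  have hLa' := hLa hWm0
  have ha1 : 1 ≤ a := by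
    by_contra! h0
    rw [Nat.lt_one_iff.1 h0, bestConst_zero] at hLa'
    exact hL0 hLa'.symm
  have hWmax : IsMaximizer γ a W := by
    refine ⟨hW, hW0, ?_⟩
    have h1 : rieszSum γ a W = bestConst d γ a * powInt p W := hsa
    rw [h1, mass_eq_powInt, ENNReal.mul_div_cancel_right hWm0 (hW.powInt_lt_top hp0).ne]
  rw [hα0] at hα
  have hstrong := hAweak.tendsto_eLpNorm_sub hp hAp hW hα
  -- If no mass escapes, all N levels are assigned to W, whatever the greedy split was; it is
  -- optimal for N levels as well. Otherwise L^(b) = L > 0 gives b ≥ 1.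
  by_cases hm₁0 : m₁ = 0
  · refine ⟨φ, x, r, W, N, 0, hφmono, hrt, by omega, hN, rfl, ?_, hstrong, m₁, hm₁t, hm₁,
      Or.inl ⟨rfl, hm₁0⟩⟩
    exact (hWmax.of_bestConst_eq hd hγ (by omega) hLa' hLt).1
  · have hLb' := hLb hm₁0
    refine ⟨φ, x, r, W, a, b, hφmono, hrt, hab, ha1, hLa', hWmax, hstrong, m₁, hm₁t, hm₁,
      Or.inr ⟨?_, hm₁0, hLb', ?_⟩⟩
    · by_contra! h0
      rw [Nat.lt_one_iff.1 h0, bestConst_zero] at hLb'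
      exact hL0 hLb'.symm
    · rw [← hσb]
      exact hσlim

end

end LiebThirring

namespace LiebThirring

noncomputable section

variable {d : ℕ} {p γ : ℝ}

/-! ### The full bubble decomposition -/

theorem eLpNorm_translate (p : ℝ) {F : Space d → ℝ} (hF : AEStronglyMeasurable F volume)
    (a : Space d) : eLpNorm (fun y => F (y - a)) (ENNReal.ofReal p) volume =
      eLpNorm F (ENNReal.ofReal p) volume :=
  eLpNorm_comp_measurePreserving hF (measurePreserving_sub_right volume a)

theorem IsPot.translate_sub {V : Space d → ℝ} (hV : IsPot p V) (a : Space d) :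
    IsPot p fun y => V (y - a) := by
  simpa [sub_eq_add_neg] using hV.translate (-a)

theorem exists_closedBall_eLpNorm_ne_zero (hp : 0 < p) {W : Space d → ℝ} (hW : IsPot p W)
    (hW0 : ¬ W =ᵐ[volume] 0) :
    ∃ R : ℝ, eLpNorm ((Metric.closedBall 0 R).indicator W) (ENNReal.ofReal p) volume ≠ 0 := by
  by_contra! h
  refine hW0 ?_
  have h1 : ∀ᵐ y, ∀ j : ℕ, (Metric.closedBall (0 : Space d) j).indicator W y = 0 := by
    rw [ae_all_iff]
    intro j
    exact (eLpNorm_eq_zero_iff (hW.2.1.indicator Metric.isClosed_closedBall.measurableSet)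
      (by simpa using hp)).1 (h j)
  filter_upwards [h1] with y hy
  obtain ⟨j, hj⟩ := exists_nat_ge ‖y‖
  have h2 := hy j
  rwa [Set.indicator_of_mem (by simpa using hj)] at h2

/-- Bubbles approximating functions which vanish on growing balls move off to infinity. -/
theorem tendsto_norm_center (hp : 0 < p) {V : ℕ → Space d → ℝ} {r : ℕ → ℝ}
    (hr : Tendsto r atTop atTop) (hV0 : ∀ n, ∀ y ∈ Metric.closedBall (0 : Space d) (r n), V n y = 0)
    {K : ℕ} {W : Fin K → Space d → ℝ} {x : Fin K → ℕ → Space d} (hW : ∀ k, IsPot p (W k))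
    (h : Tendsto (fun n => eLpNorm (fun y => V n y - ∑ k, W k (y - x k n)) (ENNReal.ofReal p)
      volume) atTop (𝓝 0)) (k : Fin K) (hk : ¬ W k =ᵐ[volume] 0) :
    Tendsto (fun n => ‖x k n‖) atTop atTop := by
  -- If the centre stayed bounded along a subsequence, a fixed nonzero part of the bubble would lie
  -- where V_n vanishes. As all bubbles are nonnegative, the others cannot cancel it there.
  by_contra hcon
  rw [tendsto_atTop] at hcon
  push Not at hcon
  obtain ⟨B, hB⟩ := hcon
  obtain ⟨R, hR⟩ := exists_closedBall_eLpNorm_ne_zero hp (hW k) hk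
  obtain ⟨n, hn1, hn2, hn3⟩ := (hB.and_eventually ((hr.eventually_ge_atTop (R + B)).and
    (h.eventually_lt_const (pos_iff_ne_zero.2 hR)))).exists
  refine absurd hn3 (not_lt.2 ?_)
  rw [← eLpNorm_translate p ((hW k).indicator Metric.isClosed_closedBall.measurableSet).2.1 (x k n)]
  have hnn : ∀ᵐ y, ∀ j, 0 ≤ W j (y - x j n) := by
    rw [ae_all_iff]
    exact fun j => ((hW j).translate_sub (x j n)).1
  refine eLpNorm_mono_ae ?_
  filter_upwards [hnn] with y hy
  by_cases hyR : y - x k n ∈ Metric.closedBall (0 : Space d) R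
  · rw [Set.indicator_of_mem hyR, hV0 n y, zero_sub, norm_neg, Real.norm_of_nonneg (hy k),
      Real.norm_of_nonneg (Finset.sum_nonneg fun j _ => hy j)]
    · exact Finset.single_le_sum (f := fun j => W j (y - x j n)) (fun j _ => hy j)
        (Finset.mem_univ k)
    · rw [mem_closedBall_zero_iff] at hyR ⊢
      have h1 : ‖y‖ ≤ ‖y - x k n‖ + ‖x k n‖ := by
        simpa using norm_add_le (y - x k n) (x k n)
      linarith
  · rw [Set.indicator_of_notMem hyR, norm_zero]
    exact norm_nonneg _

/-- Adding the bubble centred at `a` to a decomposition of the remainder. -/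
theorem eLpNorm_sub_cons_le (hp : 1 ≤ p) {V : Space d → ℝ} (hV : IsPot p V) (a : Space d) (r : ℝ)
    {W : Space d → ℝ} (hW : IsPot p W) {K : ℕ} {W' : Fin K → Space d → ℝ} {x' : Fin K → Space d}
    (hW' : ∀ k, IsPot p (W' k)) :
    eLpNorm (fun y => V y - ∑ k, Fin.cons (α := fun _ => Space d → ℝ) W W' k
        (y - Fin.cons (α := fun _ => Space d) a (fun j => a + x' j) k)) (ENNReal.ofReal p) volume ≤
      eLpNorm (((Metric.closedBall 0 r).indicator fun y => V (y + a)) - W) (ENNReal.ofReal p)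
        volume +
      eLpNorm (fun y => (Metric.closedBall 0 r)ᶜ.indicator (fun y => V (y + a)) y -
        ∑ k, W' k (y - x' k)) (ENNReal.ofReal p) volume := by
  have hBm : MeasurableSet (Metric.closedBall (0 : Space d) r) :=
    Metric.isClosed_closedBall.measurableSet
  have h1 : AEStronglyMeasurable
      (((Metric.closedBall 0 r).indicator fun y => V (y + a)) - W) volume :=
    (((hV.translate a).indicator hBm).2.sub hW.2).1
  have h2 : AEStronglyMeasurable (fun y => (Metric.closedBall 0 r)ᶜ.indicator
      (fun y => V (y + a)) y - ∑ k, W' k (y - x' k)) volume := by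
    refine (((hV.translate a).indicator hBm.compl).2.1).sub ?_
    exact Finset.aestronglyMeasurable_fun_sum _ fun k _ => ((hW' k).translate_sub (x' k)).2.1
  refine le_trans (le_of_eq ?_) (eLpNorm_add_le h1 h2 (ENNReal.one_le_ofReal.2 hp))
  rw [← eLpNorm_translate p (h1.add h2) a]
  congr 1
  ext y
  rw [Fin.sum_univ_succ]
  simp only [Fin.cons_zero, Fin.cons_succ, Pi.add_apply, Pi.sub_apply]
  have h3 : (Metric.closedBall 0 r).indicator (fun y => V (y + a)) (y - a) +
      (Metric.closedBall 0 r)ᶜ.indicator (fun y => V (y + a)) (y - a) = V y := by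
    have := congrFun (Set.indicator_self_add_compl (Metric.closedBall (0 : Space d) r)
      fun y => V (y + a)) (y - a)
    rw [Pi.add_apply] at this
    rw [this, sub_add_cancel]
  rw [← h3]
  simp only [sub_sub]
  ring

/-- The bubble decomposition of maximizing sequences of arbitrary mass. -/
theorem exists_bubbles (hd : 1 ≤ d) (hγ : 0 < γ) (hp : 1 < γ + d / 2) (N : ℕ) (hN : 1 ≤ N)
    {V : ℕ → Space d → ℝ} (hV : ∀ n, IsPot (γ + d / 2) (V n)) {m : ℝ≥0∞} (hm0 : m ≠ 0)
    (hmt : m ≠ ⊤) (hVm : Tendsto (fun n => powInt (γ + d / 2) (V n)) atTop (𝓝 m))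
    (hS : Tendsto (fun n => rieszSum γ N (V n)) atTop (𝓝 (bestConst d γ N * m))) :
    ∃ (K : ℕ) (M : Fin K → ℕ) (W : Fin K → Space d → ℝ) (x : Fin K → ℕ → Space d) (φ : ℕ → ℕ),
      StrictMono φ ∧ 1 ≤ K ∧ (∀ k, 1 ≤ M k) ∧ ∑ k, M k = N ∧
      (∀ k, bestConst d γ (M k) = bestConst d γ N) ∧ (∀ k, IsMaximizer γ (M k) (W k)) ∧
      (∀ k k', k ≠ k' → Tendsto (fun n => ‖x k n - x k' n‖) atTop atTop) ∧
      Tendsto (fun n => eLpNorm (fun y => V (φ n) y - ∑ k, W k (y - x k n))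
        (ENNReal.ofReal (γ + d / 2)) volume) atTop (𝓝 0) := by
  induction N using Nat.strong_induction_on generalizing V m with
  | _ N ih =>
    have hp0 : 0 < γ + (d : ℝ) / 2 := by linarith
    obtain ⟨-, φ, x, r, W, a, b, hφ, hr, hab, ha, hLa, hW, hstrong, m₁, hm₁t, hm₁, hcase⟩ :=
      exists_bubble hd hγ hp hN hV hm0 hmt hVm hS
    set U : ℕ → Space d → ℝ := fun n => (Metric.closedBall 0 (r n))ᶜ.indicator
      fun y => V (φ n) (y + x n) with hU
    have hUp : ∀ n, IsPot (γ + d / 2) (U n) := fun n =>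
      ((hV _).translate _).indicator Metric.isClosed_closedBall.measurableSet.compl
    have hrest : ∃ (K : ℕ) (M : Fin K → ℕ) (W' : Fin K → Space d → ℝ) (x' : Fin K → ℕ → Space d)
        (φ' : ℕ → ℕ), StrictMono φ' ∧ (∀ k, 1 ≤ M k) ∧ ∑ k, M k = b ∧
        (∀ k, bestConst d γ (M k) = bestConst d γ N) ∧ (∀ k, IsMaximizer γ (M k) (W' k)) ∧
        (∀ k k', k ≠ k' → Tendsto (fun n => ‖x' k n - x' k' n‖) atTop atTop) ∧
        Tendsto (fun n => eLpNorm (fun y => U (φ' n) y - ∑ k, W' k (y - x' k n))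
          (ENNReal.ofReal (γ + d / 2)) volume) atTop (𝓝 0) := by
      rcases hcase with ⟨hb, h0⟩ | ⟨hb, h0, hLb, hSb⟩
      · refine ⟨0, Fin.elim0, Fin.elim0, Fin.elim0, id, strictMono_id, fun k => k.elim0,
          by simp [hb], fun k => k.elim0, fun k => k.elim0, fun k => k.elim0, ?_⟩
        rw [h0] at hm₁
        have h1 := (ENNReal.continuous_rpow_const (y := 1 / (γ + (d : ℝ) / 2))).tendsto 0 |>.comp hm₁
        rw [ENNReal.zero_rpow_of_pos (by positivity)] at h1
        refine h1.congr fun n => ?_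
        rw [Function.comp_apply, ← eLpNorm_rpow_eq_powInt hp0 (hUp n).1, ← ENNReal.rpow_mul,
          mul_one_div_cancel hp0.ne', ENNReal.rpow_one]
        simp [hU]
      · obtain ⟨K, M, W', x', φ', h1, -, h2, h3, h4, h5, h6, h7⟩ :=
          -- The induction descends because a ≥ 1 gives b < N.
          ih b (by omega) hb hUp h0 hm₁t hm₁ hSb
        exact ⟨K, M, W', x', φ', h1, h2, h3, fun k => (h4 k).trans hLb, h5, h6, h7⟩
    obtain ⟨K, M, W', x', φ', hφ', hM1, hMs, hL, hW', hdiv, hconv⟩ := hrest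
    -- In coordinates recentred at the first bubble, separation from it means that the remaining
    -- centres go to infinity.
    have hx' : ∀ k, Tendsto (fun n => ‖x' k n‖) atTop atTop := fun k =>
      tendsto_norm_center hp0 (V := fun n => U (φ' n)) (hr.comp hφ'.tendsto_atTop)
        (fun n y hy => Set.indicator_of_notMem (Set.notMem_compl_iff.2 hy) _) (fun k => (hW' k).1) hconv k
        (hW' k).2.1
    refine ⟨K + 1, Fin.cons a M, Fin.cons W W',
      fun k n => Fin.cons (α := fun _ => Space d) (x (φ' n)) (fun j => x (φ' n) + x' j n) k,
      fun n => φ (φ' n), hφ.comp hφ', by omega, ?_, ?_, ?_, ?_, ?_, ?_⟩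
    · exact Fin.cases ha hM1
    · rw [Fin.sum_univ_succ]
      simp only [Fin.cons_zero, Fin.cons_succ]
      omega
    · exact Fin.cases hLa hL
    · exact Fin.cases hW hW'
    · refine Fin.cases (Fin.cases (fun h => absurd rfl h) fun k' _ => ?_) fun k => Fin.cases
        (fun _ => ?_) fun k' hkk' => ?_
      · simp only [Fin.cons_zero, Fin.cons_succ, sub_add_cancel_left, norm_neg]
        exact hx' k'
      · simp only [Fin.cons_zero, Fin.cons_succ, add_sub_cancel_left]
        exact hx' k
      · simp only [Fin.cons_succ, add_sub_add_left_eq_sub]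
        exact hdiv k k' fun h => hkk' (by rw [h])
    · have h1 := (hstrong.comp hφ'.tendsto_atTop).add hconv
      rw [add_zero] at h1
      exact tendsto_of_tendsto_of_tendsto_of_le_of_le tendsto_const_nhds h1 (fun _ => zero_le)
        fun n => eLpNorm_sub_cons_le hp.le (hV _) (x (φ' n)) (r (φ' n)) hW.1 fun k => (hW' k).1

/-- A left inverse of a strictly increasing sequence of indices, tending to infinity. -/
theorem exists_tendsto_leftInverse {φ : ℕ → ℕ} (hφ : StrictMono φ) :
    ∃ ψ : ℕ → ℕ, Tendsto ψ atTop atTop ∧ ∀ n, ψ (φ n) = n := by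
  refine ⟨fun n => Nat.findGreatest (fun m => φ m ≤ n) n, ?_, fun n => ?_⟩
  · refine tendsto_atTop.2 fun m => ?_
    filter_upwards [eventually_ge_atTop (φ m)] with n hn
    exact Nat.le_findGreatest ((hφ.le_apply).trans hn) hn
  · refine le_antisymm ?_ (Nat.le_findGreatest hφ.le_apply le_rfl)
    have h1 : φ (Nat.findGreatest (fun m => φ m ≤ φ n) (φ n)) ≤ φ n :=
      Nat.findGreatest_spec (P := fun m => φ m ≤ φ n) (hφ.le_apply) le_rfl
    exact hφ.le_iff_le.1 h1

end

end LiebThirring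

/-! ### Conclusion for normalized maximizing sequences -/

theorem mainTheorem2 (d : ℕ) (γ : ℝ)
    (hγ : (d = 1 ∧ 1 / 2 < γ) ∨ (2 ≤ d ∧ 0 < γ))
    (N : ℕ) (hN : 1 ≤ N) (V : ℕ → LiebThirring.Space d → ℝ)
    (hV : LiebThirring.IsNormalizedMaximizingSeq γ N V) :
    ∃ (K : ℕ) (M : Fin K → ℕ) (W : Fin K → LiebThirring.Space d → ℝ)
      (x : Fin K → ℕ → LiebThirring.Space d),
      1 ≤ K ∧
      (∀ k, 1 ≤ M k) ∧
      ∑ k, M k = N ∧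
      (∀ k, LiebThirring.bestConst d γ (M k) = LiebThirring.bestConst d γ N) ∧
      (∀ k, LiebThirring.IsMaximizer γ (M k) (W k)) ∧
      (∀ k, M k < N → LiebThirring.level (W k) (M k + 1) = 0) ∧
      (∀ k, LiebThirring.IsMaximizer γ N (W k)) ∧
      (∀ k k', k ≠ k' → Tendsto (fun n => ‖x k n - x k' n‖) atTop atTop) ∧
      ∃ φ : ℕ → ℕ, StrictMono φ ∧
        Tendsto (fun n => eLpNorm
            (fun y => V (φ n) y - ∑ k, W k (y - x k (φ n)))
            (ENNReal.ofReal (γ + (d : ℝ) / 2)) volume)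
          atTop (𝓝 0) := by
  have hd : 1 ≤ d := by omega
  have hγ0 : 0 < γ := by rcases hγ with h | h <;> linarith [h.2]
  have hp : 1 < γ + (d : ℝ) / 2 := by
    rcases hγ with ⟨h1, h2⟩ | ⟨h1, h2⟩
    · rw [h1]
      push_cast
      linarith
    · have : (2 : ℝ) ≤ d := by exact_mod_cast h1
      linarith
  obtain ⟨hVp, hVm, hS⟩ := hV
  have hVm1 : Tendsto (fun n => LiebThirring.powInt (γ + (d : ℝ) / 2) (V n)) atTop (𝓝 1) :=
    tendsto_const_nhds.congr fun n => (hVm n).symm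
  rw [← mul_one (LiebThirring.bestConst d γ N)] at hS
  have hfin := (LiebThirring.exists_bubble hd hγ0 hp hN hVp one_ne_zero ENNReal.one_ne_top hVm1
    hS).1
  obtain ⟨K, M, W, x, φ, hφ, hK, hM, hsum, hL, hW, hdiv, hconv⟩ :=
    LiebThirring.exists_bubbles hd hγ0 hp N hN hVp one_ne_zero ENNReal.one_ne_top hVm1 hS
  -- The centres are indexed by the extracted sequence, but must be defined for every original
  -- index; composing with a left inverse of φ that tends to infinity keeps their mutual separation.
  obtain ⟨ψ, hψ, hψφ⟩ := LiebThirring.exists_tendsto_leftInverse hφ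
  have hMN : ∀ k, M k ≤ N := fun k =>
    hsum ▸ Finset.single_le_sum (f := M) (fun j _ => Nat.zero_le _) (Finset.mem_univ k)
  have hmax := fun k => (hW k).of_bestConst_eq hd hγ0 (hMN k) (hL k) hfin
  refine ⟨K, M, W, fun k n => x k (ψ n), hK, hM, hsum, hL, hW, fun k => (hmax k).2,
    fun k => (hmax k).1, fun k k' h => (hdiv k k' h).comp hψ, φ, hφ, ?_⟩
  simpa only [hψφ] using hconv
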